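/- **Setting.** Let $\Omega=\mathbb T^2\times(0,1)$, where $\mathbb T^2$ is the flat torus with periods $\ell_1,\ell_2>0$; functions on $\Omega$ are functions of $x\in\mathbb R^2\times(0,1)$ that are periodic in $(x_1,x_2)$. Let $d(x)=\min(x_3,1-x_3)$ be the distance to $\partial\Omega$, and let $w$ be a measurable function on $\Omega$ with $K^{-1}d\le w\le Kd$ for a constant $K>0$. Let $\alpha>0$ and let $b\ge 0$ be an integer. Let $F$ be a field on $\Omega$ with finitely many real components, $|\cdot|$ the Euclidean length, and $DF=(\partial_sF^i)_{i,s}$. All derivatives are weak derivatives of locally integrable functions. For a multi-index $m=(m_1,m_2,m_3)$ put $\partial^m=\partial_1^{m_1}\partial_2^{m_2}\partial_3^{m_3}$ and define $$\|F\|_{X^{\alpha,b}}^2=\sum_{|m|\le b}\int_\Omega w^{\alpha+m_3}|\partial^mF|^2\,dx .$$ Let $\eta$ be a weakly differentiable map such that $\eta(x)-x$ is periodic in $(x_1,x_2)$. Put $A=[D\eta]^{-1}$, $J=\det D\eta$, $[D_\eta G]^i_r=\sum_sA^s_r\,\partial_sG^i$, and $$\|F\|_{Y^{\alpha,b}}^2=\sum_{|m|\le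 b}\int_\Omega w^{1+\alpha+m_3}J^{-1/\alpha}|D_\eta\partial^mF|^2\,dx,\qquad \|F\|_{Z^{\alpha,b}}^2=\sum_{|m|\le b}\int_\Omega w^{1+\alpha+m_3}J^{-1/\alpha}|\partial^mF|^2\,dx .$$ The spaces $X^{\alpha,b},Y^{\alpha,b},Z^{\alpha,b}$ consist of the $F$ for which the weak derivatives that occur exist and the norm is finite (for $Y^{\alpha,b}$ it is enough that $DF$, rather than $F$, is periodic). For real $s\ge0$, $H^s=H^s(\Omega)$ is the Sobolev–Slobodeckij space, with norm given by the $L^2$ norms of $\partial^mF$, $|m|\le\lfloor s\rfloor$, and, if $s\notin\mathbb Z$, the Gagliardo seminorms of order $s-\lfloor s\rfloor$ of $\partial^mF$, $|m|=\lfloor s\rfloor$. **Lemma 3.1.** 1. If $b\ge\lceil\alpha\rceil$, then $X^{\alpha,b}\subset H^{(b-\alpha)/2}$ and $\|F\|_{H^{(b-\alpha)/2}}\le C\|F\|_{X^{\alpha,b}}$ for all $F\in X^{\alpha,b}$. 2. If $b\ge\lfloor\alpha\rfloor+4$, then $X^{\alpha,b}\subset L^\infty(\Omega)$ and $\|F\|_{L^\infty}\le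 C\|F\|_{X^{\alpha,b}}$ for all $F\in X^{\alpha,b}$. Suppose in addition that $\|A-I\|_{L^\infty}\le 1/8$, i.e. the entries of $A-I$ are bounded by $1/8$ a.e. 3. If $b\ge\lceil\alpha\rceil+1$, then $DF\in H^{(b-\alpha-1)/2}$ and $\|DF\|_{H^{(b-\alpha-1)/2}}\le C\|F\|_{Y^{\alpha,b}}$ for all $F\in Y^{\alpha,b}$, and $F\in H^{(b-\alpha-1)/2}$ and $\|F\|_{H^{(b-\alpha-1)/2}}\le C\|F\|_{Z^{\alpha,b}}$ for all $F\in Z^{\alpha,b}$. 4. If $b\ge\lfloor\alpha\rfloor+5$, then $DF\in L^\infty(\Omega)$ and $\|DF\|_{L^\infty}\le C\|F\|_{Y^{\alpha,b}}$ for all $F\in Y^{\alpha,b}$, and $F\in L^\infty(\Omega)$ and $\|F\|_{L^\infty}\le C\|F\|_{Z^{\alpha,b}}$ for all $F\in Z^{\alpha,b}$. The constants $C$ depend only on $\alpha$, $b$, $K$, $\ell_1,\ell_2$ and the number of components of $F$; in particular they do not depend on $w$, $\eta$ or $F$. -/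

import Mathlib

open MeasureTheory Set
open scoped ENNReal NNReal ContDiff

noncomputable section

namespace VacuumEmbedding

/-- Three-dimensional Euclidean space. Coordinates `0, 1` are tangential, coordinate `2` is normal. -/
abbrev Space : Type := EuclideanSpace ℝ (Fin 3)

/-- The `i`-th standard basis vector. -/
def basisVec (i : Fin 3) : Space := EuclideanSpace.single i (1 : ℝ)

/-- The strip `ℝ² × (0,1)`, the universal cover of `Ω = 𝕋² × (0,1)`. Functions on `Ω` are treated as
functions on the strip that are periodic in the first two coordinates. -/
def strip : Set Space := {x | 0 < x 2 ∧ x 2 < 1}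

/-- The fundamental cell `(0,ℓ₁) × (0,ℓ₂) × (0,1)` of `Ω`; integrals over `Ω` are integrals over it. -/
def cell (ℓ : Fin 2 → ℝ) : Set Space :=
  {x | (0 < x 0 ∧ x 0 < ℓ 0) ∧ (0 < x 1 ∧ x 1 < ℓ 1) ∧ (0 < x 2 ∧ x 2 < 1)}

/-- Periodicity in the two tangential variables, almost everywhere on the strip. -/
def AEPeriodic (ℓ : Fin 2 → ℝ) (f : Space → ℝ) : Prop :=
  ∀ j : Fin 2, ∀ᵐ x ∂(volume.restrict strip), f (x + ℓ j • basisVec j.castSucc) = f x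

/-- Distance to the boundary `{x₃ = 0} ∪ {x₃ = 1}` of the strip. -/
def bdryDist (x : Space) : ℝ := min (x 2) (1 - x 2)

/-! ### Weak derivatives -/

/-- Classical partial derivative. -/
def partialD (i : Fin 3) (φ : Space → ℝ) : Space → ℝ := fun x => fderiv ℝ φ x (basisVec i)

/-- Classical iterated partial derivative `∂₁^{m₁} ∂₂^{m₂} ∂₃^{m₃} φ`. -/
def multiD (m : Fin 3 → ℕ) (φ : Space → ℝ) : Space → ℝ :=
  (partialD 0)^[m 0] ((partialD 1)^[m 1] ((partialD 2)^[m 2] φ))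

/-- The order `|m|` of a multi-index. -/
def order (m : Fin 3 → ℕ) : ℕ := ∑ i, m i

/-- The multi-index `m + e_s`. -/
def incr (m : Fin 3 → ℕ) (s : Fin 3) : Fin 3 → ℕ := m + Pi.single s 1

/-- `g` is the weak derivative `∂^m f` on the strip. -/
def HasWeakD (m : Fin 3 → ℕ) (f g : Space → ℝ) : Prop :=
  LocallyIntegrableOn f strip volume ∧ LocallyIntegrableOn g strip volume ∧
    ∀ φ : Space → ℝ, ContDiff ℝ ∞ φ → HasCompactSupport φ → tsupport φ ⊆ strip →
      ∫ x in strip, f x * multiD m φ x = (-1 : ℝ) ^ order m * ∫ x in strip, g x * φ x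

open Classical in
/-- The weak derivative `∂^m f` on the strip (unique up to null sets; `0` if there is none). -/
def weakD (m : Fin 3 → ℕ) (f : Space → ℝ) : Space → ℝ :=
  if h : ∃ g, HasWeakD m f g then h.choose else 0

/-- The multi-indices of order exactly `k`. -/
def multiIdx (k : ℕ) : Finset (Fin 3 → ℕ) := Finset.Nat.antidiagonalTuple 3 k

variable {ι : Type*} [Fintype ι]

/-- The weak gradient `[DF]ⁱ_s = ∂_s Fⁱ` of a field `F` with components `Fⁱ`. -/
def grad (F : ι → Space → ℝ) : ι × Fin 3 → Space → ℝ := fun p => weakD (incr 0 p.2) (F p.1)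

/-- Pointwise Euclidean length `|F(x)|` of a field. -/
def fieldNorm (F : ι → Space → ℝ) : Space → ℝ := fun x => Real.sqrt (∑ i, (F i x) ^ 2)

/-! ### The Sobolev space `H^s(Ω)`, real `s ≥ 0` (Sobolev–Slobodeckij) -/

/-- Squared Gagliardo seminorm of order `σ ∈ (0,1)` of a periodic function. The second variable runs
over the whole cover, i.e. the kernel on `Ω × Ω` is the periodization of `|x - y|^{-3-2σ}`, which is
comparable to the power `-3-2σ` of the distance in `Ω`, and bounds it from above. -/
def gagliardoSq (ℓ : Fin 2 → ℝ) (σ : ℝ) (g : Space → ℝ) : ℝ≥0∞ :=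
  ∫⁻ x in cell ℓ, ∫⁻ y in strip, ENNReal.ofReal ((g x - g y) ^ 2 / ‖x - y‖ ^ (3 + 2 * σ))

/-- The norm of `H^s(Ω)`: derivatives up to order `⌊s⌋` in `L²`, and, for non-integer `s`, the
Gagliardo seminorms of order `s - ⌊s⌋` of the derivatives of order `⌊s⌋`. -/
def sobolevNorm (ℓ : Fin 2 → ℝ) (s : ℝ) (F : ι → Space → ℝ) : ℝ≥0∞ :=
  (∑ i, ((∑ k ∈ Finset.range (⌊s⌋₊ + 1), ∑ m ∈ multiIdx k,
        ∫⁻ x in cell ℓ, ENNReal.ofReal ((weakD m (F i) x) ^ 2)) +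
      (if Int.fract s = 0 then 0
        else ∑ m ∈ multiIdx ⌊s⌋₊, gagliardoSq ℓ (Int.fract s) (weakD m (F i))))) ^ (1 / 2 : ℝ)

/-- Membership in `H^s(Ω)`, for `s ≥ 0`. -/
def MemSobolevΩ (ℓ : Fin 2 → ℝ) (s : ℝ) (F : ι → Space → ℝ) : Prop :=
  (∀ i, AEPeriodic ℓ (F i)) ∧
  (∀ i, ∀ m, order m ≤ ⌊s⌋₊ → ∃ g, HasWeakD m (F i) g) ∧
  sobolevNorm ℓ s F < ⊤

/-! ### The weight and the flow map -/

/-- The enthalpy profile `w` on `Ω`, comparable to the distance to the boundary with constant `K`. -/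
structure IsWeight (ℓ : Fin 2 → ℝ) (K : ℝ) (w : Space → ℝ) : Prop where
  measurable : Measurable w
  periodic : AEPeriodic ℓ w
  lower : ∀ x ∈ strip, K⁻¹ * bdryDist x ≤ w x
  upper : ∀ x ∈ strip, w x ≤ K * bdryDist x

/-- A weakly differentiable flow map of `Ω`: `η - id` is periodic. -/
structure IsFlowMap (ℓ : Fin 2 → ℝ) (η : Fin 3 → Space → ℝ) : Prop where
  periodic : ∀ i, AEPeriodic ℓ (fun x => η i x - x i)
  weakDiff : ∀ i s, ∃ g, HasWeakD (incr 0 s) (η i) g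

/-- The deformation tensor `[Dη]ⁱ_j = ∂_j ηⁱ`. -/
def deformation (η : Fin 3 → Space → ℝ) (x : Space) : Matrix (Fin 3) (Fin 3) ℝ :=
  Matrix.of fun i j => grad η (i, j) x

/-- `A = [Dη]⁻¹`; the entry `A s r` is `A^s_r`. -/
def invDeformation (η : Fin 3 → Space → ℝ) (x : Space) : Matrix (Fin 3) (Fin 3) ℝ :=
  (deformation η x)⁻¹

/-- `J = det Dη`. -/
def jac (η : Fin 3 → Space → ℝ) (x : Space) : ℝ := (deformation η x).det

/-- `‖A - I‖_∞ ≤ 1/8`, entrywise. (A singular `Dη(x)` is excluded: there the matrix inverse is `0`.) -/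
def NearIdentity (ℓ : Fin 2 → ℝ) (η : Fin 3 → Space → ℝ) : Prop :=
  ∀ᵐ x ∂(volume.restrict (cell ℓ)), ∀ s r,
    |(invDeformation η x - (1 : Matrix (Fin 3) (Fin 3) ℝ)) s r| ≤ 1 / 8

/-! ### The weighted spaces -/

/-- The norm of `X^{α,b}`. -/
def normX (ℓ : Fin 2 → ℝ) (w : Space → ℝ) (α : ℝ) (b : ℕ) (F : ι → Space → ℝ) : ℝ≥0∞ :=
  (∑ k ∈ Finset.range (b + 1), ∑ m ∈ multiIdx k,
    ∫⁻ x in cell ℓ, ENNReal.ofReal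
      (w x ^ (α + (m 2 : ℝ)) * ∑ i, (weakD m (F i) x) ^ 2)) ^ (1 / 2 : ℝ)

/-- Membership in `X^{α,b}`. -/
def MemX (ℓ : Fin 2 → ℝ) (w : Space → ℝ) (α : ℝ) (b : ℕ) (F : ι → Space → ℝ) : Prop :=
  (∀ i, AEPeriodic ℓ (F i)) ∧
  (∀ i, ∀ m, order m ≤ b → ∃ g, HasWeakD m (F i) g) ∧
  normX ℓ w α b F < ⊤

/-- The component `[D_η ∂^m F]ⁱ_r = A^s_r ∂_s ∂^m Fⁱ`. -/
def lieGrad (η : Fin 3 → Space → ℝ) (m : Fin 3 → ℕ) (f : Space → ℝ) (r : Fin 3) : Space → ℝ :=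
  fun x => ∑ s, invDeformation η x s r * weakD (incr m s) f x

/-- The norm of `Y^{α,b}` (with respect to the flow map `η`). -/
def normY (ℓ : Fin 2 → ℝ) (w : Space → ℝ) (η : Fin 3 → Space → ℝ) (α : ℝ) (b : ℕ)
    (F : ι → Space → ℝ) : ℝ≥0∞ :=
  (∑ k ∈ Finset.range (b + 1), ∑ m ∈ multiIdx k,
    ∫⁻ x in cell ℓ, ENNReal.ofReal
      (w x ^ (1 + α + (m 2 : ℝ)) * jac η x ^ (-1 / α) *
        ∑ i, ∑ r, (lieGrad η m (F i) r x) ^ 2)) ^ (1 / 2 : ℝ)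

/-- Membership in `Y^{α,b}`. Only the gradient is required to be periodic, so that maps such as `η`
itself are admitted besides functions on `Ω`. -/
def MemY (ℓ : Fin 2 → ℝ) (w : Space → ℝ) (η : Fin 3 → Space → ℝ) (α : ℝ) (b : ℕ)
    (F : ι → Space → ℝ) : Prop :=
  (∀ p, AEPeriodic ℓ (grad F p)) ∧
  (∀ i, ∀ m, order m ≤ b → ∀ s, ∃ g, HasWeakD (incr m s) (F i) g) ∧
  normY ℓ w η α b F < ⊤

/-- The norm of `Z^{α,b}` (with respect to the flow map `η`). -/
def normZ (ℓ : Fin 2 → ℝ) (w : Space → ℝ) (η : Fin 3 → Space → ℝ) (α : ℝ) (b : ℕ)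
    (F : ι → Space → ℝ) : ℝ≥0∞ :=
  (∑ k ∈ Finset.range (b + 1), ∑ m ∈ multiIdx k,
    ∫⁻ x in cell ℓ, ENNReal.ofReal
      (w x ^ (1 + α + (m 2 : ℝ)) * jac η x ^ (-1 / α) *
        ∑ i, (weakD m (F i) x) ^ 2)) ^ (1 / 2 : ℝ)

/-- Membership in `Z^{α,b}`. -/
def MemZ (ℓ : Fin 2 → ℝ) (w : Space → ℝ) (η : Fin 3 → Space → ℝ) (α : ℝ) (b : ℕ)
    (F : ι → Space → ℝ) : Prop :=
  (∀ i, AEPeriodic ℓ (F i)) ∧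
  (∀ i, ∀ m, order m ≤ b → ∃ g, HasWeakD m (F i) g) ∧
  normZ ℓ w η α b F < ⊤

/-- The field `F` is in `L^∞(Ω)` with `‖F‖_∞ ≤ R`. -/
def LInftyBound (ℓ : Fin 2 → ℝ) (F : ι → Space → ℝ) (R : ℝ≥0∞) : Prop :=
  (∀ i, MemLp (F i) ⊤ (volume.restrict (cell ℓ))) ∧
  eLpNorm (fieldNorm F) ⊤ (volume.restrict (cell ℓ)) ≤ R

end VacuumEmbedding

end

namespace VacuumEmbedding

/-! ### Classical derivatives of test functions -/

/-! Write `d` for the distance to the boundary and call the integral of `d^γ |g|²` over the cell the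
energy of `g` with exponent `γ`. Since `w` is comparable to `d`, the norm of `X^{α,b}` bounds the
energy of `∂^m F` with exponent `α + m₃` for every `|m| ≤ b`. Everything else is a trade of unused
derivatives for smaller exponents.

The trade is Hardy's inequality (`hardy`): for `γ ≥ 0` the energy of `g` with exponent `γ` is
bounded by that of `∂₃g` with exponent `γ + 2` plus a harmless interior term. Passing from `m` to `m
+ e₃` gains two in the exponent but the norm charges one for the extra normal derivative, so each
unused derivative lowers the exponent by one. Hence (`WeightedFamily.energy_lower`) the energy of
`∂^m F` with exponent `γ` is under control whenever `γ ≥ 0` and `γ ≥ α + m₃ + |m| - b`.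

For the Sobolev bound put `s = (b - α)/2`. If `|m| ≤ ⌊s⌋` then `m₃ + |m| ≤ b - α`, and exponent `0`
is reached: these derivatives are in `L²`. If `s` is not an integer, put `σ = s - ⌊s⌋`; derivatives
of order `⌊s⌋ + 1` reach the exponent `2 - 2σ`. An `L²` function whose gradient has finite energy
with exponent `2 - 2σ` has finite Gagliardo seminorm of order `σ` (`gagliardoSq_le`): an increment
is taken along a detour that first moves away from the boundary, so that at parameter `θ` the
distance is at least `θ|z|`, and integrating the resulting kernel in `z` and `θ` yields the power
`d^{2-2σ}`.

For the `L^∞` bound, integration along the three coordinate directions bounds a function by the `L¹`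
norms of its mixed derivatives `∂^m`, `m ∈ {0,1}³` (`WeightedFamily.enorm_le_mixed`). For these `m₃
+ |m| ≤ 4`, so with `b ≥ ⌊α⌋ + 4` an exponent `γ < 1` is reached; as `d^{-γ}` is integrable,
Cauchy–Schwarz turns energies into `L¹` norms.

For `Y` and `Z`, closeness of `A` to the identity gives `J ≤ 2` and lets `DF` be recovered pointwise
from `D_η F`. The same energy bounds then hold with `α + 1` in place of `α`, for `DF` and `F`
respectively.

The analytic basis is a fundamental theorem of calculus for weak derivatives along translates
(`WeakDir.sub_eq_integral`) and the fact that translating a periodic density does not increase its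
integral over the cell (`lintegral_cell_translate_le`). -/

theorem contDiff_partialD {φ : Space → ℝ} (hφ : ContDiff ℝ ∞ φ) (i : Fin 3) :
    ContDiff ℝ ∞ (partialD i φ) :=
  (hφ.fderiv_right (m := ∞) (by simp)).clm_apply contDiff_const

theorem tsupport_partialD_subset (φ : Space → ℝ) (i : Fin 3) :
    tsupport (partialD i φ) ⊆ tsupport φ :=
  tsupport_fderiv_apply_subset ℝ (basisVec i)

theorem hasCompactSupport_partialD {φ : Space → ℝ} (hφ : HasCompactSupport φ) (i : Fin 3) :
    HasCompactSupport (partialD i φ) :=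
  hφ.fderiv_apply ℝ (basisVec i)

/-- Symmetry of the second derivative. It makes the fixed order of differentiation in `multiD`
irrelevant, so that weak derivatives can be peeled off in any direction. -/
theorem partialD_comm {φ : Space → ℝ} (hφ : ContDiff ℝ ∞ φ) (i j : Fin 3) :
    partialD i (partialD j φ) = partialD j (partialD i φ) := by
  have key : ∀ (a b : Fin 3) (x : Space), partialD a (partialD b φ) x
      = fderiv ℝ (fderiv ℝ φ) x (basisVec a) (basisVec b) := by
    intro a b x
    have hd : DifferentiableAt ℝ (fderiv ℝ φ) x :=
      ((hφ.fderiv_right (m := ∞) (by simp)).differentiable (by simp)) x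
    unfold partialD
    rw [fderiv_clm_apply hd (differentiableAt_const _)]
    simp
  funext x
  rw [key, key]
  exact (hφ.contDiffAt.isSymmSndFDerivAt (by simpa using (mod_cast le_top : ((2 : ℕ∞) : WithTop ℕ∞) ≤ (⊤ : ℕ∞)))) _ _

theorem contDiff_iterate_partialD {φ : Space → ℝ} (hφ : ContDiff ℝ ∞ φ) (i : Fin 3) (n : ℕ) :
    ContDiff ℝ ∞ ((partialD i)^[n] φ) := by
  induction n with
  | zero => exact hφ
  | succ n ih => rw [Function.iterate_succ_apply']; exact contDiff_partialD ih i

theorem partialD_iterate_comm {φ : Space → ℝ} (hφ : ContDiff ℝ ∞ φ) (i j : Fin 3) (n : ℕ) :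
    partialD i ((partialD j)^[n] φ) = (partialD j)^[n] (partialD i φ) := by
  induction n with
  | zero => rfl
  | succ n ih =>
    rw [Function.iterate_succ_apply', Function.iterate_succ_apply',
      partialD_comm (contDiff_iterate_partialD hφ j n), ih]

theorem contDiff_multiD {φ : Space → ℝ} (hφ : ContDiff ℝ ∞ φ) (m : Fin 3 → ℕ) :
    ContDiff ℝ ∞ (multiD m φ) :=
  contDiff_iterate_partialD (contDiff_iterate_partialD (contDiff_iterate_partialD hφ _ _) _ _) _ _

theorem multiD_partialD {φ : Space → ℝ} (hφ : ContDiff ℝ ∞ φ) (m : Fin 3 → ℕ) (s : Fin 3) :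
    multiD m (partialD s φ) = partialD s (multiD m φ) := by
  unfold multiD
  rw [partialD_iterate_comm (contDiff_iterate_partialD (contDiff_iterate_partialD hφ _ _) _ _),
    partialD_iterate_comm (contDiff_iterate_partialD hφ _ _), partialD_iterate_comm hφ]

theorem multiD_incr {φ : Space → ℝ} (hφ : ContDiff ℝ ∞ φ) (m : Fin 3 → ℕ) (s : Fin 3) :
    multiD (incr m s) φ = partialD s (multiD m φ) := by
  rw [← multiD_partialD hφ]
  unfold multiD incr
  fin_cases s
  · simp only [Fin.zero_eta, Pi.add_apply, Pi.single_eq_same, ne_eq, one_ne_zero,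
      not_false_eq_true, Pi.single_eq_of_ne, add_zero, Fin.reduceEq]
    rw [Function.iterate_succ_apply,
      partialD_iterate_comm (contDiff_iterate_partialD hφ _ _), partialD_iterate_comm hφ]
  · simp only [Fin.mk_one, Pi.add_apply, Pi.single_eq_same, ne_eq, zero_ne_one,
      not_false_eq_true, Pi.single_eq_of_ne, add_zero, Fin.reduceEq]
    rw [Function.iterate_succ_apply, partialD_iterate_comm hφ]
  · simp only [Fin.reduceFinMk, Pi.add_apply, Pi.single_eq_same, ne_eq,
      not_false_eq_true, Pi.single_eq_of_ne, add_zero, Fin.reduceEq]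
    rw [Function.iterate_succ_apply]

theorem multiD_zero (φ : Space → ℝ) : multiD 0 φ = φ := rfl

theorem tsupport_iterate_partialD_subset (φ : Space → ℝ) (i : Fin 3) (n : ℕ) :
    tsupport ((partialD i)^[n] φ) ⊆ tsupport φ := by
  induction n with
  | zero => exact subset_rfl
  | succ n ih =>
    rw [Function.iterate_succ_apply']; exact (tsupport_partialD_subset _ _).trans ih

theorem tsupport_multiD_subset (φ : Space → ℝ) (m : Fin 3 → ℕ) :
    tsupport (multiD m φ) ⊆ tsupport φ :=
  (tsupport_iterate_partialD_subset _ _ _).trans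
    ((tsupport_iterate_partialD_subset _ _ _).trans (tsupport_iterate_partialD_subset _ _ _))

theorem hasCompactSupport_multiD {φ : Space → ℝ} (hφ : HasCompactSupport φ) (m : Fin 3 → ℕ) :
    HasCompactSupport (multiD m φ) :=
  hφ.mono' ((subset_tsupport _).trans (tsupport_multiD_subset φ m))

theorem partialD_comp_add_right (φ : Space → ℝ) (v : Space) (i : Fin 3) :
    partialD i (fun x => φ (x + v)) = fun x => partialD i φ (x + v) := by
  funext x
  simp only [partialD, fderiv_comp_add_right]

theorem iterate_partialD_comp_add_right (φ : Space → ℝ) (v : Space) (i : Fin 3) (n : ℕ) :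
    (partialD i)^[n] (fun x => φ (x + v)) = fun x => (partialD i)^[n] φ (x + v) := by
  induction n with
  | zero => rfl
  | succ n ih => rw [Function.iterate_succ_apply', ih, partialD_comp_add_right,
      Function.iterate_succ_apply']

theorem multiD_comp_add_right (φ : Space → ℝ) (v : Space) (m : Fin 3 → ℕ) :
    multiD m (fun x => φ (x + v)) = fun x => multiD m φ (x + v) := by
  unfold multiD
  rw [iterate_partialD_comp_add_right, iterate_partialD_comp_add_right,
    iterate_partialD_comp_add_right]

/-! ### Multi-indices -/

theorem order_incr (m : Fin 3 → ℕ) (s : Fin 3) : order (incr m s) = order m + 1 := by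
  simp [order, incr, Finset.sum_add_distrib]

theorem order_zero : order 0 = 0 := by simp [order]

theorem mem_multiIdx {k : ℕ} {m : Fin 3 → ℕ} : m ∈ multiIdx k ↔ order m = k :=
  Finset.Nat.mem_antidiagonalTuple

theorem incr_apply_two_le (m : Fin 3 → ℕ) (s : Fin 3) : incr m s 2 ≤ m 2 + 1 := by
  simp only [incr, Pi.add_apply]
  have : (Pi.single s 1 : Fin 3 → ℕ) 2 ≤ 1 := by fin_cases s <;> simp
  omega

theorem incr_two_apply_two (m : Fin 3 → ℕ) : incr m 2 2 = m 2 + 1 := by simp [incr]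

theorem apply_le_order (m : Fin 3 → ℕ) (s : Fin 3) : m s ≤ order m :=
  Finset.single_le_sum (fun _ _ => Nat.zero_le _) (Finset.mem_univ s)

/-! ### Weak derivatives -/

theorem isOpen_strip : IsOpen strip := by
  have h : Continuous fun x : Space => x 2 := by fun_prop
  exact (isOpen_lt continuous_const h).inter (isOpen_lt h continuous_const)

theorem measurableSet_strip : MeasurableSet strip := isOpen_strip.measurableSet

theorem cell_subset_strip (ℓ : Fin 2 → ℝ) : cell ℓ ⊆ strip := fun _ hx => hx.2.2

theorem isOpen_cell (ℓ : Fin 2 → ℝ) : IsOpen (cell ℓ) := by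
  have h (i : Fin 3) : Continuous fun x : Space => x i := by fun_prop
  exact ((isOpen_lt continuous_const (h 0)).inter (isOpen_lt (h 0) continuous_const)).inter
    (((isOpen_lt continuous_const (h 1)).inter (isOpen_lt (h 1) continuous_const)).inter
      ((isOpen_lt continuous_const (h 2)).inter (isOpen_lt (h 2) continuous_const)))

theorem measurableSet_cell (ℓ : Fin 2 → ℝ) : MeasurableSet (cell ℓ) :=
  (isOpen_cell ℓ).measurableSet

theorem ae_cell_of_ae_strip {ℓ : Fin 2 → ℝ} {p : Space → Prop}
    (h : ∀ᵐ x ∂(volume.restrict strip), p x) : ∀ᵐ x ∂(volume.restrict (cell ℓ)), p x :=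
  ae_mono (Measure.restrict_mono (cell_subset_strip ℓ) le_rfl) h

theorem HasWeakD.ae_eq {m : Fin 3 → ℕ} {f g g' : Space → ℝ} (h : HasWeakD m f g)
    (h' : HasWeakD m f g') : g =ᵐ[volume.restrict strip] g' := by
  have key : ∀ᵐ x ∂volume, x ∈ strip → (g - g') x = 0 := by
    refine isOpen_strip.ae_eq_zero_of_integral_contDiff_smul_eq_zero (h.2.1.sub h'.2.1) ?_
    intro φ hφ hc hs
    have e := (h.2.2 φ hφ hc hs).symm.trans (h'.2.2 φ hφ hc hs)
    have e2 : ∫ x in strip, g x * φ x = ∫ x in strip, g' x * φ x :=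
      mul_left_cancel₀ (pow_ne_zero _ (by norm_num)) e
    have hi : ∀ {u : Space → ℝ}, LocallyIntegrableOn u strip volume →
        IntegrableOn (fun x => u x * φ x) strip volume := by
      intro u hu
      have h1 : IntegrableOn (fun x => u x * φ x) (tsupport φ) volume :=
        (hu.integrableOn_compact_subset hs hc).mul_continuousOn hφ.continuous.continuousOn hc
      refine IntegrableOn.of_forall_sdiff_eq_zero h1 measurableSet_strip ?_
      intro x hx
      simp [image_eq_zero_of_notMem_tsupport hx.2]
    rw [← setIntegral_eq_integral_of_forall_compl_eq_zero (s := strip)]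
    · simp only [Pi.sub_apply, smul_eq_mul]
      have : ∀ x, φ x * (g x - g' x) = g x * φ x - g' x * φ x := fun x => by ring
      simp_rw [this]
      rw [integral_sub (hi h.2.1) (hi h'.2.1), e2, sub_self]
    · intro x hx
      rw [image_eq_zero_of_notMem_tsupport (fun hx' => hx (hs hx')), zero_smul]
  rw [Filter.EventuallyEq, ae_restrict_iff' measurableSet_strip]
  filter_upwards [key] with x hx hxs
  exact sub_eq_zero.1 (hx hxs)

theorem HasWeakD.congr {m : Fin 3 → ℕ} {f g f' g' : Space → ℝ} (h : HasWeakD m f g)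
    (hf : f =ᵐ[volume.restrict strip] f') (hg : g =ᵐ[volume.restrict strip] g') :
    HasWeakD m f' g' := by
  have aux : ∀ {u u' : Space → ℝ}, u =ᵐ[volume.restrict strip] u' →
      LocallyIntegrableOn u strip volume → LocallyIntegrableOn u' strip volume := by
    intro u u' huu hu
    rw [locallyIntegrableOn_iff isOpen_strip.isLocallyClosed] at hu ⊢
    intro k hk hc
    exact (hu k hk hc).congr (ae_mono (Measure.restrict_mono hk le_rfl) huu)
  refine ⟨aux hf h.1, aux hg h.2.1, fun φ h1 h2 h3 => ?_⟩
  have e1 : ∫ x in strip, f x * multiD m φ x = ∫ x in strip, f' x * multiD m φ x :=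
    integral_congr_ae (hf.mono fun x hx => by simp only [hx])
  have e2 : ∫ x in strip, g x * φ x = ∫ x in strip, g' x * φ x :=
    integral_congr_ae (hg.mono fun x hx => by simp only [hx])
  rw [← e1, ← e2]
  exact h.2.2 φ h1 h2 h3

theorem hasWeakD_weakD {m : Fin 3 → ℕ} {f : Space → ℝ} (h : ∃ g, HasWeakD m f g) :
    HasWeakD m f (weakD m f) := by
  rw [weakD, dif_pos h]; exact h.choose_spec

theorem HasWeakD.weakD_ae_eq {m : Fin 3 → ℕ} {f g : Space → ℝ} (h : HasWeakD m f g) :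
    weakD m f =ᵐ[volume.restrict strip] g :=
  (hasWeakD_weakD ⟨g, h⟩).ae_eq h

theorem hasWeakD_zero {f : Space → ℝ} (h : LocallyIntegrableOn f strip volume) :
    HasWeakD 0 f f :=
  ⟨h, h, fun φ _ _ _ => by simp [multiD_zero, order_zero]⟩

/-- If `∂^m f` and `∂^{m + e_s} f` exist then the latter is `∂_s` of the former. -/
theorem HasWeakD.of_incr {m : Fin 3 → ℕ} {s : Fin 3} {f p g : Space → ℝ} (hp : HasWeakD m f p)
    (hg : HasWeakD (incr m s) f g) : HasWeakD (incr 0 s) p g := by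
  refine ⟨hp.2.1, hg.2.1, fun φ h1 h2 h3 => ?_⟩
  have e1 := hp.2.2 (partialD s φ) (contDiff_partialD h1 s) (hasCompactSupport_partialD h2 s)
    ((tsupport_partialD_subset φ s).trans h3)
  have e2 := hg.2.2 φ h1 h2 h3
  rw [multiD_partialD h1, ← multiD_incr h1, e2, order_incr, pow_succ, mul_assoc] at e1
  have e3 := mul_left_cancel₀ (pow_ne_zero _ (by norm_num)) e1
  rw [multiD_incr h1, multiD_zero, order_incr, order_zero, ← e3]
  simp

/-- If `∂_s f` and `∂^{m + e_s} f` exist then the latter is `∂^m` of the former. -/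
theorem HasWeakD.of_incr' {m : Fin 3 → ℕ} {s : Fin 3} {f p g : Space → ℝ}
    (hp : HasWeakD (incr 0 s) f p) (hg : HasWeakD (incr m s) f g) : HasWeakD m p g := by
  refine ⟨hp.2.1, hg.2.1, fun φ h1 h2 h3 => ?_⟩
  have e1 := hp.2.2 (multiD m φ) (contDiff_multiD h1 m) (hasCompactSupport_multiD h2 m)
    ((tsupport_multiD_subset φ m).trans h3)
  have e2 := hg.2.2 φ h1 h2 h3
  rw [multiD_incr (contDiff_multiD h1 m), multiD_zero, ← multiD_incr h1, e2, order_incr,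
    order_incr, order_zero] at e1
  have : ∫ x in strip, p x * multiD m φ x = -((-1 : ℝ) ^ 1 * ∫ x in strip, p x * multiD m φ x) := by
    ring
  rw [this]
  simp only [zero_add] at e1
  rw [← e1]
  ring

theorem add_mem_strip_iff {v : Space} (hv : v 2 = 0) (x : Space) : x + v ∈ strip ↔ x ∈ strip := by
  simp [strip, hv]

theorem measurePreserving_add_restrict_strip {v : Space} (hv : v 2 = 0) :
    MeasurePreserving (fun x => x + v) (volume.restrict strip) (volume.restrict strip) := by
  have h := (measurePreserving_add_right (volume : Measure Space) v).restrict_preimage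
    measurableSet_strip
  have : (fun x => x + v) ⁻¹' strip = strip := by
    ext x; exact add_mem_strip_iff hv x
  rwa [this] at h

theorem HasWeakD.comp_add {m : Fin 3 → ℕ} {f g : Space → ℝ} (h : HasWeakD m f g) {v : Space}
    (hv : v 2 = 0) : HasWeakD m (fun x => f (x + v)) (fun x => g (x + v)) := by
  have aux : ∀ {u : Space → ℝ}, LocallyIntegrableOn u strip volume →
      LocallyIntegrableOn (fun x => u (x + v)) strip volume := by
    intro u hu
    rw [locallyIntegrableOn_iff isOpen_strip.isLocallyClosed] at hu ⊢
    intro k hk hc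
    have := hu ((fun x => x + v) '' k) (by
      rintro _ ⟨x, hx, rfl⟩; exact (add_mem_strip_iff hv x).2 (hk hx))
      (hc.image (by fun_prop))
    exact ((measurePreserving_add_right (volume : Measure Space) v).integrableOn_image
      (measurableEmbedding_addRight v)).1 this
  refine ⟨aux h.1, aux h.2.1, fun φ h1 h2 h3 => ?_⟩
  have hme := measurableEmbedding_addRight v
  have e := h.2.2 (fun x => φ (x + -v)) (h1.comp (by fun_prop))
    (h2.comp_homeomorph (Homeomorph.addRight (-v))) (by
      have := tsupport_comp_eq_preimage φ (Homeomorph.addRight (-v))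
      have h' : tsupport (fun x => φ (x + -v)) = (fun x => x + -v) ⁻¹' tsupport φ := this
      rw [h']
      intro x hx
      have := h3 hx
      exact (add_mem_strip_iff (v := -v) (by simp [hv]) x).1 this)
  have tr : ∀ u : Space → ℝ, ∫ x in strip, u (x + v) = ∫ x in strip, u x :=
    fun u => (measurePreserving_add_restrict_strip hv).integral_comp hme u
  have e1 := tr fun x => f x * multiD m φ (x + -v)
  have e2 := tr fun x => g x * φ (x + -v)
  simp only [add_neg_cancel_right] at e1 e2
  rw [multiD_comp_add_right, ← e1, ← e2] at e
  exact e

/-- Translating by a period gives a weak derivative of the translated function, which is the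
function itself almost everywhere; uniqueness of weak derivatives does the rest. -/
theorem HasWeakD.aePeriodic {ℓ : Fin 2 → ℝ} {m : Fin 3 → ℕ} {f g : Space → ℝ}
    (h : HasWeakD m f g) (hf : AEPeriodic ℓ f) : AEPeriodic ℓ g := by
  intro j
  have hv : (ℓ j • basisVec j.castSucc) 2 = 0 := by
    fin_cases j <;> simp [basisVec]
  exact ((h.comp_add hv).congr (hf j) (Filter.EventuallyEq.refl _ _)).ae_eq h

/-! ### The fundamental theorem of calculus along lines -/

/-- `G` is the weak derivative of `g` on the strip in the direction `u`. -/
structure WeakDir (u : Space) (g G : Space → ℝ) : Prop where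
  left : LocallyIntegrableOn g strip volume
  right : LocallyIntegrableOn G strip volume
  test : ∀ φ : Space → ℝ, ContDiff ℝ ∞ φ → HasCompactSupport φ → tsupport φ ⊆ strip →
    ∫ x in strip, g x * fderiv ℝ φ x u = - ∫ x in strip, G x * φ x

theorem add_smul_mem_strip {x u : Space} {r t : ℝ} (hx : x ∈ strip) (hxt : x + t • u ∈ strip)
    (hr : 0 ≤ r) (hrt : r ≤ t) : x + r • u ∈ strip := by
  simp only [strip, mem_ofPred_eq, PiLp.add_apply, PiLp.smul_apply, smul_eq_mul] at *
  rcases le_total 0 (u 2) with h | h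
  · have h1 : 0 ≤ r * u 2 := mul_nonneg hr h
    have h2 : r * u 2 ≤ t * u 2 := mul_le_mul_of_nonneg_right hrt h
    constructor <;> linarith [hx.1, hx.2, hxt.1, hxt.2]
  · have h1 : r * u 2 ≤ 0 := mul_nonpos_of_nonneg_of_nonpos hr h
    have h2 : t * u 2 ≤ r * u 2 := mul_le_mul_of_nonpos_right hrt h
    constructor <;> linarith [hx.1, hx.2, hxt.1, hxt.2]

theorem integrable_mul_of_tsupport_subset {g φ : Space → ℝ} (hg : LocallyIntegrableOn g strip volume)
    (hφ : Continuous φ) (hc : HasCompactSupport φ) (hs : tsupport φ ⊆ strip) :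
    Integrable (fun x => g x * φ x) := by
  have h1 : IntegrableOn (fun x => g x * φ x) (tsupport φ) volume :=
    (hg.integrableOn_compact_subset hs hc).mul_continuousOn hφ.continuousOn hc
  rw [← integrableOn_univ]
  exact h1.of_forall_sdiff_eq_zero MeasurableSet.univ
    fun x hx => by simp [image_eq_zero_of_notMem_tsupport hx.2]

theorem WeakDir.test_univ {u : Space} {g G : Space → ℝ} (h : WeakDir u g G) {φ : Space → ℝ}
    (h1 : ContDiff ℝ ∞ φ) (h2 : HasCompactSupport φ) (h3 : tsupport φ ⊆ strip) :
    ∫ x, g x * fderiv ℝ φ x u = - ∫ x, G x * φ x := by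
  rw [← setIntegral_eq_integral_of_forall_compl_eq_zero (s := strip)
      (f := fun x => g x * fderiv ℝ φ x u),
    ← setIntegral_eq_integral_of_forall_compl_eq_zero (s := strip) (f := fun x => G x * φ x)]
  · exact h.test φ h1 h2 h3
  · intro x hx
    rw [image_eq_zero_of_notMem_tsupport (fun hx' => hx (h3 hx')), mul_zero]
  · intro x hx
    rw [image_eq_zero_of_notMem_tsupport (f := fun x => fderiv ℝ φ x u)
      (fun hx' => hx (h3 (tsupport_fderiv_apply_subset ℝ u hx'))), mul_zero]

theorem tsupport_comp_sub (φ : Space → ℝ) (v : Space) :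
    tsupport (fun x => φ (x - v)) = (fun x => x - v) ⁻¹' tsupport φ :=
  tsupport_comp_eq_preimage φ (Homeomorph.subRight v)

theorem hasCompactSupport_comp_sub {φ : Space → ℝ} (h : HasCompactSupport φ) (v : Space) :
    HasCompactSupport (fun x => φ (x - v)) :=
  h.comp_homeomorph (Homeomorph.subRight v)

/-- A segment-swept compact set. -/
theorem isCompact_sweep {k : Set Space} (hk : IsCompact k) (u : Space) (t : ℝ) :
    IsCompact ((fun p : Space × ℝ => p.1 + p.2 • u) '' (k ×ˢ Icc 0 t)) :=
  (hk.prod isCompact_Icc).image (by fun_prop)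

/-- A compact set swept along the segment stays compact inside the strip, where `G` is integrable.
This joint integrability in base point and parameter is what justifies the later uses of Fubini. -/
theorem integrable_sweep {G : Space → ℝ} (hG : Measurable G) (hl : LocallyIntegrableOn G strip volume)
    {k : Set Space} (hk : IsCompact k) {u : Space} {t : ℝ}
    (hs : ∀ x ∈ k, x ∈ strip ∧ x + t • u ∈ strip) :
    Integrable (fun p : Space × ℝ => G (p.1 + p.2 • u))
      ((volume.restrict k).prod (volume.restrict (Ioc 0 t))) := by
  set k' := (fun p : Space × ℝ => p.1 + p.2 • u) '' (k ×ˢ Icc 0 t) with hk'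
  have hk'c : IsCompact k' := isCompact_sweep hk u t
  have hk's : k' ⊆ strip := by
    rintro _ ⟨⟨x, r⟩, ⟨hx, hr⟩, rfl⟩
    exact add_smul_mem_strip (hs x hx).1 (hs x hx).2 hr.1 hr.2
  have hint : IntegrableOn G k' volume := hl.integrableOn_compact_subset hk's hk'c
  have hm : Measurable fun p : Space × ℝ => G (p.1 + p.2 • u) := hG.comp (by fun_prop)
  refine ⟨hm.aestronglyMeasurable, ?_⟩
  rw [HasFiniteIntegral, lintegral_prod_symm _ hm.enorm.aemeasurable]
  calc ∫⁻ r in Ioc 0 t, ∫⁻ x in k, ‖G (x + r • u)‖ₑ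
      ≤ ∫⁻ r in Ioc 0 t, ∫⁻ x in k', ‖G x‖ₑ := by
        refine setLIntegral_mono measurable_const fun r hr => ?_
        have e := ((measurePreserving_add_right (volume : Measure Space) (r • u)).restrict_preimage
          hk'c.measurableSet).lintegral_comp hG.enorm
        rw [← e]
        refine lintegral_mono' (Measure.restrict_mono ?_ le_rfl) le_rfl
        intro x hx
        exact ⟨(x, r), ⟨hx, hr.1.le, hr.2⟩, rfl⟩
    _ < ⊤ := by
        rw [lintegral_const]
        exact ENNReal.mul_lt_top hint.2 (by simp)

theorem integral_deriv_line {φ : Space → ℝ} (hφ : ContDiff ℝ ∞ φ) (u y : Space) {t : ℝ}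
    (ht : 0 ≤ t) :
    ∫ r in Ioc 0 t, fderiv ℝ φ (y - r • u) u = φ y - φ (y - t • u) := by
  have hd : ∀ r : ℝ, HasDerivAt (fun r : ℝ => φ (y - r • u)) (-(fderiv ℝ φ (y - r • u) u)) r := by
    intro r
    have h1 : HasDerivAt (fun r : ℝ => y - r • u) (-u) r := by
      simpa using ((hasDerivAt_id r).smul_const u).const_sub y
    have h2 := ((hφ.differentiable (by simp)) (y - r • u)).hasFDerivAt.comp_hasDerivAt r h1
    simpa [Function.comp_def] using h2
  have hcont : Continuous fun r : ℝ => fderiv ℝ φ (y - r • u) u :=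
    ((hφ.continuous_fderiv (by simp)).comp (by fun_prop)).clm_apply continuous_const
  have := intervalIntegral.integral_eq_sub_of_hasDerivAt (a := 0) (b := t)
    (fun r _ => hd r) (hcont.neg.intervalIntegrable _ _)
  rw [intervalIntegral.integral_neg, intervalIntegral.integral_of_le ht] at this
  simp only [zero_smul, sub_zero] at this
  linarith

/-- Testing both sides with `φ` moves the translations onto `φ`. By Fubini the right side becomes an
average of the weak derivative tested with translates of `φ`; integrating the classical derivative
of `φ` along the segment recovers the left side. The exceptional null set depends on `t`, and no
absolutely continuous representative is needed. -/
theorem WeakDir.sub_eq_integral {u : Space} {g G : Space → ℝ} (h : WeakDir u g G)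
    (hGm : Measurable G) {t : ℝ} (ht : 0 ≤ t) :
    ∀ᵐ x, x ∈ strip ∧ x + t • u ∈ strip →
      g (x + t • u) - g x = ∫ r in Ioc 0 t, G (x + r • u) := by
  set U : Set Space := {x | x ∈ strip ∧ x + t • u ∈ strip} with hU
  have hUo : IsOpen U := isOpen_strip.inter (isOpen_strip.preimage (by fun_prop))
  have hg1 : LocallyIntegrableOn (fun x => g (x + t • u)) U volume := by
    have := h.left
    rw [locallyIntegrableOn_iff isOpen_strip.isLocallyClosed] at this
    rw [locallyIntegrableOn_iff hUo.isLocallyClosed]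
    intro k hk hc
    exact ((measurePreserving_add_right (volume : Measure Space) (t • u)).integrableOn_image
      (measurableEmbedding_addRight _)).1 (this ((fun x => x + t • u) '' k) (by
        rintro _ ⟨x, hx, rfl⟩; exact (hk hx).2) (hc.image (by fun_prop)))
  have hg0 : LocallyIntegrableOn g U volume := h.left.mono_set fun x hx => hx.1
  have hI : LocallyIntegrableOn (fun x => ∫ r in Ioc 0 t, G (x + r • u)) U volume := by
    rw [locallyIntegrableOn_iff hUo.isLocallyClosed]
    intro k hk hc
    exact (integrable_sweep hGm h.right hc (fun x hx => hk hx)).integral_prod_left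
  have key := hUo.ae_eq_zero_of_integral_contDiff_smul_eq_zero ((hg1.sub hg0).sub hI) ?_
  · filter_upwards [key] with x hx hxU
    have := hx hxU
    simp only [Pi.sub_apply] at this
    linarith
  intro φ hφ hc hs
  have hcont := hφ.continuous
  have int : ∀ {f : Space → ℝ}, LocallyIntegrableOn f U volume →
      Integrable (fun x => f x * φ x) := by
    intro f hf
    have h1 : IntegrableOn (fun x => f x * φ x) (tsupport φ) volume :=
      (hf.integrableOn_compact_subset hs hc).mul_continuousOn hcont.continuousOn hc
    rw [← integrableOn_univ]
    exact h1.of_forall_sdiff_eq_zero MeasurableSet.univ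
      fun x hx => by simp [image_eq_zero_of_notMem_tsupport hx.2]
  -- The support of `φ` lies where both ends of the segment are in the strip, so by convexity every
  -- intermediate translate of `φ` is still an admissible test function.
  have hsr : ∀ r ∈ Icc (0 : ℝ) t, tsupport (fun x => φ (x - r • u)) ⊆ strip := by
    intro r hr x hx
    rw [tsupport_comp_sub] at hx
    have hx' := hs hx
    have := add_smul_mem_strip hx'.1 hx'.2 hr.1 hr.2
    simpa using this
  have hφr : ∀ r : ℝ, ContDiff ℝ ∞ (fun x => φ (x - r • u)) := fun r => hφ.comp (by fun_prop)
  -- the translated first term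
  have e1 : ∫ x, g (x + t • u) * φ x = ∫ x, g x * φ (x - t • u) := by
    rw [← integral_add_right_eq_self (fun x => g x * φ (x - t • u)) (t • u)]
    simp
  -- the averaged term
  have e2 : ∫ x, (∫ r in Ioc 0 t, G (x + r • u)) * φ x
      = ∫ x, g x * (φ (x - t • u) - φ x) := by
    have s1 : ∫ x, (∫ r in Ioc 0 t, G (x + r • u)) * φ x
        = ∫ x in tsupport φ, ∫ r in Ioc 0 t, G (x + r • u) * φ x := by
      rw [← setIntegral_eq_integral_of_forall_compl_eq_zero (s := tsupport φ)]
      · simp_rw [integral_mul_const]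
      · intro x hx
        rw [image_eq_zero_of_notMem_tsupport hx, mul_zero]
    have s2 : ∫ x in tsupport φ, ∫ r in Ioc 0 t, G (x + r • u) * φ x
        = ∫ r in Ioc 0 t, ∫ x in tsupport φ, G (x + r • u) * φ x := by
      obtain ⟨C, hC⟩ := hcont.bounded_above_of_compact_support hc
      refine integral_integral_swap (f := fun x r => G (x + r • u) * φ x) ?_
      exact (integrable_sweep hGm h.right hc (fun x hx => hs hx)).mul_bdd (c := C)
        (hcont.comp continuous_fst).aestronglyMeasurable (Filter.Eventually.of_forall fun p => hC _)
    have s3 : ∀ r ∈ Ioc 0 t, ∫ x in tsupport φ, G (x + r • u) * φ x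
        = - ∫ x, g x * fderiv ℝ φ (x - r • u) u := by
      intro r hr
      rw [setIntegral_eq_integral_of_forall_compl_eq_zero (fun x hx => by
        rw [image_eq_zero_of_notMem_tsupport hx, mul_zero])]
      have := h.test_univ (hφr r) (hasCompactSupport_comp_sub hc _) (hsr r ⟨hr.1.le, hr.2⟩)
      simp only [fderiv_comp_sub] at this
      rw [this, neg_neg, ← integral_add_right_eq_self (fun x => G x * φ (x - r • u)) (r • u)]
      simp
    rw [s1, s2, setIntegral_congr_fun measurableSet_Ioc s3, integral_neg]
    set k' := (fun p : Space × ℝ => p.1 + p.2 • u) '' (tsupport φ ×ˢ Icc 0 t) with hk'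
    have hk'c : IsCompact k' := isCompact_sweep hc u t
    have hk's : k' ⊆ strip := by
      rintro _ ⟨⟨x, r⟩, ⟨hx, hr⟩, rfl⟩
      exact add_smul_mem_strip (hs hx).1 (hs hx).2 hr.1 hr.2
    have hψc : Continuous fun p : Space × ℝ => fderiv ℝ φ (p.1 - p.2 • u) u :=
      ((hφ.continuous_fderiv (by simp)).comp (by fun_prop)).clm_apply continuous_const
    have hout : ∀ r ∈ Ioc 0 t, ∀ x ∉ k', fderiv ℝ φ (x - r • u) u = 0 := by
      intro r hr x hx
      refine image_eq_zero_of_notMem_tsupport (f := fun x => fderiv ℝ φ x u) fun hx' => hx ?_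
      exact ⟨(x - r • u, r), ⟨tsupport_fderiv_apply_subset ℝ u hx', hr.1.le, hr.2⟩, by simp⟩
    have s4 : ∫ r in Ioc 0 t, ∫ x, g x * fderiv ℝ φ (x - r • u) u
        = ∫ r in Ioc 0 t, ∫ x in k', g x * fderiv ℝ φ (x - r • u) u := by
      refine setIntegral_congr_fun measurableSet_Ioc fun r hr => ?_
      refine (setIntegral_eq_integral_of_forall_compl_eq_zero fun x hx => ?_).symm
      rw [hout r hr x hx, mul_zero]
    have s5 : ∫ r in Ioc 0 t, ∫ x in k', g x * fderiv ℝ φ (x - r • u) u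
        = ∫ x in k', ∫ r in Ioc 0 t, g x * fderiv ℝ φ (x - r • u) u := by
      have hb : ∃ C, ∀ x, ‖fderiv ℝ φ x u‖ ≤ C :=
        ((hφ.continuous_fderiv (by simp)).clm_apply continuous_const).bounded_above_of_compact_support
          (hc.fderiv_apply ℝ u)
      obtain ⟨C, hC⟩ := hb
      refine integral_integral_swap (f := fun r x => g x * fderiv ℝ φ (x - r • u) u) ?_
      have hgi : IntegrableOn g k' volume := h.left.integrableOn_compact_subset hk's hk'c
      have : Integrable (fun p : ℝ × Space => g p.2)
          ((volume.restrict (Ioc 0 t)).prod (volume.restrict k')) := hgi.comp_snd _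
      exact this.mul_bdd (c := C) (hψc.comp continuous_swap).aestronglyMeasurable
        (Filter.Eventually.of_forall fun p => hC _)
    rw [s4, s5, ← integral_neg]
    rw [← setIntegral_eq_integral_of_forall_compl_eq_zero (s := k')
      (f := fun x => g x * (φ (x - t • u) - φ x))]
    · refine integral_congr_ae (Filter.Eventually.of_forall fun x => ?_)
      simp only
      rw [integral_const_mul, integral_deriv_line hφ u x ht]
      ring
    · intro x hx
      rcases ht.eq_or_lt with h0 | h0
      · simp [← h0]
      rw [image_eq_zero_of_notMem_tsupport (f := φ) (x := x)
          (fun hx' => hx ⟨(x, 0), ⟨hx', le_rfl, ht⟩, by simp⟩),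
        image_eq_zero_of_notMem_tsupport (f := φ) (x := x - t • u)
          (fun hx' => hx ⟨(x - t • u, t), ⟨hx', ht, le_rfl⟩, by simp⟩)]
      simp
  have i1 := int hg1
  have i0 := int hg0
  have i2 := int hI
  have i3 : Integrable fun x => g x * φ (x - t • u) :=
    integrable_mul_of_tsupport_subset h.left (hφr t).continuous (hasCompactSupport_comp_sub hc _)
      (hsr t ⟨ht, le_rfl⟩)
  calc ∫ x, φ x • ((fun x => g (x + t • u)) - g - fun x => ∫ r in Ioc 0 t, G (x + r • u)) x
      = ∫ x, (g (x + t • u) * φ x - g x * φ x - (∫ r in Ioc 0 t, G (x + r • u)) * φ x) := by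
        congr 1; funext x; simp only [Pi.sub_apply, smul_eq_mul]; ring
    _ = 0 := by
        have i4 := i1.sub i0
        simp only [Pi.sub_def] at i4
        rw [integral_sub i4 i2, integral_sub i1 i0, e1, e2]
        simp_rw [mul_sub]
        rw [integral_sub i3 i0]
        ring

theorem WeakDir.enorm_sub_le {u : Space} {g G : Space → ℝ} (h : WeakDir u g G)
    (hGm : Measurable G) {t : ℝ} (ht : 0 ≤ t) :
    ∀ᵐ x, x ∈ strip ∧ x + t • u ∈ strip →
      ‖g (x + t • u) - g x‖ₑ ≤ ∫⁻ r in Ioc 0 t, ‖G (x + r • u)‖ₑ := by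
  filter_upwards [h.sub_eq_integral hGm ht] with x hx hxU
  rw [hx hxU]
  exact enorm_integral_le_lintegral_enorm _

theorem weakDir_of_hasWeakD {i : Fin 3} {g G : Space → ℝ} (h : HasWeakD (incr 0 i) g G) :
    WeakDir (basisVec i) g G := by
  refine ⟨h.1, h.2.1, fun φ h1 h2 h3 => ?_⟩
  have := h.2.2 φ h1 h2 h3
  rw [multiD_incr h1, multiD_zero, order_incr, order_zero] at this
  simpa [partialD] using this

theorem WeakDir.smul {u : Space} {g G : Space → ℝ} (h : WeakDir u g G) (c : ℝ) :
    WeakDir (c • u) g (fun x => c * G x) := by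
  refine ⟨h.left, h.right.smul c, fun φ h1 h2 h3 => ?_⟩
  have := h.test φ h1 h2 h3
  simp only [map_smul, smul_eq_mul, mul_assoc, mul_left_comm _ c, integral_const_mul, this]
  ring

theorem WeakDir.add {u v : Space} {g G H : Space → ℝ} (h : WeakDir u g G) (h' : WeakDir v g H) :
    WeakDir (u + v) g (fun x => G x + H x) := by
  refine ⟨h.left, h.right.add h'.right, fun φ h1 h2 h3 => ?_⟩
  have hc : ∀ w : Space, IntegrableOn (fun x => g x * fderiv ℝ φ x w) strip := fun w =>
    (integrable_mul_of_tsupport_subset h.left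
      ((h1.continuous_fderiv (by simp)).clm_apply continuous_const) (h2.fderiv_apply ℝ w)
      ((tsupport_fderiv_apply_subset ℝ w).trans h3)).integrableOn
  have hi : ∀ {f : Space → ℝ}, LocallyIntegrableOn f strip volume →
      IntegrableOn (fun x => f x * φ x) strip := fun hf =>
    (integrable_mul_of_tsupport_subset hf h1.continuous h2 h3).integrableOn
  simp only [map_add, mul_add, add_mul]
  rw [integral_add (hc u) (hc v), integral_add (hi h.right) (hi h'.right),
    h.test φ h1 h2 h3, h'.test φ h1 h2 h3]
  ring

theorem sum_smul_basisVec (u : Space) : u 0 • basisVec 0 + u 1 • basisVec 1 + u 2 • basisVec 2 = u := by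
  ext i
  fin_cases i <;> simp [basisVec]

theorem weakDir_of_grad {g : Space → ℝ} {D : Fin 3 → Space → ℝ}
    (h : ∀ i, HasWeakD (incr 0 i) g (D i)) (u : Space) :
    WeakDir u g (fun x => u 0 * D 0 x + u 1 * D 1 x + u 2 * D 2 x) := by
  have := (((weakDir_of_hasWeakD (h 0)).smul (u 0)).add ((weakDir_of_hasWeakD (h 1)).smul (u 1))).add
    ((weakDir_of_hasWeakD (h 2)).smul (u 2))
  rwa [sum_smul_basisVec] at this

/-! ### Periodic densities -/

/-- Tangential periodicity, almost everywhere on the strip, of a nonnegative density. -/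
def EPeriodic (ℓ : Fin 2 → ℝ) (Φ : Space → ℝ≥0∞) : Prop :=
  ∀ j : Fin 2, ∀ᵐ x ∂(volume.restrict strip), Φ (x + ℓ j • basisVec j.castSucc) = Φ x

/-- The lattice of tangential periods. -/
def lattice (ℓ : Fin 2 → ℝ) : AddSubgroup Space :=
  AddSubgroup.closure {ℓ 0 • basisVec 0, ℓ 1 • basisVec 1}

theorem mem_lattice {ℓ : Fin 2 → ℝ} {v : Space} :
    v ∈ lattice ℓ ↔ ∃ m n : ℤ, m • (ℓ 0 • basisVec 0) + n • (ℓ 1 • basisVec 1) = v :=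
  AddSubgroup.mem_closure_pair

instance countable_lattice (ℓ : Fin 2 → ℝ) : Countable (lattice ℓ) := by
  have : (lattice ℓ : Set Space) ⊆ range fun p : ℤ × ℤ =>
      p.1 • (ℓ 0 • basisVec 0) + p.2 • (ℓ 1 • basisVec 1) := by
    intro v hv
    obtain ⟨m, n, h⟩ := mem_lattice.1 hv
    exact ⟨(m, n), h⟩
  exact ((countable_range _).mono this).to_subtype

theorem lattice_apply_two {ℓ : Fin 2 → ℝ} {v : Space} (hv : v ∈ lattice ℓ) : v 2 = 0 := by
  obtain ⟨m, n, rfl⟩ := mem_lattice.1 hv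
  simp [basisVec]

/-- The columns over translated fundamental rectangles. -/
def column (ℓ : Fin 2 → ℝ) (z : Space) : Set Space :=
  {x | x 0 ∈ Ico (z 0) (z 0 + ℓ 0) ∧ x 1 ∈ Ico (z 1) (z 1 + ℓ 1)}

theorem measurableSet_column (ℓ : Fin 2 → ℝ) (z : Space) : MeasurableSet (column ℓ z) := by
  have h (i : Fin 3) : Measurable fun x : Space => x i := by fun_prop
  exact (h 0 measurableSet_Ico).inter (h 1 measurableSet_Ico)

/-- Half-open intervals of period length meet every orbit exactly once. The base point is free so
that two columns can be compared, and the measure is free because the one used carries the periodic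
density. -/
theorem isAddFundamentalDomain_column {ℓ : Fin 2 → ℝ} (hℓ : ∀ j, 0 < ℓ j) (z : Space)
    (ν : Measure Space) : IsAddFundamentalDomain (lattice ℓ) (column ℓ z) ν := by
  refine IsAddFundamentalDomain.mk' (measurableSet_column ℓ z).nullMeasurableSet fun x => ?_
  obtain ⟨m, hm, hmu⟩ := existsUnique_add_zsmul_mem_Ico (hℓ 0) (x 0) (z 0)
  obtain ⟨n, hn, hnu⟩ := existsUnique_add_zsmul_mem_Ico (hℓ 1) (x 1) (z 1)
  have c0 : ∀ m n : ℤ, (m • (ℓ 0 • basisVec 0) + n • (ℓ 1 • basisVec 1) + x) 0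
      = x 0 + m • ℓ 0 := by
    intro m n; simp [basisVec, add_comm]
  have c1 : ∀ m n : ℤ, (m • (ℓ 0 • basisVec 0) + n • (ℓ 1 • basisVec 1) + x) 1
      = x 1 + n • ℓ 1 := by
    intro m n; simp [basisVec, add_comm]
  refine ⟨⟨_, mem_lattice.2 ⟨m, n, rfl⟩⟩, ?_, ?_⟩
  · change _ + x ∈ column ℓ z
    exact ⟨by rw [c0]; exact hm, by rw [c1]; exact hn⟩
  · rintro ⟨v, hv⟩ h
    obtain ⟨m', n', rfl⟩ := mem_lattice.1 hv
    have h' : m' • (ℓ 0 • basisVec 0) + n' • (ℓ 1 • basisVec 1) + x ∈ column ℓ z := h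
    have h0 := h'.1
    have h1 := h'.2
    rw [c0] at h0
    rw [c1] at h1
    rw [Subtype.mk.injEq, hmu m' h0, hnu n' h1]

theorem EPeriodic.lattice {ℓ : Fin 2 → ℝ} {Φ : Space → ℝ≥0∞} (h : EPeriodic ℓ Φ) {v : Space}
    (hv : v ∈ lattice ℓ) : ∀ᵐ x ∂(volume.restrict strip), Φ (x + v) = Φ x := by
  have tr : ∀ {p : Space → Prop} {v : Space}, v 2 = 0 → (∀ᵐ x ∂(volume.restrict strip), p x) →
      ∀ᵐ x ∂(volume.restrict strip), p (x + v) := fun hv hp =>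
    (measurePreserving_add_restrict_strip hv).quasiMeasurePreserving.ae hp
  refine AddSubgroup.closure_induction
    (p := fun v _ => ∀ᵐ x ∂(volume.restrict strip), Φ (x + v) = Φ x) ?_ ?_ ?_ ?_ hv
  · rintro _ (rfl | rfl)
    · exact h 0
    · exact h 1
  · simp
  · intro a b ha hb h1 h2
    filter_upwards [h1, tr (lattice_apply_two ha) h2] with x hx hx'
    rw [← add_assoc, hx', hx]
  · intro a ha h1
    have : (-a) 2 = 0 := by simp [lattice_apply_two ha]
    filter_upwards [tr this h1] with x hx
    rw [← hx]; simp

theorem volume_hyperplane (i : Fin 3) : volume {x : Space | x i = 0} = 0 := by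
  have := Measure.addHaar_submodule (volume : Measure Space)
    (LinearMap.ker (EuclideanSpace.proj (𝕜 := ℝ) i : Space →L[ℝ] ℝ).toLinearMap) (by
      intro h
      have : basisVec i ∈ LinearMap.ker (EuclideanSpace.proj (𝕜 := ℝ) i : Space →L[ℝ] ℝ).toLinearMap :=
        h ▸ Submodule.mem_top
      simp [basisVec] at this)
  convert this using 2
  ext x
  simp

/-- The measure with density `Φ` on the strip is invariant under the lattice, and two fundamental
domains have equal measure. -/
theorem lintegral_column_eq {ℓ : Fin 2 → ℝ} (hℓ : ∀ j, 0 < ℓ j) {Φ : Space → ℝ≥0∞}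
    (hm : Measurable Φ) (h : EPeriodic ℓ Φ) (z z' : Space) :
    ∫⁻ x in column ℓ z ∩ strip, Φ x = ∫⁻ x in column ℓ z' ∩ strip, Φ x := by
  set ν := (volume.restrict strip).withDensity Φ with hν
  have hap : ∀ s, MeasurableSet s → ν s = ∫⁻ x in s ∩ strip, Φ x := by
    intro s hs
    rw [hν, withDensity_apply _ hs, Measure.restrict_restrict hs]
  have : VAddInvariantMeasure (lattice ℓ) Space ν := by
    refine ⟨fun c s hs => ?_⟩
    obtain ⟨v, hv⟩ := c
    have hv2 := lattice_apply_two hv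
    have hpre : (fun x => (⟨v, hv⟩ : lattice ℓ) +ᵥ x) ⁻¹' s = (fun x => x + v) ⁻¹' s := by
      ext x
      change v + x ∈ s ↔ x + v ∈ s
      rw [add_comm]
    have hms : MeasurableSet ((fun x => x + v) ⁻¹' s) := by
      exact measurableSet_preimage (measurable_add_const v) hs
    rw [hpre, hν, withDensity_apply _ hms, withDensity_apply _ hs]
    have e := ((measurePreserving_add_restrict_strip hv2).restrict_preimage hs).lintegral_comp hm
    rw [← e]
    exact lintegral_congr_ae ((ae_restrict_of_ae (h.lattice hv)).mono fun x hx => hx.symm)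
  rw [← hap _ (measurableSet_column ℓ z), ← hap _ (measurableSet_column ℓ z')]
  exact (isAddFundamentalDomain_column hℓ z ν).measure_eq (isAddFundamentalDomain_column hℓ z' ν)

theorem lintegral_column_zero (ℓ : Fin 2 → ℝ) (Φ : Space → ℝ≥0∞) :
    ∫⁻ x in column ℓ 0 ∩ strip, Φ x = ∫⁻ x in cell ℓ, Φ x := by
  refine setLIntegral_congr ?_
  have h0 : ∀ᵐ x : Space, x 0 ≠ 0 := by
    rw [ae_iff]; simpa using volume_hyperplane 0
  have h1 : ∀ᵐ x : Space, x 1 ≠ 0 := by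
    rw [ae_iff]; simpa using volume_hyperplane 1
  filter_upwards [h0, h1] with x h0 h1
  refine propext ?_
  change ((x 0 ∈ Ico _ _ ∧ x 1 ∈ Ico _ _) ∧ _) ↔ _ ∧ _ ∧ _
  simp only [mem_Ico, PiLp.zero_apply, zero_add]
  constructor
  · rintro ⟨⟨⟨a, b⟩, c, d⟩, e⟩
    exact ⟨⟨lt_of_le_of_ne a h0.symm, b⟩, ⟨lt_of_le_of_ne c h1.symm, d⟩, e⟩
  · rintro ⟨⟨a, b⟩, ⟨c, d⟩, e⟩
    exact ⟨⟨⟨a.le, b⟩, c.le, d⟩, e⟩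

/-- Integrals of periodic densities do not increase under translations. -/
theorem lintegral_cell_translate_le {ℓ : Fin 2 → ℝ} (hℓ : ∀ j, 0 < ℓ j) {Φ : Space → ℝ≥0∞}
    (hm : Measurable Φ) (h : EPeriodic ℓ Φ) (z : Space) :
    ∫⁻ x in cell ℓ, strip.indicator Φ (x + z) ≤ ∫⁻ x in cell ℓ, Φ x := by
  rw [← lintegral_column_zero ℓ Φ, lintegral_column_eq hℓ hm h 0 z]
  have hmi : Measurable (strip.indicator Φ) := hm.indicator measurableSet_strip
  have e := ((measurePreserving_add_right (volume : Measure Space) z).restrict_preimage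
    (measurableSet_column ℓ z)).lintegral_comp hmi
  rw [inter_comm, ← Measure.restrict_restrict measurableSet_strip,
    ← lintegral_indicator measurableSet_strip, ← e]
  refine lintegral_mono' (Measure.restrict_mono ?_ le_rfl) le_rfl
  rintro x ⟨⟨a, b⟩, ⟨c, d⟩, -⟩
  change (x 0 + z 0 ∈ Ico _ _ ∧ x 1 + z 1 ∈ Ico _ _)
  simp only [mem_Ico]
  refine ⟨⟨?_, ?_⟩, ?_, ?_⟩ <;> linarith

theorem EPeriodic.mul {ℓ : Fin 2 → ℝ} {Φ Ψ : Space → ℝ≥0∞} (h : EPeriodic ℓ Φ)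
    (h' : EPeriodic ℓ Ψ) : EPeriodic ℓ (fun x => Φ x * Ψ x) := by
  intro j
  filter_upwards [h j, h' j] with x h1 h2
  rw [h1, h2]

theorem AEPeriodic.ePeriodic {ℓ : Fin 2 → ℝ} {f : Space → ℝ} (h : AEPeriodic ℓ f)
    (F : ℝ → ℝ≥0∞) : EPeriodic ℓ (fun x => F (f x)) := by
  intro j
  filter_upwards [h j] with x h1
  rw [h1]

theorem ePeriodic_of_apply_two {ℓ : Fin 2 → ℝ} (F : ℝ → ℝ≥0∞) : EPeriodic ℓ (fun x => F (x 2)) := by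
  intro j
  refine Filter.Eventually.of_forall fun x => ?_
  have : (x + ℓ j • basisVec j.castSucc) 2 = x 2 := by fin_cases j <;> simp [basisVec]
  simp only [this]

/-! ### Auxiliary inequalities for lower integrals -/

theorem ennreal_add_sq_le (a b : ℝ≥0∞) : (a + b) ^ 2 ≤ 4 * (a ^ 2 + b ^ 2) := by
  rcases le_total a b with h | h
  · calc (a + b) ^ 2 ≤ (b + b) ^ 2 := by gcongr
      _ = 4 * b ^ 2 := by ring
      _ ≤ _ := by gcongr; exact le_add_self
  · calc (a + b) ^ 2 ≤ (a + a) ^ 2 := by gcongr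
      _ = 4 * a ^ 2 := by ring
      _ ≤ _ := by gcongr; exact le_self_add

/-- The Cauchy–Schwarz inequality with a weight `b ≥ 1 / a`. -/
theorem sq_lintegral_le {T : Type*} [MeasurableSpace T] {τ : Measure T} {a b U : T → ℝ≥0∞}
    (ha : AEMeasurable a τ) (hb : AEMeasurable b τ) (hU : AEMeasurable U τ)
    (hab : ∀ᵐ t ∂τ, 1 ≤ a t * b t) :
    (∫⁻ t, U t ∂τ) ^ 2 ≤ (∫⁻ t, a t ∂τ) * ∫⁻ t, b t * U t ^ 2 ∂τ := by
  have h2 : (0 : ℝ) < 2⁻¹ := by norm_num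
  have sq : ∀ y : ℝ≥0∞, (y ^ (2⁻¹ : ℝ)) ^ (2 : ℝ) = y := fun y => by
    rw [← ENNReal.rpow_mul]; norm_num
  have h1 : ∫⁻ t, U t ∂τ
      ≤ ∫⁻ t, ((fun t => a t ^ (2⁻¹ : ℝ)) * fun t => b t ^ (2⁻¹ : ℝ) * U t) t ∂τ := by
    refine lintegral_mono_ae ?_
    filter_upwards [hab] with t ht
    simp only [Pi.mul_apply]
    rw [← mul_assoc, ← ENNReal.mul_rpow_of_nonneg _ _ h2.le]
    calc U t = 1 * U t := (one_mul _).symm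
      _ ≤ _ := by
        gcongr
        exact ENNReal.one_le_rpow ht h2
  have h3 := ENNReal.lintegral_mul_le_Lp_mul_Lq τ Real.HolderConjugate.two_two
    (ha.pow_const (2⁻¹ : ℝ)) ((hb.pow_const (2⁻¹ : ℝ)).mul hU)
  have h4 := h1.trans h3
  have h5 := pow_le_pow_left' h4 2
  refine h5.trans (le_of_eq ?_)
  rw [mul_pow, ← ENNReal.rpow_natCast, ← ENNReal.rpow_natCast, one_div]
  push_cast
  rw [sq, sq]
  congr 1
  · simp only [sq]
  · refine lintegral_congr fun t => ?_
    simp only [Pi.mul_apply]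
    rw [ENNReal.mul_rpow_of_nonneg _ _ (by norm_num), sq]
    norm_cast

/-- Shifting the argument of a periodic density by a parameter, and integrating over it. -/
theorem lintegral_shift_le {ℓ : Fin 2 → ℝ} (hℓ : ∀ j, 0 < ℓ j) {T : Type*} [MeasurableSpace T]
    (τ : Measure T) [SFinite τ] {s : T → Space} (hs : Measurable s) {k : T × ℝ → ℝ≥0∞}
    (hk : Measurable k) {Φ : Space → ℝ≥0∞} (hΦ : Measurable Φ) (hp : EPeriodic ℓ Φ) :
    ∫⁻ x in cell ℓ, ∫⁻ t, strip.indicator (fun p => k (t, p 2) * Φ p) (x + s t) ∂τ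
      ≤ ∫⁻ p in cell ℓ, (∫⁻ t, k (t, p 2) ∂τ) * Φ p := by
  have h2 : Measurable fun x : Space => x 2 := by fun_prop
  have hF : Measurable fun q : T × Space => k (q.1, q.2 2) * Φ q.2 :=
    (hk.comp (measurable_fst.prodMk (h2.comp measurable_snd))).mul (hΦ.comp measurable_snd)
  have hG : Measurable fun q : Space × T =>
      strip.indicator (fun p => k (q.2, p 2) * Φ p) (q.1 + s q.2) := by
    have h3 : Measurable fun q : Space × T => (q.2, q.1 + s q.2) :=
      measurable_snd.prodMk (measurable_fst.add (hs.comp measurable_snd))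
    have h4 := (hF.indicator (measurable_snd measurableSet_strip)).comp h3
    exact h4
  rw [lintegral_lintegral_swap hG.aemeasurable]
  calc ∫⁻ t, ∫⁻ x in cell ℓ, strip.indicator (fun p => k (t, p 2) * Φ p) (x + s t) ∂volume ∂τ
      ≤ ∫⁻ t, ∫⁻ p in cell ℓ, k (t, p 2) * Φ p ∂volume ∂τ := by
        refine lintegral_mono fun t => ?_
        -- For fixed `t` the factor `k (t, p 2)` depends on the normal coordinate alone, so the
        -- product with `Φ` is again a periodic density.
        exact lintegral_cell_translate_le hℓ (hF.comp measurable_prodMk_left)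
          ((ePeriodic_of_apply_two (fun y => k (t, y))).mul hp) (s t)
    _ = _ := by
        rw [lintegral_lintegral_swap hF.aemeasurable]
        refine lintegral_congr fun p => ?_
        rw [lintegral_mul_const]
        exact hk.comp (measurable_id.prodMk measurable_const)

/-! ### The two sides of the strip -/

/-- The distance to the lower (`c = 1`) or upper (`c = -1`) boundary, as a function of `x₃`. -/
noncomputable def sideDist (c y : ℝ) : ℝ := (1 - c) / 2 + c * y

/-- The inner normal to the lower or upper boundary. -/
noncomputable def sideVec (c : ℝ) : Space := c • basisVec 2

theorem sideDist_add {c : ℝ} (hc : c = 1 ∨ c = -1) (x : Space) (h : ℝ) :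
    sideDist c ((x + h • sideVec c) 2) = sideDist c (x 2) + h := by
  rcases hc with rfl | rfl <;> simp [sideDist, sideVec, basisVec] <;> ring

theorem mem_strip_iff {c : ℝ} (hc : c = 1 ∨ c = -1) (x : Space) :
    x ∈ strip ↔ 0 < sideDist c (x 2) ∧ sideDist c (x 2) < 1 := by
  change (0 < x 2 ∧ x 2 < 1) ↔ _
  rcases hc with rfl | rfl <;> simp only [sideDist] <;> constructor <;> rintro ⟨h1, h2⟩ <;>
    constructor <;> linarith

theorem bdryDist_eq {c : ℝ} (hc : c = 1 ∨ c = -1) (x : Space) :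
    bdryDist x = min (sideDist c (x 2)) (1 - sideDist c (x 2)) := by
  rcases hc with rfl | rfl
  · simp [bdryDist, sideDist]
  · rw [bdryDist, min_comm]; congr 1 <;> simp only [sideDist] <;> ring

theorem exists_side (x : Space) : ∃ c : ℝ, (c = 1 ∨ c = -1) ∧ sideDist c (x 2) ≤ 1 / 2 := by
  rcases le_total (x 2) (1 / 2) with h | h
  · exact ⟨1, Or.inl rfl, by simp only [sideDist]; linarith⟩
  · exact ⟨-1, Or.inr rfl, by simp only [sideDist]; linarith⟩

theorem measurable_sideDist (c : ℝ) : Measurable (sideDist c) := by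
  unfold sideDist; fun_prop

/-- To bound an integral over the cell it suffices to bound it over both sides. -/
theorem lintegral_cell_le_of_sides {ℓ : Fin 2 → ℝ} {Φ : Space → ℝ≥0∞} {B : ℝ≥0∞}
    (h : ∀ c : ℝ, c = 1 ∨ c = -1 → ∫⁻ x in cell ℓ ∩ {x | sideDist c (x 2) ≤ 1 / 2}, Φ x ≤ B) :
    ∫⁻ x in cell ℓ, Φ x ≤ 2 * B := by
  have hsub : cell ℓ ⊆ (cell ℓ ∩ {x | sideDist 1 (x 2) ≤ 1 / 2}) ∪
      (cell ℓ ∩ {x | sideDist (-1) (x 2) ≤ 1 / 2}) := by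
    intro x hx
    obtain ⟨c, rfl | rfl, h2⟩ := exists_side x
    · exact Or.inl ⟨hx, h2⟩
    · exact Or.inr ⟨hx, h2⟩
  calc ∫⁻ x in cell ℓ, Φ x ≤ _ := lintegral_mono_set hsub
    _ ≤ _ := lintegral_union_le _ _ _
    _ ≤ B + B := add_le_add (h 1 (Or.inl rfl)) (h (-1) (Or.inr rfl))
    _ = 2 * B := (two_mul B).symm

/-! ### Powers of the boundary distance and weighted energies -/

theorem bdryDist_pos {x : Space} (hx : x ∈ strip) : 0 < bdryDist x :=
  lt_min hx.1 (by linarith [hx.2])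

theorem bdryDist_le_one {x : Space} (hx : x ∈ strip) : bdryDist x ≤ 1 :=
  (min_le_left _ _).trans hx.2.le

/-- A power of the boundary distance, as a density. -/
noncomputable def wt (γ : ℝ) (x : Space) : ℝ≥0∞ := ENNReal.ofReal (bdryDist x ^ γ)

theorem measurable_bdryDist : Measurable bdryDist := by
  unfold bdryDist; fun_prop

theorem measurable_wt (γ : ℝ) : Measurable (wt γ) :=
  (measurable_bdryDist.pow_const γ).ennreal_ofReal

theorem ePeriodic_wt (ℓ : Fin 2 → ℝ) (γ : ℝ) : EPeriodic ℓ (wt γ) :=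
  ePeriodic_of_apply_two fun y => ENNReal.ofReal (min y (1 - y) ^ γ)

/-- The weighted energy of a function on the cell. -/
noncomputable def energy (ℓ : Fin 2 → ℝ) (γ : ℝ) (g : Space → ℝ) : ℝ≥0∞ :=
  ∫⁻ x in cell ℓ, wt γ x * ‖g x‖ₑ ^ 2

theorem energy_anti (ℓ : Fin 2 → ℝ) {γ δ : ℝ} (h : γ ≤ δ) (g : Space → ℝ) :
    energy ℓ δ g ≤ energy ℓ γ g := by
  refine setLIntegral_mono' (measurableSet_cell ℓ) fun x hx => ?_
  have hx' := cell_subset_strip ℓ hx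
  gcongr
  exact ENNReal.ofReal_le_ofReal
    (Real.rpow_le_rpow_of_exponent_ge (bdryDist_pos hx') (bdryDist_le_one hx') h)

theorem energy_congr (ℓ : Fin 2 → ℝ) (γ : ℝ) {g g' : Space → ℝ}
    (h : g =ᵐ[volume.restrict strip] g') : energy ℓ γ g = energy ℓ γ g' :=
  lintegral_congr_ae ((ae_cell_of_ae_strip h).mono fun x hx => by simp only [hx])

/-! ### One-dimensional power integrals -/

theorem lintegral_rpow_sub {q s : ℝ} (hq : 0 ≤ q) (hs : -1 < s) :
    ∫⁻ r in Ioo 0 q, ENNReal.ofReal ((q - r) ^ s) = ENNReal.ofReal (q ^ (s + 1) / (s + 1)) := by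
  have hint : IntervalIntegrable (fun r => (q - r) ^ s) volume 0 q := by
    have := (intervalIntegral.intervalIntegrable_rpow' hs (a := 0) (b := q)).comp_sub_left q
    simpa using this.symm
  rw [restrict_Ioo_eq_restrict_Ioc, ← ofReal_integral_eq_lintegral_ofReal]
  · congr 1
    rw [← intervalIntegral.integral_of_le hq, intervalIntegral.integral_comp_sub_left (fun y => y ^ s),
      sub_self, sub_zero, integral_rpow (Or.inl hs), Real.zero_rpow (by linarith), sub_zero]
  · exact hint.1
  · filter_upwards [ae_restrict_mem measurableSet_Ioc] with r hr
    exact Real.rpow_nonneg (by linarith [hr.2]) _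

theorem lintegral_rpow_add_le {q : ℝ} (hq : 0 < q) (b : ℝ) :
    ∫⁻ r in Ioc 0 b, ENNReal.ofReal ((q + r) ^ (-(3 / 2) : ℝ))
      ≤ ENNReal.ofReal (2 * q ^ (-(1 / 2) : ℝ)) := by
  have hsub : Ioc 0 b ⊆ Ioi 0 := fun r hr => hr.1
  refine (lintegral_mono_set hsub).trans (le_of_eq ?_)
  have e1 : ∫⁻ r in Ioi 0, ENNReal.ofReal ((q + r) ^ (-(3 / 2) : ℝ))
      = ∫⁻ r in Ioi q, ENNReal.ofReal (r ^ (-(3 / 2) : ℝ)) := by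
    have hm : Measurable fun r : ℝ => ENNReal.ofReal (r ^ (-(3 / 2) : ℝ)) :=
      (measurable_id.pow_const _).ennreal_ofReal
    have := ((measurePreserving_add_left (volume : Measure ℝ) q).restrict_preimage
      (measurableSet_Ioi (a := q))).lintegral_comp hm
    rw [← this]
    congr 2
    ext r; simp
  rw [e1, ← ofReal_integral_eq_lintegral_ofReal]
  · rw [integral_Ioi_rpow_of_lt (by norm_num) hq]
    congr 1
    norm_num
    ring
  · exact integrableOn_Ioi_rpow_of_lt (by norm_num) hq
  · filter_upwards [ae_restrict_mem measurableSet_Ioi] with r hr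
    exact Real.rpow_nonneg (hq.trans hr).le _

/-! ### The Hardy inequality -/

/-- Up to `5/8 = 1/2 + 1/8`, the furthest point reached from the near half by a step of length
`1/8`, the opposite face is at distance at least `3/8`, and `5/8 ≤ 2 · 3/8`. -/
theorem sideDist_le_two_mul_bdryDist {c : ℝ} (hc : c = 1 ∨ c = -1) {p : Space}
    (h : sideDist c (p 2) ≤ 5 / 8) (h0 : 0 ≤ sideDist c (p 2)) :
    sideDist c (p 2) ≤ 2 * bdryDist p := by
  rw [bdryDist_eq hc]
  rcases min_choice (sideDist c (p 2)) (1 - sideDist c (p 2)) with e | e <;> rw [e] <;> linarith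

/-- The boundary term of the Hardy inequality. -/
theorem hardy_gradient_term {ℓ : Fin 2 → ℝ} (hℓ : ∀ j, 0 < ℓ j) {γ : ℝ} (hγ : 0 ≤ γ) {c : ℝ}
    (hc : c = 1 ∨ c = -1) {G : Space → ℝ} (hG : Measurable G) (hp : AEPeriodic ℓ G) :
    ∫⁻ x in cell ℓ ∩ {x | sideDist c (x 2) ≤ 1 / 2},
        wt γ x * (∫⁻ r in Ioc (0 : ℝ) (1 / 8), ‖G (x + r • sideVec c)‖ₑ) ^ 2
      ≤ ENNReal.ofReal (4 * 2 ^ (γ + 2)) * energy ℓ (γ + 2) G := by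
  set q : Space → ℝ := fun x => sideDist c (x 2) with hq
  set S : Set Space := {x | sideDist c (x 2) ≤ 1 / 2} with hS
  have hqm : Measurable q := (measurable_sideDist c).comp (by fun_prop)
  have hSm : MeasurableSet S := hqm measurableSet_Iic
  -- In terms of the shifted point `p = x + r ν`, with `q` the distance to the chosen face, the
  -- original distance is `q(p) - r > 0`. The kernel `k` below is what the weight and the
  -- Cauchy–Schwarz factors become when written in `p` and `r`.
  set A : Set (ℝ × ℝ) := {t | t.1 < sideDist c t.2 ∧ sideDist c t.2 ≤ 5 / 8} with hA
  have hsm2 : Measurable fun t : ℝ × ℝ => sideDist c t.2 := (measurable_sideDist c).comp measurable_snd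
  have hAm : MeasurableSet A :=
    (measurableSet_lt measurable_fst hsm2).inter (measurableSet_le hsm2 measurable_const)
  set k : ℝ × ℝ → ℝ≥0∞ := A.indicator fun t => ENNReal.ofReal (2 * sideDist c t.2 ^ (γ + 3 / 2)) *
    ENNReal.ofReal ((sideDist c t.2 - t.1) ^ (-(1 / 2) : ℝ)) with hk
  have hkm : Measurable k :=
    (Measurable.mul ((hsm2.pow_const _).const_mul _).ennreal_ofReal
      ((hsm2.sub measurable_fst).pow_const _).ennreal_ofReal).indicator hAm
  have hΦm : Measurable fun p => ‖G p‖ₑ ^ 2 := hG.enorm.pow_const 2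
  have hΦp : EPeriodic ℓ fun p => ‖G p‖ₑ ^ 2 := hp.ePeriodic fun y => ‖y‖ₑ ^ 2
  have hsv : Measurable fun r : ℝ => r • sideVec c := by fun_prop
  have step1 : ∀ x ∈ cell ℓ ∩ S, wt γ x * (∫⁻ r in Ioc (0 : ℝ) (1 / 8), ‖G (x + r • sideVec c)‖ₑ) ^ 2
      ≤ ∫⁻ r in Ioc (0 : ℝ) (1 / 8),
        strip.indicator (fun p => k (r, p 2) * ‖G p‖ₑ ^ 2) (x + r • sideVec c) := by
    rintro x ⟨hx, hxS⟩
    have hxs := cell_subset_strip ℓ hx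
    have hq0 : 0 < q x := ((mem_strip_iff hc x).1 hxs).1
    have hqS : q x ≤ 1 / 2 := hxS
    have hdx : bdryDist x ≤ q x := (bdryDist_eq hc x).le.trans (min_le_left _ _)
    have hd0 : 0 ≤ bdryDist x := (bdryDist_pos hxs).le
    have hUm : Measurable fun r : ℝ => ‖G (x + r • sideVec c)‖ₑ :=
      (hG.comp (measurable_const.add hsv)).enorm
    -- The weight `(q+r)^{-3/2}` is integrable at infinity but not at `0`, so its integral is of
    -- size `q^{-1/2}`; the complementary factor `(q+r)^{3/2}` stays with `|G|²`.
    have cs := sq_lintegral_le (τ := volume.restrict (Ioc (0 : ℝ) (1 / 8)))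
      (a := fun r => ENNReal.ofReal ((q x + r) ^ (-(3 / 2) : ℝ)))
      (b := fun r => ENNReal.ofReal ((q x + r) ^ (3 / 2 : ℝ)))
      (U := fun r => ‖G (x + r • sideVec c)‖ₑ)
      (((measurable_const.add measurable_id).pow_const _).ennreal_ofReal.aemeasurable)
      (((measurable_const.add measurable_id).pow_const _).ennreal_ofReal.aemeasurable)
      hUm.aemeasurable (by
        filter_upwards [ae_restrict_mem measurableSet_Ioc] with r hr
        have : 0 < q x + r := by linarith [hr.1]
        rw [← ENNReal.ofReal_mul (Real.rpow_nonneg this.le _), ← Real.rpow_add this]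
        simp)
    have hle := lintegral_rpow_add_le hq0 (1 / 8)
    calc wt γ x * (∫⁻ r in Ioc (0 : ℝ) (1 / 8), ‖G (x + r • sideVec c)‖ₑ) ^ 2
        ≤ ENNReal.ofReal (bdryDist x ^ γ) * (ENNReal.ofReal (2 * q x ^ (-(1 / 2) : ℝ)) *
          ∫⁻ r in Ioc (0 : ℝ) (1 / 8), ENNReal.ofReal ((q x + r) ^ (3 / 2 : ℝ)) *
            ‖G (x + r • sideVec c)‖ₑ ^ 2) := by
          unfold wt
          gcongr
          exact cs.trans (by gcongr)
      _ = ∫⁻ r in Ioc (0 : ℝ) (1 / 8), ENNReal.ofReal (bdryDist x ^ γ) *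
          (ENNReal.ofReal (2 * q x ^ (-(1 / 2) : ℝ)) *
            (ENNReal.ofReal ((q x + r) ^ (3 / 2 : ℝ)) * ‖G (x + r • sideVec c)‖ₑ ^ 2)) := by
          rw [lintegral_const_mul', lintegral_const_mul'] <;> exact ENNReal.ofReal_ne_top
      _ ≤ _ := by
          refine setLIntegral_mono' measurableSet_Ioc fun r hr => ?_
          have hqp : sideDist c ((x + r • sideVec c) 2) = q x + r := sideDist_add hc x r
          have hmem : x + r • sideVec c ∈ strip := by
            rw [mem_strip_iff hc, hqp]
            constructor <;> linarith [hr.1, hr.2]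
          have hAmem : (r, (x + r • sideVec c) 2) ∈ A := by
            change r < _ ∧ _ ≤ _
            rw [hqp]
            constructor <;> linarith [hr.1, hr.2]
          rw [indicator_of_mem hmem, hk, indicator_of_mem hAmem]
          simp only [hqp, add_sub_cancel_right]
          rw [← mul_assoc, ← mul_assoc]
          refine mul_le_mul' ?_ le_rfl
          have hpos : 0 < q x + r := by linarith [hr.1]
          rw [← ENNReal.ofReal_mul (by positivity), ← ENNReal.ofReal_mul (by positivity),
            ← ENNReal.ofReal_mul (by positivity)]
          refine ENNReal.ofReal_le_ofReal ?_
          -- The place where `γ ≥ 0` enters: the weight at `x` is dominated by the weight at the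
          -- shifted point.
          have h1 : bdryDist x ^ γ ≤ (q x + r) ^ γ :=
            Real.rpow_le_rpow hd0 (by linarith [hr.1]) hγ
          rw [Real.rpow_add hpos]
          calc bdryDist x ^ γ * (2 * q x ^ (-(1 / 2) : ℝ)) * (q x + r) ^ (3 / 2 : ℝ)
              ≤ (q x + r) ^ γ * (2 * q x ^ (-(1 / 2) : ℝ)) * (q x + r) ^ (3 / 2 : ℝ) := by gcongr
            _ = _ := by ring
  calc ∫⁻ x in cell ℓ ∩ S, wt γ x * (∫⁻ r in Ioc (0 : ℝ) (1 / 8), ‖G (x + r • sideVec c)‖ₑ) ^ 2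
      ≤ ∫⁻ x in cell ℓ ∩ S, ∫⁻ r in Ioc (0 : ℝ) (1 / 8),
        strip.indicator (fun p => k (r, p 2) * ‖G p‖ₑ ^ 2) (x + r • sideVec c) :=
        setLIntegral_mono' ((measurableSet_cell ℓ).inter hSm) step1
    _ ≤ ∫⁻ x in cell ℓ, ∫⁻ r in Ioc (0 : ℝ) (1 / 8),
        strip.indicator (fun p => k (r, p 2) * ‖G p‖ₑ ^ 2) (x + r • sideVec c) :=
        lintegral_mono_set inter_subset_left
    _ ≤ ∫⁻ p in cell ℓ, (∫⁻ r in Ioc (0 : ℝ) (1 / 8), k (r, p 2)) * ‖G p‖ₑ ^ 2 :=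
        lintegral_shift_le hℓ _ hsv hkm hΦm hΦp
    _ ≤ ∫⁻ p in cell ℓ, ENNReal.ofReal (4 * 2 ^ (γ + 2)) * (wt (γ + 2) p * ‖G p‖ₑ ^ 2) := by
        refine setLIntegral_mono' (measurableSet_cell ℓ) fun p hp => ?_
        have hps := cell_subset_strip ℓ hp
        have hq0 : 0 < q p := ((mem_strip_iff hc p).1 hps).1
        rw [← mul_assoc]
        gcongr
        by_cases h58 : q p ≤ 5 / 8
        · calc ∫⁻ r in Ioc (0 : ℝ) (1 / 8), k (r, p 2)
              ≤ ∫⁻ r in Ioi 0, k (r, p 2) := lintegral_mono_set fun r hr => hr.1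
            _ = ∫⁻ r in Ioo 0 (q p), ENNReal.ofReal (2 * q p ^ (γ + 3 / 2)) *
                  ENNReal.ofReal ((q p - r) ^ (-(1 / 2) : ℝ)) := by
                rw [← lintegral_indicator measurableSet_Ioi, ← lintegral_indicator measurableSet_Ioo]
                refine lintegral_congr fun r => ?_
                by_cases h1 : 0 < r
                · by_cases h2 : r < q p
                  · rw [indicator_of_mem (show r ∈ Ioi 0 from h1),
                      indicator_of_mem (show r ∈ Ioo 0 (q p) from ⟨h1, h2⟩), hk,
                      indicator_of_mem (show (r, p 2) ∈ A from ⟨h2, h58⟩)]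
                  · rw [indicator_of_mem (show r ∈ Ioi 0 from h1),
                      indicator_of_notMem (show r ∉ Ioo 0 (q p) from fun h => h2 h.2), hk,
                      indicator_of_notMem (show (r, p 2) ∉ A from fun h => h2 h.1)]
                · rw [indicator_of_notMem (show r ∉ Ioi 0 from h1),
                    indicator_of_notMem (show r ∉ Ioo 0 (q p) from fun h => h1 h.1)]
            -- The integral of `(q - r)^{-1/2}` over `0 < r < q` is `2 q^{1/2}`, which completes the
            -- exponent to `γ + 2`.
            _ = ENNReal.ofReal (4 * q p ^ (γ + 2)) := by
                rw [lintegral_const_mul' _ _ ENNReal.ofReal_ne_top,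
                  lintegral_rpow_sub hq0.le (by norm_num), ← ENNReal.ofReal_mul (by positivity)]
                congr 1
                have : γ + 2 = (γ + 3 / 2) + (-(1 / 2) + 1) := by ring
                rw [this, Real.rpow_add hq0 (γ + 3 / 2)]
                ring
            _ ≤ _ := by
                unfold wt
                rw [← ENNReal.ofReal_mul (by positivity)]
                refine ENNReal.ofReal_le_ofReal ?_
                rw [mul_assoc, ← Real.mul_rpow (by norm_num) (bdryDist_pos hps).le]
                gcongr
                exact sideDist_le_two_mul_bdryDist hc h58 hq0.le
        · refine le_of_eq_of_le ?_ zero_le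
          have : ∀ r, k (r, p 2) = 0 := fun r =>
            indicator_of_notMem (show (r, p 2) ∉ A from fun h => h58 h.2) _
          simp [this]
    _ = _ := lintegral_const_mul' _ _ ENNReal.ofReal_ne_top

theorem sideDist_interior_le {c : ℝ} (hc : c = 1 ∨ c = -1) {p : Space}
    (h : 1 / 8 ≤ sideDist c (p 2)) (h' : sideDist c (p 2) ≤ 5 / 8) : 1 / 8 ≤ bdryDist p := by
  rw [bdryDist_eq hc]
  exact le_min h (by linarith)

theorem WeakDir.sideVec {g G : Space → ℝ} (h : WeakDir (basisVec 2) g G) (c : ℝ) :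
    WeakDir (sideVec c) g (fun x => c * G x) := h.smul c

/-- Each point of the near half is joined to a point `1/8` further inside along the normal. The end
value lies at distance at least `1/8` from the boundary, where weights with different exponents are
comparable, so any `a ≥ 0` may be used there; the integral of `G` along the segment is the boundary
term above. -/
theorem hardy {ℓ : Fin 2 → ℝ} (hℓ : ∀ j, 0 < ℓ j) {γ a : ℝ} (hγ : 0 ≤ γ) (ha : 0 ≤ a) :
    ∃ C : ℝ≥0, ∀ g G : Space → ℝ, Measurable g → Measurable G → AEPeriodic ℓ g → AEPeriodic ℓ G →
      WeakDir (basisVec 2) g G →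
      energy ℓ γ g ≤ C * (energy ℓ (γ + 2) G + energy ℓ a g) := by
  -- The factor `2` counts the two faces, `4` comes from squaring a sum, `8 ^ a` from `d ≥ 1/8` at
  -- the inner end point, and the last summand from `hardy_gradient_term`.
  refine ⟨2 * (4 * (Real.toNNReal (8 ^ a) + Real.toNNReal (4 * 2 ^ (γ + 2)))),
    fun g G hg hG hgp hGp hw => ?_⟩
  push_cast
  rw [mul_assoc]
  refine lintegral_cell_le_of_sides fun c hc => ?_
  set S : Set Space := {x | sideDist c (x 2) ≤ 1 / 2} with hS
  have hSm : MeasurableSet S := (measurable_sideDist c).comp (by fun_prop) measurableSet_Iic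
  have hcn : ∀ y : ℝ, ‖c * y‖ₑ = ‖y‖ₑ := by
    intro y; rcases hc with rfl | rfl <;> simp
  have ftc := (hw.sideVec c).enorm_sub_le (hG.const_mul c) (t := 1 / 8) (by norm_num)
  have hsm : MeasurableSet (cell ℓ ∩ S) := (measurableSet_cell ℓ).inter hSm
  have hΦm : Measurable fun p => ENNReal.ofReal (8 ^ a) * (wt a p * ‖g p‖ₑ ^ 2) :=
    ((measurable_wt a).mul (hg.enorm.pow_const 2)).const_mul _
  have hΦp : EPeriodic ℓ fun p => ENNReal.ofReal (8 ^ a) * (wt a p * ‖g p‖ₑ ^ 2) :=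
    (ePeriodic_of_apply_two (ℓ := ℓ) fun _ => ENNReal.ofReal (8 ^ a)).mul
      ((ePeriodic_wt ℓ a).mul (hgp.ePeriodic fun y => ‖y‖ₑ ^ 2))
  set v := (1 / 8 : ℝ) • sideVec c with hv
  have bound : ∀ᵐ x ∂(volume.restrict (cell ℓ ∩ S)), wt γ x * ‖g x‖ₑ ^ 2 ≤
      4 * (strip.indicator (fun p => ENNReal.ofReal (8 ^ a) * (wt a p * ‖g p‖ₑ ^ 2)) (x + v) +
        wt γ x * (∫⁻ r in Ioc (0 : ℝ) (1 / 8), ‖G (x + r • sideVec c)‖ₑ) ^ 2) := by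
    filter_upwards [ae_restrict_mem hsm, ae_restrict_of_ae ftc] with x hx hf
    have hxs := cell_subset_strip ℓ hx.1
    have hq0 := ((mem_strip_iff hc x).1 hxs).1
    have hqS : sideDist c (x 2) ≤ 1 / 2 := hx.2
    have hqp : sideDist c ((x + v) 2) = sideDist c (x 2) + 1 / 8 := sideDist_add hc x _
    have hmem : x + v ∈ strip := by
      rw [mem_strip_iff hc, hqp]
      constructor <;> linarith
    have hf' := hf ⟨hxs, hmem⟩
    simp only [hcn] at hf'
    have h1 : ‖g x‖ₑ ≤ ‖g (x + v)‖ₑ + ∫⁻ r in Ioc (0 : ℝ) (1 / 8), ‖G (x + r • sideVec c)‖ₑ := by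
      calc ‖g x‖ₑ = ‖g (x + v) - (g (x + v) - g x)‖ₑ := by rw [sub_sub_cancel]
        _ ≤ ‖g (x + v)‖ₑ + ‖g (x + v) - g x‖ₑ := enorm_sub_le
        _ ≤ _ := by gcongr
    rw [indicator_of_mem hmem]
    have hd : 1 / 8 ≤ bdryDist (x + v) :=
      sideDist_interior_le hc (by rw [hqp]; linarith) (by rw [hqp]; linarith)
    have hw1 : wt γ x ≤ 1 := by
      rw [wt, ENNReal.ofReal_le_one]
      exact Real.rpow_le_one (bdryDist_pos hxs).le (bdryDist_le_one hxs) hγ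
    have hw2 : 1 ≤ ENNReal.ofReal (8 ^ a) * wt a (x + v) := by
      rw [wt, ← ENNReal.ofReal_mul (by positivity),
        ← Real.mul_rpow (by norm_num) (bdryDist_pos hmem).le, ENNReal.one_le_ofReal]
      exact Real.one_le_rpow (by linarith) ha
    calc wt γ x * ‖g x‖ₑ ^ 2 ≤ wt γ x * (4 * (‖g (x + v)‖ₑ ^ 2 +
          (∫⁻ r in Ioc (0 : ℝ) (1 / 8), ‖G (x + r • sideVec c)‖ₑ) ^ 2)) := by
          gcongr
          exact (pow_le_pow_left' h1 2).trans (ennreal_add_sq_le _ _)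
      _ = 4 * (wt γ x * ‖g (x + v)‖ₑ ^ 2 +
          wt γ x * (∫⁻ r in Ioc (0 : ℝ) (1 / 8), ‖G (x + r • sideVec c)‖ₑ) ^ 2) := by ring
      _ ≤ _ := by
          refine mul_le_mul' le_rfl (add_le_add ?_ le_rfl)
          rw [← mul_assoc]
          exact mul_le_mul' (hw1.trans hw2) le_rfl
  have hmi : Measurable fun x => strip.indicator
      (fun p => ENNReal.ofReal (8 ^ a) * (wt a p * ‖g p‖ₑ ^ 2)) (x + v) :=
    (hΦm.indicator measurableSet_strip).comp (measurable_add_const v)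
  calc ∫⁻ x in cell ℓ ∩ S, wt γ x * ‖g x‖ₑ ^ 2 ≤ _ := lintegral_mono_ae bound
    _ = 4 * ((∫⁻ x in cell ℓ ∩ S, strip.indicator
          (fun p => ENNReal.ofReal (8 ^ a) * (wt a p * ‖g p‖ₑ ^ 2)) (x + v)) +
        ∫⁻ x in cell ℓ ∩ S, wt γ x * (∫⁻ r in Ioc (0 : ℝ) (1 / 8), ‖G (x + r • sideVec c)‖ₑ) ^ 2) := by
        rw [lintegral_const_mul' _ _ (by norm_num), lintegral_add_left hmi]
    _ ≤ 4 * (ENNReal.ofReal (8 ^ a) * energy ℓ a g +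
          ENNReal.ofReal (4 * 2 ^ (γ + 2)) * energy ℓ (γ + 2) G) := by
        gcongr
        · calc _ ≤ ∫⁻ x in cell ℓ, strip.indicator
                (fun p => ENNReal.ofReal (8 ^ a) * (wt a p * ‖g p‖ₑ ^ 2)) (x + v) :=
                lintegral_mono_set inter_subset_left
            _ ≤ _ := lintegral_cell_translate_le hℓ hΦm hΦp v
            _ = _ := lintegral_const_mul' _ _ ENNReal.ofReal_ne_top
        · exact hardy_gradient_term hℓ hγ hc hG hGp
    _ ≤ _ := by
        rw [mul_assoc]
        gcongr
        rw [add_mul]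
        change ENNReal.ofReal _ * _ + ENNReal.ofReal _ * _ ≤ ENNReal.ofReal _ * _ + ENNReal.ofReal _ * _
        rw [add_comm (energy ℓ (γ + 2) G)]
        gcongr
        · exact le_self_add
        · exact le_add_self

/-! ### Radial integrals -/

/-- Polar coordinates in dimension three; `s > -3` is integrability at the origin. -/
theorem lintegral_norm_rpow_le {s : ℝ} (hs : -3 < s) :
    ∃ A : ℝ, 0 ≤ A ∧ ∀ R : ℝ, 0 ≤ R →
      ∫⁻ z : Space, {z : Space | ‖z‖ ≤ R}.indicator (fun z => ENNReal.ofReal (‖z‖ ^ s)) z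
        ≤ ENNReal.ofReal (A * R ^ (s + 3)) := by
  refine ⟨3 * (volume.real (Metric.ball (0 : Space) 1) * (s + 3)⁻¹),
    mul_nonneg (by norm_num) (mul_nonneg measureReal_nonneg (inv_nonneg.2 (by linarith))),
    fun R hR => ?_⟩
  set f : ℝ → ℝ := (Iic R).indicator fun y => y ^ s with hf
  have hdim : Module.finrank ℝ Space = 3 := finrank_euclideanSpace_fin
  have hfn : ∀ y, 0 < y → 0 ≤ f y := fun y hy =>
    indicator_apply_nonneg fun _ => Real.rpow_nonneg hy.le _
  have hfn0 : ∀ z : Space, 0 ≤ f ‖z‖ := fun z =>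
    indicator_apply_nonneg fun _ => Real.rpow_nonneg (norm_nonneg z) _
  have hcongr : ∀ y ∈ Ioi (0 : ℝ), y ^ (Module.finrank ℝ Space - 1) • f y
      = (Iic R).indicator (fun y => y ^ (s + 2)) y := by
    intro y hy
    rw [hdim, hf]
    by_cases h : y ∈ Iic R
    · rw [indicator_of_mem h, indicator_of_mem h, smul_eq_mul, add_comm, Real.rpow_add hy]
      norm_num
    · rw [indicator_of_notMem h, indicator_of_notMem h, smul_zero]
  have hii : IntervalIntegrable (fun y : ℝ => y ^ (s + 2)) volume 0 R :=
    intervalIntegral.intervalIntegrable_rpow' (by linarith)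
  have hset : Ioi (0 : ℝ) ∩ Iic R = Ioc 0 R := rfl
  have hint : IntegrableOn (fun y : ℝ => y ^ (Module.finrank ℝ Space - 1) • f y) (Ioi 0) := by
    rw [integrableOn_congr_fun hcongr measurableSet_Ioi, integrableOn_indicator_iff measurableSet_Iic,
      inter_comm, hset]
    exact hii.1
  have hint' : Integrable fun z : Space => f ‖z‖ :=
    (integrable_fun_norm_addHaar (volume : Measure Space)).2 hint
  have e1 : ∫⁻ z : Space, {z : Space | ‖z‖ ≤ R}.indicator (fun z => ENNReal.ofReal (‖z‖ ^ s)) z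
      = ∫⁻ z : Space, ENNReal.ofReal (f ‖z‖) := by
    refine lintegral_congr fun z => ?_
    by_cases h : ‖z‖ ≤ R
    · rw [indicator_of_mem (show z ∈ {z : Space | ‖z‖ ≤ R} from h), hf,
        indicator_of_mem (show ‖z‖ ∈ Iic R from h)]
    · rw [indicator_of_notMem (show z ∉ {z : Space | ‖z‖ ≤ R} from h), hf,
        indicator_of_notMem (show ‖z‖ ∉ Iic R from h), ENNReal.ofReal_zero]
  rw [e1, ← ofReal_integral_eq_lintegral_ofReal hint' (Filter.Eventually.of_forall hfn0),
    integral_fun_norm_addHaar (volume : Measure Space) f,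
    setIntegral_congr_fun measurableSet_Ioi hcongr, setIntegral_indicator measurableSet_Iic, hset,
    ← intervalIntegral.integral_of_le hR, integral_rpow (Or.inl (by linarith)), hdim]
  refine ENNReal.ofReal_le_ofReal (le_of_eq ?_)
  rw [Real.zero_rpow (by linarith)]
  have h3 : s + 2 + 1 = s + 3 := by ring
  rw [h3, nsmul_eq_mul, smul_eq_mul, sub_zero, div_eq_mul_inv]
  push_cast
  ring

/-- For `‖z‖ ≥ 1/8` one has `1 + ‖z‖ ≤ 9‖z‖`, so the kernel is dominated by an integrable power of
`1 + ‖z‖`. -/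
theorem lintegral_norm_rpow_far_lt_top {σ : ℝ} (hσ : 0 < σ) :
    ∫⁻ z in (Metric.ball (0 : Space) (1 / 8))ᶜ, ENNReal.ofReal (‖z‖ ^ (-(3 + 2 * σ))) < ⊤ := by
  have hint : Integrable fun z : Space => (1 + ‖z‖) ^ (-(3 + 2 * σ)) := by
    refine integrable_one_add_norm ?_
    rw [finrank_euclideanSpace_fin]
    push_cast
    linarith
  have hlt : ∫⁻ z : Space, ENNReal.ofReal (9 ^ (3 + 2 * σ) * (1 + ‖z‖) ^ (-(3 + 2 * σ))) < ⊤ :=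
    (hint.const_mul _).lintegral_lt_top
  refine lt_of_le_of_lt ?_ hlt
  refine (setLIntegral_mono' measurableSet_ball.compl fun z hz => ?_).trans
    (setLIntegral_le_lintegral _ _)
  have hz' : 1 / 8 ≤ ‖z‖ := by simpa using hz
  refine ENNReal.ofReal_le_ofReal ?_
  have h0 : (0 : ℝ) < ‖z‖ := by linarith
  rw [Real.rpow_neg h0.le, Real.rpow_neg (by positivity), ← div_eq_mul_inv,
    ← Real.div_rpow (by norm_num) (by positivity), ← Real.inv_rpow h0.le]
  refine Real.rpow_le_rpow (by positivity) ?_ (by linarith)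
  rw [inv_eq_one_div, div_le_div_iff₀ h0 (by positivity)]
  linarith

/-! ### The Gagliardo seminorm -/

/-- The density of the full gradient. -/
noncomputable def gradDensity (D : Fin 3 → Space → ℝ) (x : Space) : ℝ≥0∞ := ∑ i, ‖D i x‖ₑ ^ 2

theorem enorm_dir_sq_le (D : Fin 3 → Space → ℝ) (u x : Space) :
    ‖u 0 * D 0 x + u 1 * D 1 x + u 2 * D 2 x‖ₑ ^ 2 ≤ 16 * ‖u‖ₑ ^ 2 * gradDensity D x := by
  have hu : ∀ i, ‖u i‖ₑ ≤ ‖u‖ₑ := fun i => by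
    rw [enorm_le_iff_norm_le]; exact PiLp.norm_apply_le u i
  have h1 : ‖u 0 * D 0 x + u 1 * D 1 x + u 2 * D 2 x‖ₑ
      ≤ (‖u‖ₑ * ‖D 0 x‖ₑ + ‖u‖ₑ * ‖D 1 x‖ₑ) + ‖u‖ₑ * ‖D 2 x‖ₑ := by
    refine (enorm_add_le _ _).trans (add_le_add ((enorm_add_le _ _).trans (add_le_add ?_ ?_)) ?_) <;>
    · rw [enorm_mul]; gcongr; exact hu _
  refine (pow_le_pow_left' h1 2).trans ((ennreal_add_sq_le _ _).trans ?_)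
  calc 4 * ((‖u‖ₑ * ‖D 0 x‖ₑ + ‖u‖ₑ * ‖D 1 x‖ₑ) ^ 2 + (‖u‖ₑ * ‖D 2 x‖ₑ) ^ 2)
      ≤ 4 * (4 * ((‖u‖ₑ * ‖D 0 x‖ₑ) ^ 2 + (‖u‖ₑ * ‖D 1 x‖ₑ) ^ 2) + 4 * (‖u‖ₑ * ‖D 2 x‖ₑ) ^ 2) := by
        gcongr
        · exact ennreal_add_sq_le _ _
        · exact le_mul_of_one_le_left' (by norm_num)
    _ = _ := by rw [gradDensity, Fin.sum_univ_three]; ring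

theorem measurable_gradDensity {D : Fin 3 → Space → ℝ} (hD : ∀ i, Measurable (D i)) :
    Measurable (gradDensity D) :=
  Finset.measurable_sum _ fun i _ => (hD i).enorm.pow_const 2

theorem ePeriodic_gradDensity {ℓ : Fin 2 → ℝ} {D : Fin 3 → Space → ℝ}
    (hD : ∀ i, AEPeriodic ℓ (D i)) : EPeriodic ℓ (gradDensity D) := by
  intro j
  have : ∀ᵐ x ∂(volume.restrict strip), ∀ i, D i (x + ℓ j • basisVec j.castSucc) = D i x :=
    ae_all_iff.2 fun i => hD i j
  filter_upwards [this] with x hx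
  simp only [gradDensity, hx]

theorem lintegral_theta {s : ℝ} (hs : 0 < s) :
    ∫⁻ θ in Ioc (0 : ℝ) 1, ENNReal.ofReal (θ ^ (s - 1)) = ENNReal.ofReal (1 / s) := by
  have hii : IntervalIntegrable (fun y : ℝ => y ^ (s - 1)) volume 0 1 :=
    intervalIntegral.intervalIntegrable_rpow' (by linarith)
  rw [← ofReal_integral_eq_lintegral_ofReal hii.1]
  · rw [← intervalIntegral.integral_of_le zero_le_one, integral_rpow (Or.inl (by linarith))]
    simp [Real.zero_rpow hs.ne']
  · filter_upwards [ae_restrict_mem measurableSet_Ioc] with r hr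
    exact Real.rpow_nonneg hr.1.le _

/-- The increment of a function along a segment, in terms of its gradient. -/
theorem sq_increment_le {g : Space → ℝ} {D : Fin 3 → Space → ℝ} (hD : ∀ i, Measurable (D i))
    (h : ∀ i, HasWeakD (incr 0 i) g (D i)) {σ : ℝ} (hσ : 0 < σ) (u : Space) :
    ∀ᵐ x, x ∈ strip ∧ x + u ∈ strip → ‖g (x + u) - g x‖ₑ ^ 2 ≤
      ENNReal.ofReal (16 / σ) * ‖u‖ₑ ^ 2 *
        ∫⁻ θ in Ioc (0 : ℝ) 1, ENNReal.ofReal (θ ^ (1 - σ)) * gradDensity D (x + θ • u) := by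
  have hm : Measurable fun x => u 0 * D 0 x + u 1 * D 1 x + u 2 * D 2 x :=
    (((hD 0).const_mul _).add ((hD 1).const_mul _)).add ((hD 2).const_mul _)
  filter_upwards [(weakDir_of_grad h u).enorm_sub_le hm (t := 1) zero_le_one] with x hx hxs
  have hx' := hx (by simpa using hxs)
  rw [one_smul] at hx'
  have hsh : Measurable fun θ : ℝ => x + θ • u := by fun_prop
  -- Weighting by `θ^{σ-1}` costs the factor `1/σ`. The factor `θ^{1-σ}` left with the gradient is
  -- chosen to compensate the `θ^{-(2-2σ)}` that the later integration in `z` produces, leaving the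
  -- integrable `θ^{σ-1}` again.
  have cs := sq_lintegral_le (τ := volume.restrict (Ioc (0 : ℝ) 1))
    (a := fun θ => ENNReal.ofReal (θ ^ (σ - 1))) (b := fun θ => ENNReal.ofReal (θ ^ (1 - σ)))
    (measurable_id.pow_const _).ennreal_ofReal.aemeasurable
    (measurable_id.pow_const _).ennreal_ofReal.aemeasurable
    (hm.comp hsh).enorm.aemeasurable (by
      filter_upwards [ae_restrict_mem measurableSet_Ioc] with r hr
      rw [← ENNReal.ofReal_mul (Real.rpow_nonneg hr.1.le _), ← Real.rpow_add hr.1]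
      simp)
  rw [lintegral_theta hσ] at cs
  refine (pow_le_pow_left' hx' 2).trans (cs.trans ?_)
  have hne : 16 * ‖u‖ₑ ^ 2 ≠ ⊤ := ENNReal.mul_ne_top (by norm_num) (by simp)
  calc ENNReal.ofReal (1 / σ) * ∫⁻ θ in Ioc (0 : ℝ) 1, ENNReal.ofReal (θ ^ (1 - σ)) * _ 
      ≤ ENNReal.ofReal (1 / σ) * ∫⁻ θ in Ioc (0 : ℝ) 1, (16 * ‖u‖ₑ ^ 2) *
          (ENNReal.ofReal (θ ^ (1 - σ)) * gradDensity D (x + θ • u)) := by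
        refine mul_le_mul' le_rfl (lintegral_mono fun θ => ?_)
        rw [mul_left_comm]
        exact mul_le_mul' le_rfl (enorm_dir_sq_le D u _)
    _ = _ := by
        rw [lintegral_const_mul' _ _ hne, div_eq_mul_one_div (16 : ℝ), ENNReal.ofReal_mul (by norm_num),
          ENNReal.ofReal_ofNat]
        ring

/-- The kernel that the segments of length `‖z‖` contribute to the Gagliardo seminorm. -/
noncomputable def segKernel (σ : ℝ) (z : Space) (t : ℝ × ℝ) : ℝ≥0∞ :=
  if t.1 * ‖z‖ ≤ min t.2 (1 - t.2) then
    ENNReal.ofReal (‖z‖ ^ (-(1 + 2 * σ))) * ENNReal.ofReal (t.1 ^ (1 - σ)) else 0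

theorem measurable_segKernel_uncurry (σ : ℝ) :
    Measurable fun q : Space × ℝ × ℝ => segKernel σ q.1 q.2 := by
  have hA : MeasurableSet {q : Space × ℝ × ℝ | q.2.1 * ‖q.1‖ ≤ min q.2.2 (1 - q.2.2)} :=
    measurableSet_le (by fun_prop) (by fun_prop)
  have hf : Measurable fun q : Space × ℝ × ℝ =>
      ENNReal.ofReal (‖q.1‖ ^ (-(1 + 2 * σ))) * ENNReal.ofReal (q.2.1 ^ (1 - σ)) :=
    ((measurable_fst.norm.pow_const _).ennreal_ofReal).mul
      ((measurable_snd.fst.pow_const _).ennreal_ofReal)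
  exact Measurable.ite hA hf measurable_const

theorem measurable_segKernel (σ : ℝ) (z : Space) : Measurable (segKernel σ z) :=
  (measurable_segKernel_uncurry σ).comp measurable_prodMk_left

/-- For fixed `θ` the constraint is `‖z‖ ≤ d/θ`, and the radial integral of `‖z‖^{-(1+2σ)}` over
that ball is a multiple of `(d/θ)^{2-2σ}`. Multiplied by `θ^{1-σ}` this is `d^{2-2σ} θ^{σ-1}`,
integrable in `θ`. -/
theorem lintegral_segKernel_le {σ : ℝ} (hσ : 0 < σ) (hσ1 : σ < 1) :
    ∃ C : ℝ≥0, ∀ y : ℝ, 0 < y → y < 1 →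
      ∫⁻ z : Space, ∫⁻ θ in Ioc (0 : ℝ) 1, segKernel σ z (θ, y)
        ≤ C * ENNReal.ofReal (min y (1 - y) ^ (2 - 2 * σ)) := by
  obtain ⟨A, hA, hAR⟩ := lintegral_norm_rpow_le (s := -(1 + 2 * σ)) (by linarith)
  refine ⟨Real.toNNReal (A * (1 / σ)), fun y hy0 hy1 => ?_⟩
  set d := min y (1 - y) with hd
  have hd0 : 0 < d := lt_min hy0 (by linarith)
  have hm : Measurable fun q : Space × ℝ => segKernel σ q.1 (q.2, y) :=
    (measurable_segKernel_uncurry σ).comp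
      (measurable_fst.prodMk (measurable_snd.prodMk measurable_const))
  rw [lintegral_lintegral_swap hm.aemeasurable]
  calc ∫⁻ θ in Ioc (0 : ℝ) 1, ∫⁻ z : Space, segKernel σ z (θ, y)
      ≤ ∫⁻ θ in Ioc (0 : ℝ) 1, ENNReal.ofReal (A * d ^ (2 - 2 * σ)) * ENNReal.ofReal (θ ^ (σ - 1)) := by
        refine setLIntegral_mono' measurableSet_Ioc fun θ hθ => ?_
        have e1 : ∀ z : Space, segKernel σ z (θ, y) = ENNReal.ofReal (θ ^ (1 - σ)) *
            {z : Space | ‖z‖ ≤ d / θ}.indicator (fun z => ENNReal.ofReal (‖z‖ ^ (-(1 + 2 * σ)))) z := by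
          intro z
          by_cases h : θ * ‖z‖ ≤ d
          · have h' : ‖z‖ ≤ d / θ := by rw [le_div_iff₀ hθ.1]; linarith
            rw [indicator_of_mem (show z ∈ {z : Space | ‖z‖ ≤ d / θ} from h'), segKernel, if_pos h,
              mul_comm]
          · have h' : ¬ ‖z‖ ≤ d / θ := by rw [le_div_iff₀ hθ.1]; linarith
            rw [indicator_of_notMem (show z ∉ {z : Space | ‖z‖ ≤ d / θ} from h'), segKernel, if_neg h,
              mul_zero]
        simp_rw [e1]
        rw [lintegral_const_mul' _ _ ENNReal.ofReal_ne_top]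
        calc _ ≤ ENNReal.ofReal (θ ^ (1 - σ)) *
              ENNReal.ofReal (A * (d / θ) ^ (-(1 + 2 * σ) + 3)) := by
              gcongr
              exact hAR _ (div_nonneg hd0.le hθ.1.le)
          _ = _ := by
              have h1 := Real.rpow_nonneg hθ.1.le (1 - σ)
              have h2 : 0 ≤ A * d ^ (2 - 2 * σ) := mul_nonneg hA (Real.rpow_nonneg hd0.le _)
              rw [← ENNReal.ofReal_mul h1, ← ENNReal.ofReal_mul h2]
              congr 1
              have h3 : -(1 + 2 * σ) + 3 = 2 - 2 * σ := by ring
              have h4 : σ - 1 = (1 - σ) - (2 - 2 * σ) := by ring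
              rw [h3, Real.div_rpow hd0.le hθ.1.le, h4, Real.rpow_sub hθ.1 (1 - σ)]
              ring
    _ = ENNReal.ofReal (A * d ^ (2 - 2 * σ)) * ENNReal.ofReal (1 / σ) := by
        rw [lintegral_const_mul' _ _ ENNReal.ofReal_ne_top, lintegral_theta hσ]
    _ = _ := by
        have h2 : 0 ≤ A * d ^ (2 - 2 * σ) := mul_nonneg hA (Real.rpow_nonneg hd0.le _)
        have h3 : 0 ≤ A * (1 / σ) := mul_nonneg hA (by positivity)
        change _ = ENNReal.ofReal _ * _
        rw [← ENNReal.ofReal_mul h2, ← ENNReal.ofReal_mul h3]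
        congr 1
        ring

/-- The integral over base points and segments, for a given increment. -/
theorem lintegral_segments_le {ℓ : Fin 2 → ℝ} (hℓ : ∀ j, 0 < ℓ j) {D : Fin 3 → Space → ℝ}
    (hD : ∀ i, Measurable (D i)) (hDp : ∀ i, AEPeriodic ℓ (D i)) (σ : ℝ) (z β u : Space) :
    ∫⁻ x in cell ℓ, ∫⁻ θ in Ioc (0 : ℝ) 1,
        strip.indicator (fun p => segKernel σ z (θ, p 2) * gradDensity D p) (x + (β + θ • u))
      ≤ ∫⁻ p in cell ℓ, (∫⁻ θ in Ioc (0 : ℝ) 1, segKernel σ z (θ, p 2)) * gradDensity D p :=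
  lintegral_shift_le hℓ (volume.restrict (Ioc (0 : ℝ) 1)) (s := fun θ => β + θ • u)
    (by fun_prop) (measurable_segKernel σ z) (measurable_gradDensity hD) (ePeriodic_gradDensity hDp)

theorem lintegral_lintegral_segKernel_le (ℓ : Fin 2 → ℝ) {σ : ℝ} (hσ : 0 < σ) (hσ1 : σ < 1) :
    ∃ C : ℝ≥0, ∀ D : Fin 3 → Space → ℝ, (∀ i, Measurable (D i)) →
      ∫⁻ z : Space, ∫⁻ p in cell ℓ, (∫⁻ θ in Ioc (0 : ℝ) 1, segKernel σ z (θ, p 2)) * gradDensity D p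
        ≤ C * ∑ i, energy ℓ (2 - 2 * σ) (D i) := by
  obtain ⟨C, hC⟩ := lintegral_segKernel_le hσ hσ1
  refine ⟨C, fun D hD => ?_⟩
  have hm1 : Measurable fun q : (Space × Space) × ℝ => segKernel σ q.1.1 (q.2, q.1.2 2) :=
    (measurable_segKernel_uncurry σ).comp
      (show Measurable fun q : (Space × Space) × ℝ => (q.1.1, q.2, q.1.2 2) by fun_prop)
  have hm2 : Measurable fun q : Space × Space =>
      ∫⁻ θ in Ioc (0 : ℝ) 1, segKernel σ q.1 (θ, q.2 2) := hm1.lintegral_prod_right'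
  have hm3 : Measurable fun q : Space × Space =>
      (∫⁻ θ in Ioc (0 : ℝ) 1, segKernel σ q.1 (θ, q.2 2)) * gradDensity D q.2 :=
    hm2.mul ((measurable_gradDensity hD).comp measurable_snd)
  rw [lintegral_lintegral_swap hm3.aemeasurable]
  calc _ ≤ ∫⁻ p in cell ℓ, C * (wt (2 - 2 * σ) p * gradDensity D p) := by
        refine setLIntegral_mono' (measurableSet_cell ℓ) fun p hp => ?_
        have hps := cell_subset_strip ℓ hp
        have hmp : Measurable fun z : Space => ∫⁻ θ in Ioc (0 : ℝ) 1, segKernel σ z (θ, p 2) := by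
          have := hm2.comp (measurable_id.prodMk (measurable_const (a := p)))
          exact this
        have hb := hC (p 2) hps.1 hps.2
        have hw : wt (2 - 2 * σ) p = ENNReal.ofReal (min (p 2) (1 - p 2) ^ (2 - 2 * σ)) := rfl
        rw [lintegral_mul_const _ hmp, ← mul_assoc, hw]
        exact mul_le_mul' hb le_rfl
    _ = C * ∑ i, energy ℓ (2 - 2 * σ) (D i) := by
        rw [lintegral_const_mul' _ _ ENNReal.coe_ne_top]
        simp only [gradDensity, energy, Finset.mul_sum]
        rw [lintegral_finsetSum]
        · rw [Finset.mul_sum]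
        · exact fun i _ => (measurable_wt _).mul ((hD i).enorm.pow_const 2)

/-- Near the diagonal an increment is split into a step along the normal, a parallel step, and a
step back. -/
theorem sq_sub_le_three (a b c d : ℝ) :
    ‖b - a‖ₑ ^ 2 ≤ 16 * (‖c - a‖ₑ ^ 2 + ‖d - c‖ₑ ^ 2 + ‖d - b‖ₑ ^ 2) := by
  have h1 : ‖b - a‖ₑ ≤ (‖c - a‖ₑ + ‖d - c‖ₑ) + ‖d - b‖ₑ := by
    calc ‖b - a‖ₑ = ‖((c - a) + (d - c)) - (d - b)‖ₑ := by congr 1; ring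
      _ ≤ ‖(c - a) + (d - c)‖ₑ + ‖d - b‖ₑ := enorm_sub_le
      _ ≤ _ := by gcongr; exact enorm_add_le _ _
  refine (pow_le_pow_left' h1 2).trans ((ennreal_add_sq_le _ _).trans ?_)
  calc 4 * ((‖c - a‖ₑ + ‖d - c‖ₑ) ^ 2 + ‖d - b‖ₑ ^ 2)
      ≤ 4 * (4 * (‖c - a‖ₑ ^ 2 + ‖d - c‖ₑ ^ 2) + 4 * ‖d - b‖ₑ ^ 2) := by
        gcongr
        · exact ennreal_add_sq_le _ _
        · exact le_mul_of_one_le_left' (by norm_num)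
    _ = _ := by ring

theorem bdryDist_ge {c : ℝ} (hc : c = 1 ∨ c = -1) {p : Space} {t : ℝ} (h0 : t ≤ sideDist c (p 2))
    (h1 : sideDist c (p 2) ≤ 1 - t) : t ≤ bdryDist p := by
  rw [bdryDist_eq hc]; exact le_min h0 (by linarith)

theorem abs_sideDist_add_sub {c : ℝ} (hc : c = 1 ∨ c = -1) (x z : Space) :
    |sideDist c ((x + z) 2) - sideDist c (x 2)| ≤ ‖z‖ := by
  have h := PiLp.norm_apply_le z 2
  have : sideDist c ((x + z) 2) - sideDist c (x 2) = c * z 2 := by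
    simp only [sideDist, PiLp.add_apply]; ring
  rw [this, abs_mul]
  rcases hc with rfl | rfl <;> simpa using h

/-- A segment that stays away from the boundary, in terms of the kernel. -/
theorem increment_le_segKernel {g : Space → ℝ} {D : Fin 3 → Space → ℝ} (hD : ∀ i, Measurable (D i))
    (h : ∀ i, HasWeakD (incr 0 i) g (D i)) {σ : ℝ} (hσ : 0 < σ) (z β u : Space) (hu : ‖u‖ = ‖z‖) :
    ∀ᵐ x, (∀ θ ∈ Icc (0 : ℝ) 1, x + (β + θ • u) ∈ strip ∧ θ * ‖z‖ ≤ bdryDist (x + (β + θ • u))) →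
      ENNReal.ofReal (‖z‖ ^ (-(3 + 2 * σ))) * ‖g (x + β + u) - g (x + β)‖ₑ ^ 2 ≤
        ENNReal.ofReal (16 / σ) * ∫⁻ θ in Ioc (0 : ℝ) 1,
          strip.indicator (fun p => segKernel σ z (θ, p 2) * gradDensity D p) (x + (β + θ • u)) := by
  have h1 := (measurePreserving_add_right (volume : Measure Space) β).quasiMeasurePreserving.ae
    (sq_increment_le hD h hσ u)
  filter_upwards [h1] with x hx hseg
  have hb0 := (hseg 0 ⟨le_rfl, zero_le_one⟩).1
  have hb1 := (hseg 1 ⟨zero_le_one, le_rfl⟩).1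
  rw [zero_smul, add_zero] at hb0
  rw [one_smul, ← add_assoc] at hb1
  calc ENNReal.ofReal (‖z‖ ^ (-(3 + 2 * σ))) * ‖g (x + β + u) - g (x + β)‖ₑ ^ 2
      ≤ ENNReal.ofReal (‖z‖ ^ (-(3 + 2 * σ))) * (ENNReal.ofReal (16 / σ) * ‖u‖ₑ ^ 2 *
        ∫⁻ θ in Ioc (0 : ℝ) 1, ENNReal.ofReal (θ ^ (1 - σ)) * gradDensity D (x + β + θ • u)) := by
        gcongr
        exact hx ⟨hb0, hb1⟩
    _ = ENNReal.ofReal (16 / σ) * ((ENNReal.ofReal (‖z‖ ^ (-(3 + 2 * σ))) * ‖u‖ₑ ^ 2) *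
        ∫⁻ θ in Ioc (0 : ℝ) 1, ENNReal.ofReal (θ ^ (1 - σ)) * gradDensity D (x + β + θ • u)) := by ring
    _ ≤ ENNReal.ofReal (16 / σ) * (ENNReal.ofReal (‖z‖ ^ (-(1 + 2 * σ))) *
        ∫⁻ θ in Ioc (0 : ℝ) 1, ENNReal.ofReal (θ ^ (1 - σ)) * gradDensity D (x + β + θ • u)) := by
        gcongr
        rw [← ofReal_norm, hu, ← ENNReal.ofReal_pow (norm_nonneg z),
          ← ENNReal.ofReal_mul (Real.rpow_nonneg (norm_nonneg z) _)]
        refine ENNReal.ofReal_le_ofReal ?_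
        -- At `z = 0` the kernel has no meaning as a negative power, but the factor `‖u‖²` vanishes
        -- there.
        rcases (norm_nonneg z).eq_or_lt with h0 | h0
        · rw [← h0]
          simp [Real.rpow_nonneg]
        · rw [← Real.rpow_natCast, ← Real.rpow_add h0]
          refine le_of_eq ?_
          congr 1
          push_cast
          ring
    _ = ENNReal.ofReal (16 / σ) * ∫⁻ θ in Ioc (0 : ℝ) 1,
          strip.indicator (fun p => segKernel σ z (θ, p 2) * gradDensity D p) (x + (β + θ • u)) := by
        rw [← lintegral_const_mul' _ _ ENNReal.ofReal_ne_top]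
        congr 1
        refine setLIntegral_congr_fun measurableSet_Ioc fun θ hθ => ?_
        obtain ⟨m1, m2⟩ := hseg θ ⟨hθ.1.le, hθ.2⟩
        simp only
        rw [indicator_of_mem m1, segKernel, if_pos (show θ * ‖z‖ ≤ min ((x + (β + θ • u)) 2)
          (1 - (x + (β + θ • u)) 2) from m2), mul_assoc, add_assoc]

theorem energy_zero (ℓ : Fin 2 → ℝ) (g : Space → ℝ) :
    energy ℓ 0 g = ∫⁻ x in cell ℓ, ‖g x‖ₑ ^ 2 := by
  simp [energy, wt]

/-- The integrand of the Gagliardo seminorm in terms of the increment `z = y - x`. -/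
noncomputable def gagliardoDensity (σ : ℝ) (g : Space → ℝ) (q : Space × Space) : ℝ≥0∞ :=
  strip.indicator
    (fun p => ENNReal.ofReal (‖q.2‖ ^ (-(3 + 2 * σ))) * ‖g p - g q.1‖ₑ ^ 2) (q.1 + q.2)

theorem measurable_gagliardoDensity (σ : ℝ) {g : Space → ℝ} (hg : Measurable g) :
    Measurable (gagliardoDensity σ g) := by
  have hA : MeasurableSet {q : Space × Space | q.1 + q.2 ∈ strip} :=
    (measurable_fst.add measurable_snd) measurableSet_strip
  have hf : Measurable fun q : Space × Space =>
      ENNReal.ofReal (‖q.2‖ ^ (-(3 + 2 * σ))) * ‖g (q.1 + q.2) - g q.1‖ₑ ^ 2 :=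
    ((measurable_snd.norm.pow_const _).ennreal_ofReal).mul
      (((hg.comp (measurable_fst.add measurable_snd)).sub (hg.comp measurable_fst)).enorm.pow_const 2)
  have hfA := hf.indicator hA
  convert hfA using 1
  funext q
  by_cases h : q.1 + q.2 ∈ strip
  · rw [gagliardoDensity, indicator_of_mem h,
      indicator_of_mem (show q ∈ {q : Space × Space | q.1 + q.2 ∈ strip} from h)]
  · rw [gagliardoDensity, indicator_of_notMem h,
      indicator_of_notMem (show q ∉ {q : Space × Space | q.1 + q.2 ∈ strip} from h)]

theorem gagliardoSq_eq (ℓ : Fin 2 → ℝ) (σ : ℝ) (g : Space → ℝ) :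
    gagliardoSq ℓ σ g = ∫⁻ x in cell ℓ, ∫⁻ z, gagliardoDensity σ g (x, z) := by
  unfold gagliardoSq
  refine lintegral_congr fun x => ?_
  rw [← lintegral_indicator measurableSet_strip, ← lintegral_add_left_eq_self _ x]
  refine lintegral_congr fun z => ?_
  rw [gagliardoDensity]
  by_cases h : x + z ∈ strip
  · rw [indicator_of_mem h, indicator_of_mem h, ← sq_abs, ← Real.norm_eq_abs, norm_sub_rev (g x),
      sub_add_cancel_left, norm_neg, div_eq_mul_inv, ← Real.rpow_neg (norm_nonneg z), mul_comm,
      ENNReal.ofReal_mul (Real.rpow_nonneg (norm_nonneg z) _), ENNReal.ofReal_pow (norm_nonneg _),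
      ofReal_norm]
  · rw [indicator_of_notMem h, indicator_of_notMem h]

/-- Away from the diagonal no smoothness is needed: the kernel is integrable, the increment is
bounded by its two end values, and the shifted one is absorbed by periodicity. -/
theorem gagliardo_far_le {ℓ : Fin 2 → ℝ} (hℓ : ∀ j, 0 < ℓ j) (σ : ℝ) {g : Space → ℝ}
    (hg : Measurable g) (hgp : AEPeriodic ℓ g) :
    ∫⁻ x in cell ℓ, ∫⁻ z in (Metric.ball 0 (1 / 8))ᶜ, gagliardoDensity σ g (x, z)
      ≤ 8 * (∫⁻ z in (Metric.ball (0 : Space) (1 / 8))ᶜ, ENNReal.ofReal (‖z‖ ^ (-(3 + 2 * σ)))) *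
        energy ℓ 0 g := by
  set τ := (volume : Measure Space).restrict (Metric.ball 0 (1 / 8))ᶜ with hτ
  set κ : Space → ℝ≥0∞ := fun z => ENNReal.ofReal (‖z‖ ^ (-(3 + 2 * σ))) with hκ
  have hκm : Measurable κ := (measurable_norm.pow_const _).ennreal_ofReal
  have hΦm : Measurable fun x => ‖g x‖ₑ ^ 2 := hg.enorm.pow_const 2
  have hΦp : EPeriodic ℓ fun x => ‖g x‖ₑ ^ 2 := hgp.ePeriodic fun y => ‖y‖ₑ ^ 2
  have shift := lintegral_shift_le hℓ τ (s := id) measurable_id (k := fun t => κ t.1)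
    (hκm.comp measurable_fst) hΦm hΦp
  have h1 : ∀ x z, gagliardoDensity σ g (x, z)
      ≤ 4 * (strip.indicator (fun p => κ z * ‖g p‖ₑ ^ 2) (x + z) + κ z * ‖g x‖ₑ ^ 2) := by
    intro x z
    rw [gagliardoDensity]
    by_cases h : x + z ∈ strip
    · rw [indicator_of_mem h, indicator_of_mem h, ← mul_add, mul_left_comm]
      simp only [hκ]
      gcongr
      exact (pow_le_pow_left' (enorm_sub_le) 2).trans (ennreal_add_sq_le _ _)
    · rw [indicator_of_notMem h]
      exact zero_le
  have hκx : ∀ x, Measurable fun z => κ z * ‖g x‖ₑ ^ 2 := fun x => hκm.mul_const _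
  have hm2 : Measurable fun x => ∫⁻ z, κ z * ‖g x‖ₑ ^ 2 ∂τ := by
    simp_rw [lintegral_mul_const _ hκm]
    exact hΦm.const_mul _
  calc ∫⁻ x in cell ℓ, ∫⁻ z, gagliardoDensity σ g (x, z) ∂τ
      ≤ ∫⁻ x in cell ℓ, ∫⁻ z, 4 * (strip.indicator (fun p => κ z * ‖g p‖ₑ ^ 2) (x + z)
          + κ z * ‖g x‖ₑ ^ 2) ∂τ := lintegral_mono fun x => lintegral_mono fun z => h1 x z
    _ = 4 * ((∫⁻ x in cell ℓ, ∫⁻ z, strip.indicator (fun p => κ z * ‖g p‖ₑ ^ 2) (x + z) ∂τ) +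
          ∫⁻ x in cell ℓ, ∫⁻ z, κ z * ‖g x‖ₑ ^ 2 ∂τ) := by
        rw [← lintegral_add_right _ hm2, ← lintegral_const_mul' _ _ (by norm_num)]
        refine lintegral_congr fun x => ?_
        rw [lintegral_const_mul' _ _ (by norm_num), lintegral_add_right _ (hκx x)]
    _ ≤ 4 * ((∫⁻ z, κ z ∂τ) * energy ℓ 0 g + (∫⁻ z, κ z ∂τ) * energy ℓ 0 g) := by
        have e : ∫⁻ x in cell ℓ, (∫⁻ z, κ z ∂τ) * ‖g x‖ₑ ^ 2 = (∫⁻ z, κ z ∂τ) * energy ℓ 0 g := by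
          rw [lintegral_const_mul _ hΦm, energy_zero]
        gcongr
        · exact shift.trans e.le
        · refine le_of_eq ?_
          rw [← e]
          refine lintegral_congr fun x => ?_
          rw [lintegral_mul_const _ hκm]
    _ = _ := by ring

theorem norm_smul_sideVec {c : ℝ} (hc : c = 1 ∨ c = -1) {h : ℝ} (hh : 0 ≤ h) :
    ‖h • sideVec c‖ = h := by
  rcases hc with rfl | rfl <;> simp [sideVec, basisVec, norm_smul, abs_of_nonneg hh]

theorem sideDist_add_smul (c : ℝ) (x z : Space) (θ : ℝ) :
    sideDist c ((x + θ • z) 2)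
      = (1 - θ) * sideDist c (x 2) + θ * sideDist c ((x + z) 2) := by
  simp only [sideDist, PiLp.add_apply, PiLp.smul_apply, smul_eq_mul]; ring

/-- The straight segment from `x` to `x + z` may run along the boundary, so it is replaced by three:
inward by `‖z‖` from `x`, parallel to `z`, and back to `x + z`. On the two normal legs the distance
at parameter `θ` is at least `θ‖z‖`, and on the parallel leg it is at least `‖z‖`. As `1/2 + 1/8 +
1/8 = 3/4`, the opposite face stays far away. -/
theorem gagliardoDensity_near_le {g : Space → ℝ} {D : Fin 3 → Space → ℝ}
    (hD : ∀ i, Measurable (D i)) (h : ∀ i, HasWeakD (incr 0 i) g (D i)) {σ : ℝ} (hσ : 0 < σ)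
    {c : ℝ} (hc : c = 1 ∨ c = -1) {z : Space} (hz : ‖z‖ < 1 / 8) :
    ∀ᵐ x, x ∈ strip → sideDist c (x 2) ≤ 1 / 2 →
      gagliardoDensity σ g (x, z) ≤ ENNReal.ofReal (256 / σ) *
        ((∫⁻ θ in Ioc (0 : ℝ) 1, strip.indicator (fun p => segKernel σ z (θ, p 2) * gradDensity D p)
            (x + (0 + θ • (‖z‖ • sideVec c)))) +
          (∫⁻ θ in Ioc (0 : ℝ) 1, strip.indicator (fun p => segKernel σ z (θ, p 2) * gradDensity D p)
            (x + (‖z‖ • sideVec c + θ • z))) +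
          ∫⁻ θ in Ioc (0 : ℝ) 1, strip.indicator (fun p => segKernel σ z (θ, p 2) * gradDensity D p)
            (x + (z + θ • (‖z‖ • sideVec c)))) := by
  set v := ‖z‖ • sideVec c with hv
  have hvn : ‖v‖ = ‖z‖ := norm_smul_sideVec hc (norm_nonneg z)
  filter_upwards [increment_le_segKernel hD h hσ z 0 v hvn, increment_le_segKernel hD h hσ z v z rfl,
    increment_le_segKernel hD h hσ z z v hvn] with x h1 h2 h3 hx hxS
  have hz0 := norm_nonneg z
  have hq := (mem_strip_iff hc x).1 hx
  rw [gagliardoDensity]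
  by_cases hxz : x + z ∈ strip
  swap
  · rw [indicator_of_notMem hxz]; exact zero_le
  have hqz := (mem_strip_iff hc (x + z)).1 hxz
  have habs := abs_le.1 (abs_sideDist_add_sub hc x z)
  rw [indicator_of_mem hxz]
  have sv : ∀ (y : Space) (θ : ℝ), sideDist c ((y + θ • v) 2) = sideDist c (y 2) + θ * ‖z‖ := by
    intro y θ; rw [hv, smul_smul, sideDist_add hc]
  have seg : ∀ {p : Space} {θ : ℝ}, θ ∈ Icc (0 : ℝ) 1 → 0 < sideDist c (p 2) →
      θ * ‖z‖ ≤ sideDist c (p 2) → sideDist c (p 2) ≤ 3 / 4 →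
      p ∈ strip ∧ θ * ‖z‖ ≤ bdryDist p := by
    intro p θ hθ ha hb hd
    have hθz : θ * ‖z‖ ≤ ‖z‖ := mul_le_of_le_one_left hz0 hθ.2
    exact ⟨(mem_strip_iff hc p).2 ⟨ha, by linarith⟩, bdryDist_ge hc hb (by linarith)⟩
  have b1 := h1 fun θ hθ => by
    have hθz : θ * ‖z‖ ≤ ‖z‖ := mul_le_of_le_one_left hz0 hθ.2
    have hθ0 : 0 ≤ θ * ‖z‖ := mul_nonneg hθ.1 hz0
    have e := sv x θ
    rw [zero_add]
    exact seg hθ (by linarith [hq.1]) (by linarith [hq.1]) (by linarith)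
  have b2 := h2 fun θ hθ => by
    have hθz : θ * ‖z‖ ≤ ‖z‖ := mul_le_of_le_one_left hz0 hθ.2
    have e : sideDist c ((x + (v + θ • z)) 2)
        = (1 - θ) * sideDist c (x 2) + θ * sideDist c ((x + z) 2) + ‖z‖ := by
      have e1 := sv (x + θ • z) 1
      rw [one_smul, one_mul, sideDist_add_smul c x z θ] at e1
      have e2 : x + (v + θ • z) = x + θ • z + v := by abel
      rw [← e1, e2]
    have p1 : 0 ≤ (1 - θ) * sideDist c (x 2) := mul_nonneg (by linarith [hθ.2]) hq.1.le
    have p2 : 0 ≤ θ * sideDist c ((x + z) 2) := mul_nonneg hθ.1 hqz.1.le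
    have p3 : 0 < (1 - θ) * sideDist c (x 2) + θ * sideDist c ((x + z) 2) := by
      rcases hθ.1.eq_or_lt with h0 | h0
      · rw [← h0]; simpa using hq.1
      · have := mul_pos h0 hqz.1; linarith
    have p4 : (1 - θ) * sideDist c (x 2) ≤ (1 - θ) * (5 / 8) :=
      mul_le_mul_of_nonneg_left (by linarith) (by linarith [hθ.2])
    have p5 : θ * sideDist c ((x + z) 2) ≤ θ * (5 / 8) :=
      mul_le_mul_of_nonneg_left (by linarith) hθ.1
    exact seg hθ (by linarith) (by linarith) (by linarith)
  have b3 := h3 fun θ hθ => by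
    have hθz : θ * ‖z‖ ≤ ‖z‖ := mul_le_of_le_one_left hz0 hθ.2
    have hθ0 : 0 ≤ θ * ‖z‖ := mul_nonneg hθ.1 hz0
    have e := sv (x + z) θ
    rw [← add_assoc]
    exact seg hθ (by linarith [hqz.1]) (by linarith [hqz.1]) (by linarith)
  rw [add_zero] at b1
  rw [add_right_comm x z v] at b3
  have hsplit := sq_sub_le_three (g x) (g (x + z)) (g (x + v)) (g (x + v + z))
  have hconst : ENNReal.ofReal (256 / σ) = 16 * ENNReal.ofReal (16 / σ) := by
    rw [← ENNReal.ofReal_ofNat 16, ← ENNReal.ofReal_mul (by norm_num)]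
    congr 1; ring
  rw [hconst]
  calc _ ≤ ENNReal.ofReal (‖z‖ ^ (-(3 + 2 * σ))) * (16 * (‖g (x + v) - g x‖ₑ ^ 2
          + ‖g (x + v + z) - g (x + v)‖ₑ ^ 2 + ‖g (x + v + z) - g (x + z)‖ₑ ^ 2)) := by
        gcongr
    _ = 16 * (ENNReal.ofReal (‖z‖ ^ (-(3 + 2 * σ))) * ‖g (x + v) - g x‖ₑ ^ 2
          + ENNReal.ofReal (‖z‖ ^ (-(3 + 2 * σ))) * ‖g (x + v + z) - g (x + v)‖ₑ ^ 2
          + ENNReal.ofReal (‖z‖ ^ (-(3 + 2 * σ))) * ‖g (x + v + z) - g (x + z)‖ₑ ^ 2) := by ring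
    _ ≤ 16 * (_ + _ + _) := mul_le_mul' le_rfl (add_le_add (add_le_add b1 b2) b3)
    _ = _ := by ring

/-- After integration in `x` all three legs have the same bound, because `lintegral_segments_le`
does not see where a segment starts or points. Integrating that bound in `z` produces the weight
`d^{2-2σ}`. -/
theorem gagliardo_near_le {ℓ : Fin 2 → ℝ} (hℓ : ∀ j, 0 < ℓ j) {σ : ℝ} (hσ : 0 < σ) (hσ1 : σ < 1) :
    ∃ C : ℝ≥0, ∀ (g : Space → ℝ) (D : Fin 3 → Space → ℝ), Measurable g → (∀ i, Measurable (D i)) →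
      (∀ i, AEPeriodic ℓ (D i)) → (∀ i, HasWeakD (incr 0 i) g (D i)) →
      ∫⁻ x in cell ℓ, ∫⁻ z in Metric.ball 0 (1 / 8), gagliardoDensity σ g (x, z)
        ≤ C * ∑ i, energy ℓ (2 - 2 * σ) (D i) := by
  obtain ⟨C, hC⟩ := lintegral_lintegral_segKernel_le ℓ hσ hσ1
  refine ⟨2 * (Real.toNNReal (256 / σ) * (3 * C)), fun g D hg hD hDp h => ?_⟩
  push_cast
  rw [mul_assoc]
  refine lintegral_cell_le_of_sides fun c hc => ?_
  have hSm : MeasurableSet {x : Space | sideDist c (x 2) ≤ 1 / 2} :=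
    (measurable_sideDist c).comp (by fun_prop) measurableSet_Iic
  have hSm' := (measurableSet_cell ℓ).inter hSm
  rw [lintegral_lintegral_swap (f := fun x z => gagliardoDensity σ g (x, z))
    (measurable_gagliardoDensity σ hg).aemeasurable]
  set K : Space → ℝ≥0∞ := fun z =>
    ∫⁻ p in cell ℓ, (∫⁻ θ in Ioc (0 : ℝ) 1, segKernel σ z (θ, p 2)) * gradDensity D p with hK
  have hI : ∀ z β u : Space, Measurable fun x : Space => ∫⁻ θ in Ioc (0 : ℝ) 1,
      strip.indicator (fun p => segKernel σ z (θ, p 2) * gradDensity D p) (x + (β + θ • u)) := by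
    intro z β u
    have hF : Measurable fun q : ℝ × Space => segKernel σ z (q.1, q.2 2) * gradDensity D q.2 :=
      ((measurable_segKernel σ z).comp
        (show Measurable fun q : ℝ × Space => (q.1, q.2 2) by fun_prop)).mul
        ((measurable_gradDensity hD).comp measurable_snd)
    have h4 := (hF.indicator (measurable_snd measurableSet_strip)).comp
      (show Measurable fun q : Space × ℝ => (q.2, q.1 + (β + q.2 • u)) by fun_prop)
    have h5 : Measurable fun q : Space × ℝ =>
      strip.indicator (fun p => segKernel σ z (q.2, p 2) * gradDensity D p)
        (q.1 + (β + q.2 • u)) := h4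
    exact h5.lintegral_prod_right'
  calc _ ≤ ∫⁻ z in Metric.ball (0 : Space) (1 / 8), ENNReal.ofReal (256 / σ) * (3 * K z) := by
        refine setLIntegral_mono' measurableSet_ball fun z hz => ?_
        have hz' : ‖z‖ < 1 / 8 := by simpa using hz
        set I : Space → Space → Space → ℝ≥0∞ := fun β u x => ∫⁻ θ in Ioc (0 : ℝ) 1,
          strip.indicator (fun p => segKernel σ z (θ, p 2) * gradDensity D p) (x + (β + θ • u))
        have hae : ∀ᵐ x ∂(volume.restrict (cell ℓ ∩ {x | sideDist c (x 2) ≤ 1 / 2})),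
            gagliardoDensity σ g (x, z) ≤ ENNReal.ofReal (256 / σ) *
              (I 0 (‖z‖ • sideVec c) x + I (‖z‖ • sideVec c) z x + I z (‖z‖ • sideVec c) x) := by
          filter_upwards [ae_restrict_mem hSm',
            ae_restrict_of_ae (gagliardoDensity_near_le hD h hσ hc hz')] with x hx hb
          exact hb (cell_subset_strip ℓ hx.1) hx.2
        have seg : ∀ β u : Space, ∫⁻ x in cell ℓ ∩ {x | sideDist c (x 2) ≤ 1 / 2}, I β u x ≤ K z :=
          fun β u => (lintegral_mono_set inter_subset_left).trans
            (lintegral_segments_le hℓ hD hDp σ z β u)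
        calc _ ≤ _ := lintegral_mono_ae hae
          _ = ENNReal.ofReal (256 / σ) *
              ((∫⁻ x in cell ℓ ∩ {x | sideDist c (x 2) ≤ 1 / 2}, I 0 (‖z‖ • sideVec c) x) +
              (∫⁻ x in cell ℓ ∩ {x | sideDist c (x 2) ≤ 1 / 2}, I (‖z‖ • sideVec c) z x) +
              ∫⁻ x in cell ℓ ∩ {x | sideDist c (x 2) ≤ 1 / 2}, I z (‖z‖ • sideVec c) x) := by
            rw [lintegral_const_mul' _ _ ENNReal.ofReal_ne_top,
              lintegral_add_right _ (hI z z (‖z‖ • sideVec c)),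
              lintegral_add_right _ (hI z (‖z‖ • sideVec c) z)]
          _ ≤ ENNReal.ofReal (256 / σ) * (K z + K z + K z) :=
            mul_le_mul' le_rfl (add_le_add (add_le_add (seg _ _) (seg _ _)) (seg _ _))
          _ = _ := by ring
    _ = ENNReal.ofReal (256 / σ) * (3 * ∫⁻ z in Metric.ball (0 : Space) (1 / 8), K z) := by
        rw [lintegral_const_mul' _ _ ENNReal.ofReal_ne_top, lintegral_const_mul' _ _ (by norm_num)]
    _ ≤ ENNReal.ofReal (256 / σ) * (3 * (C * ∑ i, energy ℓ (2 - 2 * σ) (D i))) := by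
        gcongr
        exact (setLIntegral_le_lintegral _ _).trans (hC D hD)
    _ = _ := by
        change _ = ENNReal.ofReal (256 / σ) * _ * _
        ring

/-- The weighted space with gradient in `L²(d^{2-2σ})` embeds in the Slobodeckij space of order
`σ`. -/
theorem gagliardoSq_le {ℓ : Fin 2 → ℝ} (hℓ : ∀ j, 0 < ℓ j) {σ : ℝ} (hσ : 0 < σ) (hσ1 : σ < 1) :
    ∃ C : ℝ≥0, ∀ (g : Space → ℝ) (D : Fin 3 → Space → ℝ), Measurable g → (∀ i, Measurable (D i)) →
      AEPeriodic ℓ g → (∀ i, AEPeriodic ℓ (D i)) → (∀ i, HasWeakD (incr 0 i) g (D i)) →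
      gagliardoSq ℓ σ g ≤ C * (energy ℓ 0 g + ∑ i, energy ℓ (2 - 2 * σ) (D i)) := by
  obtain ⟨C, hC⟩ := gagliardo_near_le hℓ hσ hσ1
  have hfar := lintegral_norm_rpow_far_lt_top hσ
  set M := ∫⁻ z in (Metric.ball (0 : Space) (1 / 8))ᶜ, ENNReal.ofReal (‖z‖ ^ (-(3 + 2 * σ))) with hM
  refine ⟨C + 8 * M.toNNReal, fun g D hg hD hgp hDp h => ?_⟩
  rw [gagliardoSq_eq]
  have hm := measurable_gagliardoDensity σ hg
  calc ∫⁻ x in cell ℓ, ∫⁻ z, gagliardoDensity σ g (x, z)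
      = (∫⁻ x in cell ℓ, ∫⁻ z in Metric.ball 0 (1 / 8), gagliardoDensity σ g (x, z)) +
        ∫⁻ x in cell ℓ, ∫⁻ z in (Metric.ball 0 (1 / 8))ᶜ, gagliardoDensity σ g (x, z) := by
        rw [← lintegral_add_left hm.lintegral_prod_right']
        refine lintegral_congr fun x => ?_
        rw [lintegral_add_compl _ measurableSet_ball]
    _ ≤ C * ∑ i, energy ℓ (2 - 2 * σ) (D i) + 8 * M * energy ℓ 0 g :=
        add_le_add (hC g D hg hD hDp h) (gagliardo_far_le hℓ σ hg hgp)
    _ ≤ _ := by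
        push_cast
        rw [ENNReal.coe_toNNReal hfar.ne, add_mul]
        gcongr
        · exact le_add_self
        · exact le_self_add

/-! ### Weighted families of derivatives -/

/-- The family `u m` consists of measurable periodic representatives of the weak derivatives
`∂^m f`, `|m| ≤ b`, of a function, with weighted energies at most `E`. -/
structure WeightedFamily (ℓ : Fin 2 → ℝ) (α : ℝ) (b : ℕ) (u : (Fin 3 → ℕ) → Space → ℝ)
    (E : ℝ≥0∞) : Prop where
  measurable : ∀ m, Measurable (u m)
  periodic : ∀ m, order m ≤ b → AEPeriodic ℓ (u m)
  deriv : ∀ m s, order m + 1 ≤ b → HasWeakD (incr 0 s) (u m) (u (incr m s))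
  energy_le : ∀ m, order m ≤ b → energy ℓ (α + m 2) (u m) ≤ E

/-- `weakD` is an arbitrary choice, measurable only up to null sets. Borel representatives make
translation and Fubini arguments available, and consecutive members are linked by first-order weak
derivatives. -/
theorem exists_weightedFamily {ℓ : Fin 2 → ℝ} {α : ℝ} {b : ℕ} {f : Space → ℝ} {E : ℝ≥0∞}
    (hf : AEPeriodic ℓ f) (hd : ∀ m, order m ≤ b → ∃ g, HasWeakD m f g)
    (hE : ∀ m, order m ≤ b → energy ℓ (α + m 2) (weakD m f) ≤ E) :
    ∃ u, WeightedFamily ℓ α b u E ∧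
      ∀ m, order m ≤ b → weakD m f =ᵐ[volume.restrict strip] u m := by
  classical
  have h : ∀ m, ∃ v : Space → ℝ, Measurable v ∧
      (order m ≤ b → weakD m f =ᵐ[volume.restrict strip] v) := by
    intro m
    by_cases hm : order m ≤ b
    · have h1 := (hasWeakD_weakD (hd m hm)).2.1.aestronglyMeasurable
      exact ⟨h1.mk _, h1.stronglyMeasurable_mk.measurable, fun _ => h1.ae_eq_mk⟩
    · exact ⟨0, measurable_const, fun h => absurd h hm⟩
  choose u hu1 hu2 using h
  have hw : ∀ m, order m ≤ b → HasWeakD m f (u m) := fun m hm =>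
    (hasWeakD_weakD (hd m hm)).congr (Filter.EventuallyEq.refl _ _) (hu2 m hm)
  refine ⟨u, ⟨hu1, fun m hm => (hw m hm).aePeriodic hf, fun m s hm => ?_, fun m hm => ?_⟩, hu2⟩
  · exact (hw m (by omega)).of_incr (hw _ (by rw [order_incr]; exact hm))
  · rw [← energy_congr ℓ _ (hu2 m hm)]
    exact hE m hm

/-- Induction on the number `j` of derivatives left. One use of Hardy replaces `γ` by `γ + 2`, `m₃`
by `m₃ + 1` and `j + 1` by `j`, and these changes carry `α + m₃ - (j + 1) ≤ γ` exactly to the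
condition needed at the next stage. -/
theorem WeightedFamily.energy_descent {ℓ : Fin 2 → ℝ} (hℓ : ∀ j, 0 < ℓ j) {α : ℝ} (hα : 0 ≤ α)
    (b j : ℕ) : ∀ γ : ℝ, 0 ≤ γ → ∃ C : ℝ≥0, ∀ u E, WeightedFamily ℓ α b u E →
      ∀ m, order m + j = b → α + m 2 - j ≤ γ → energy ℓ γ (u m) ≤ C * E := by
  induction j with
  | zero =>
    intro γ _
    refine ⟨1, fun u E hu m hm hγ => ?_⟩
    rw [ENNReal.coe_one, one_mul]
    exact (energy_anti ℓ (by simpa using hγ) _).trans (hu.energy_le m (by omega))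
  | succ j ih =>
    intro γ hγ0
    obtain ⟨C, hC⟩ := ih (γ + 2) (by linarith)
    -- The exponent `α + b` is at least `α + m₃` for every index of the family, so the interior term
    -- is bounded by `E` at once.
    obtain ⟨C', hC'⟩ := hardy hℓ hγ0 (a := α + b) (by positivity)
    refine ⟨C' * (C + 1), fun u E hu m hm hγ => ?_⟩
    have hm1 : order m + 1 ≤ b := by omega
    have hm2 : order (incr m 2) ≤ b := by rw [order_incr]; exact hm1
    have h1 := hC' (u m) (u (incr m 2)) (hu.measurable _) (hu.measurable _)
      (hu.periodic m (by omega)) (hu.periodic _ hm2) (weakDir_of_hasWeakD (hu.deriv m 2 hm1))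
    have h2 := hC u E hu (incr m 2) (by rw [order_incr]; omega) (by
      rw [incr_two_apply_two]; push_cast at hγ ⊢; linarith)
    have h3 : energy ℓ (α + b) (u m) ≤ E := by
      refine (energy_anti ℓ ?_ _).trans (hu.energy_le m (by omega))
      have : m 2 ≤ b := (apply_le_order m 2).trans (by omega)
      have : (m 2 : ℝ) ≤ b := by exact_mod_cast this
      linarith
    calc energy ℓ γ (u m) ≤ C' * (energy ℓ (γ + 2) (u (incr m 2)) + energy ℓ (α + b) (u m)) := h1
      _ ≤ C' * (C * E + E) := by gcongr
      _ = _ := by push_cast; ring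

/-- Every unused derivative lowers the exponent of the weight by one. -/
theorem WeightedFamily.energy_lower {ℓ : Fin 2 → ℝ} (hℓ : ∀ j, 0 < ℓ j) {α : ℝ} (hα : 0 ≤ α)
    (b : ℕ) {γ : ℝ} (hγ : 0 ≤ γ) : ∃ C : ℝ≥0, ∀ u E, WeightedFamily ℓ α b u E →
      ∀ m, order m ≤ b → α + m 2 + order m - b ≤ γ → energy ℓ γ (u m) ≤ C * E := by
  -- The descent constant depends on `j = b - |m|`; summing over `j ≤ b` gives one constant for all
  -- `m`.
  choose C hC using fun j => WeightedFamily.energy_descent hℓ hα b j γ hγ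
  refine ⟨∑ j ∈ Finset.range (b + 1), C j, fun u E hu m hm hle => ?_⟩
  have hb : ((b - order m : ℕ) : ℝ) = b - order m := by rw [Nat.cast_sub hm]
  refine (hC (b - order m) u E hu m (by omega) (by rw [hb]; linarith)).trans ?_
  gcongr
  exact Finset.single_le_sum (f := C) (fun _ _ => zero_le)
    (Finset.mem_range.2 (by omega))

/-! ### The Sobolev–Slobodeckij bound for one component -/

theorem gagliardoSq_congr (ℓ : Fin 2 → ℝ) (σ : ℝ) {g g' : Space → ℝ}
    (h : g =ᵐ[volume.restrict strip] g') : gagliardoSq ℓ σ g = gagliardoSq ℓ σ g' := by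
  unfold gagliardoSq
  refine lintegral_congr_ae ((ae_cell_of_ae_strip h).mono fun x hx => ?_)
  refine lintegral_congr_ae (h.mono fun y hy => ?_)
  simp only [hx, hy]

theorem lintegral_sq_eq_energy (ℓ : Fin 2 → ℝ) (g : Space → ℝ) :
    ∫⁻ x in cell ℓ, ENNReal.ofReal (g x ^ 2) = energy ℓ 0 g := by
  rw [energy_zero]
  refine lintegral_congr fun x => ?_
  rw [← sq_abs, ENNReal.ofReal_pow (abs_nonneg _), ← Real.norm_eq_abs, ofReal_norm]

/-- The embedding of the weighted space into the Sobolev–Slobodeckij space, for one component. -/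
theorem sobolevSq_le {ℓ : Fin 2 → ℝ} (hℓ : ∀ j, 0 < ℓ j) {α : ℝ} (hα : 0 < α) {b : ℕ}
    (hb : α ≤ b) : ∃ C : ℝ≥0, ∀ (f : Space → ℝ) (E : ℝ≥0∞), AEPeriodic ℓ f →
      (∀ m, order m ≤ b → ∃ g, HasWeakD m f g) →
      (∀ m, order m ≤ b → energy ℓ (α + m 2) (weakD m f) ≤ E) →
      (∑ k ∈ Finset.range (⌊((b : ℝ) - α) / 2⌋₊ + 1), ∑ m ∈ multiIdx k,
        ∫⁻ x in cell ℓ, ENNReal.ofReal ((weakD m f x) ^ 2)) +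
      (if Int.fract (((b : ℝ) - α) / 2) = 0 then 0
        else ∑ m ∈ multiIdx ⌊((b : ℝ) - α) / 2⌋₊,
          gagliardoSq ℓ (Int.fract (((b : ℝ) - α) / 2)) (weakD m f)) ≤ C * E := by
  set s := ((b : ℝ) - α) / 2 with hs
  have hs0 : 0 ≤ s := by rw [hs]; linarith
  set n := ⌊s⌋₊ with hn
  have hns : (n : ℝ) ≤ s := Nat.floor_le hs0
  -- At least one derivative is left beyond order `⌊s⌋`, so the gradients used for the Gagliardo
  -- seminorm belong to the family.
  have hnb : n + 1 ≤ b := by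
    have : (n : ℝ) < b := by
      have : s < b := by rw [hs]; linarith
      linarith
    exact_mod_cast this
  obtain ⟨C₁, hC₁⟩ := WeightedFamily.energy_lower hℓ hα.le b (γ := 0) le_rfl
  -- Exponent `0` is reached because `m₃ + |m| ≤ 2n ≤ 2s = b - α`.
  have hlow : ∀ u E, WeightedFamily ℓ α b u E → ∀ m, order m ≤ n → energy ℓ 0 (u m) ≤ C₁ * E := by
    intro u E hu m hm
    refine hC₁ u E hu m (by omega) ?_
    have h1 : (m 2 : ℝ) ≤ order m := by exact_mod_cast apply_le_order m 2
    have h2 : (order m : ℝ) ≤ n := by exact_mod_cast hm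
    have h3 : 2 * s = b - α := by rw [hs]; ring
    linarith
  have hgag : ∃ C₂ : ℝ≥0, Int.fract s ≠ 0 → ∀ u E, WeightedFamily ℓ α b u E → ∀ m, order m = n →
      gagliardoSq ℓ (Int.fract s) (u m) ≤ C₂ * E := by
    by_cases h0 : Int.fract s = 0
    · exact ⟨0, fun h => absurd h0 h⟩
    have hσ : 0 < Int.fract s := lt_of_le_of_ne (Int.fract_nonneg s) (Ne.symm h0)
    have hσ1 := Int.fract_lt_one s
    obtain ⟨C₃, hC₃⟩ := gagliardoSq_le hℓ hσ hσ1
    obtain ⟨C₄, hC₄⟩ := WeightedFamily.energy_lower hℓ hα.le b (γ := 2 - 2 * Int.fract s)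
      (by linarith)
    refine ⟨C₃ * (C₁ + 3 * C₄), fun _ u E hu m hm => ?_⟩
    have hle : ∀ i, order (incr m i) ≤ b := fun i => by rw [order_incr]; omega
    have h1 := hC₃ (u m) (fun i => u (incr m i)) (hu.measurable m) (fun i => hu.measurable _)
      (hu.periodic m (by omega)) (fun i => hu.periodic _ (hle i)) fun i => hu.deriv m i (by omega)
    have h2 : ∀ i, energy ℓ (2 - 2 * Int.fract s) (u (incr m i)) ≤ C₄ * E := by
      intro i
      -- The required exponent is at most `α + 2(n + 1) - b = 2 - 2(s - n)`, which is exactly `2 - 2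
      -- * Int.fract s`.
      refine hC₄ u E hu _ (hle i) ?_
      have e1 : (incr m i 2 : ℝ) ≤ n + 1 := by
        have := (incr_apply_two_le m i).trans (Nat.add_le_add_right (apply_le_order m 2) 1)
        rw [hm] at this
        exact_mod_cast this
      have e2 : (n : ℝ) + Int.fract s = s := by
        rw [hn, natCast_floor_eq_intCast_floor hs0]
        exact Int.floor_add_fract s
      have h3 : 2 * s = b - α := by rw [hs]; ring
      rw [order_incr, hm]
      push_cast
      linarith
    calc gagliardoSq ℓ (Int.fract s) (u m) ≤ _ := h1
      _ ≤ C₃ * (C₁ * E + ∑ _i : Fin 3, C₄ * E) :=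
        mul_le_mul' le_rfl (add_le_add (hlow u E hu m hm.le) (Finset.sum_le_sum fun i _ => h2 i))
      _ = _ := by
        rw [Finset.sum_const, Finset.card_univ, Fintype.card_fin, nsmul_eq_mul]
        push_cast
        ring
  obtain ⟨C₂, hC₂⟩ := hgag
  refine ⟨(∑ k ∈ Finset.range (n + 1), ∑ _m ∈ multiIdx k, C₁) + ∑ _m ∈ multiIdx n, C₂,
    fun f E hf hd hE => ?_⟩
  obtain ⟨u, hu, huf⟩ := exists_weightedFamily hf hd hE
  push_cast
  rw [add_mul, Finset.sum_mul]
  simp_rw [Finset.sum_mul]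
  refine add_le_add (Finset.sum_le_sum fun k hk => Finset.sum_le_sum fun m hm => ?_) ?_
  · have hk' : order m ≤ n := by
      rw [mem_multiIdx.1 hm]; exact Nat.lt_succ_iff.1 (Finset.mem_range.1 hk)
    rw [lintegral_sq_eq_energy, energy_congr ℓ 0 (huf m (by omega))]
    exact hlow u E hu m hk'
  · split_ifs with h0
    · exact zero_le
    · refine Finset.sum_le_sum fun m hm => ?_
      have hm' := mem_multiIdx.1 hm
      rw [gagliardoSq_congr ℓ _ (huf m (by omega))]
      exact hC₂ h0 u E hu m hm'

/-! ### Iterated integrals -/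

theorem lintegral_space {F : Space → ℝ≥0∞} (hF : Measurable F) :
    ∫⁻ x, F x = ∫⁻ a : ℝ, ∫⁻ b : ℝ, ∫⁻ c : ℝ,
      F (a • basisVec 0 + (b • basisVec 1 + c • basisVec 2)) := by
  have hv : ∀ a b c : ℝ, a • basisVec 0 + (b • basisVec 1 + c • basisVec 2)
      = WithLp.toLp 2 ![a, b, c] := by
    intro a b c
    ext i
    fin_cases i <;> simp [basisVec]
  have h1 := (PiLp.volume_preserving_toLp (Fin 3)).lintegral_comp hF
  have hF1 : Measurable fun y : Fin 3 → ℝ => F (WithLp.toLp 2 y) :=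
    hF.comp (PiLp.volume_preserving_toLp (Fin 3)).measurable
  have mp2 := (volume_preserving_piFinSuccAbove (fun _ : Fin 3 => ℝ) 0).symm
  have h2 := mp2.lintegral_comp hF1
  have mp3 := (volume_preserving_finTwoArrow ℝ).symm
  rw [← h1, ← h2]
  have hF2 : Measurable fun y : ℝ × (Fin 2 → ℝ) =>
      F (WithLp.toLp 2 ((MeasurableEquiv.piFinSuccAbove (fun _ : Fin 3 => ℝ) 0).symm y)) :=
    hF1.comp mp2.measurable
  have e : (volume : Measure (ℝ × (Fin 2 → ℝ))) = volume.prod volume := rfl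
  rw [e, lintegral_prod _ hF2.aemeasurable]
  refine lintegral_congr fun a => ?_
  have hF3 : Measurable fun y : Fin 2 → ℝ =>
      F (WithLp.toLp 2 ((MeasurableEquiv.piFinSuccAbove (fun _ : Fin 3 => ℝ) 0).symm (a, y))) :=
    hF2.comp measurable_prodMk_left
  have h3 := mp3.lintegral_comp hF3
  have e' : (volume : Measure (ℝ × ℝ)) = volume.prod volume := rfl
  have hF4 : Measurable fun z : ℝ × ℝ => F (WithLp.toLp 2
      ((MeasurableEquiv.piFinSuccAbove (fun _ : Fin 3 => ℝ) 0).symm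
        (a, MeasurableEquiv.finTwoArrow.symm z))) := by
    have := hF3.comp mp3.measurable
    exact this
  rw [← h3, e', lintegral_prod _ hF4.aemeasurable]
  refine lintegral_congr fun b => lintegral_congr fun c => ?_
  rw [hv]
  congr 2
  funext i
  fin_cases i <;> rfl

/-! ### The bound in `L^∞` -/

/-- Negative `t` reduces to positive `t` by starting from the other end. Both signs are needed
because from an interior point the normal segments run towards both faces. -/
theorem WeakDir.enorm_sub_le_uIoc {u : Space} {g G : Space → ℝ} (h : WeakDir u g G)
    (hGm : Measurable G) (t : ℝ) :
    ∀ᵐ x, x ∈ strip ∧ x + t • u ∈ strip →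
      ‖g (x + t • u) - g x‖ₑ ≤ ∫⁻ r in uIoc 0 t, ‖G (x + r • u)‖ₑ := by
  rcases le_total 0 t with ht | ht
  · rw [uIoc_of_le ht]
    exact h.enorm_sub_le hGm ht
  · rw [uIoc_of_ge ht]
    have h1 := h.enorm_sub_le hGm (t := -t) (by linarith)
    have h2 := (measurePreserving_add_right (volume : Measure Space)
      (t • u)).quasiMeasurePreserving.ae h1
    filter_upwards [h2] with x hx hxs
    have e1 : x + t • u + -t • u = x := by rw [neg_smul, add_neg_cancel_right]
    have hx' := hx ⟨hxs.2, by rw [e1]; exact hxs.1⟩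
    rw [e1, enorm_sub_rev] at hx'
    refine hx'.trans (le_of_eq ?_)
    have hm : Measurable fun r : ℝ => ‖G (x + r • u)‖ₑ :=
      (hGm.comp (by fun_prop)).enorm
    have e2 := ((measurePreserving_add_left (volume : Measure ℝ) t).restrict_preimage
      (measurableSet_Ioc (a := t) (b := 0))).lintegral_comp hm
    rw [← e2]
    have e3 : (fun r => t + r) ⁻¹' Ioc t 0 = Ioc 0 (-t) := by
      ext r; simp only [mem_preimage, mem_Ioc]; constructor <;> rintro ⟨h1, h2⟩ <;>
        constructor <;> linarith
    rw [e3]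
    refine lintegral_congr fun r => ?_
    rw [add_smul, add_assoc]

/-- Integration over the part in the strip of a segment in direction `i`. -/
noncomputable def lineInt (I : Set ℝ) (i : Fin 3) (Φ : Space → ℝ≥0∞) (x : Space) : ℝ≥0∞ :=
  ∫⁻ r in I, strip.indicator Φ (x + r • basisVec i)

theorem measurable_lineInt (I : Set ℝ) (i : Fin 3) {Φ : Space → ℝ≥0∞} (hΦ : Measurable Φ) :
    Measurable (lineInt I i Φ) := by
  have h : Measurable fun q : Space × ℝ => strip.indicator Φ (q.1 + q.2 • basisVec i) :=
    (hΦ.indicator measurableSet_strip).comp (by fun_prop)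
  exact h.lintegral_prod_right'

/-- Null sets are translation invariant, so the inequality holds for every shift at almost every
point; Fubini exchanges the two quantifiers. -/
theorem lineInt_mono_ae (I : Set ℝ) (i : Fin 3) {Φ Ψ : Space → ℝ≥0∞}
    (hΦ : Measurable Φ) (hΨ : Measurable Ψ) (h : ∀ᵐ x, x ∈ strip → Φ x ≤ Ψ x) :
    ∀ᵐ x, lineInt I i Φ x ≤ lineInt I i Ψ x := by
  have hind : ∀ᵐ x, strip.indicator Φ x ≤ strip.indicator Ψ x := by
    filter_upwards [h] with x hx
    by_cases hxs : x ∈ strip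
    · rw [indicator_of_mem hxs, indicator_of_mem hxs]; exact hx hxs
    · rw [indicator_of_notMem hxs]; exact zero_le
  have hm : ∀ {Φ : Space → ℝ≥0∞}, Measurable Φ →
      Measurable fun q : ℝ × Space => strip.indicator Φ (q.2 + q.1 • basisVec i) := fun hΦ =>
    (hΦ.indicator measurableSet_strip).comp (by fun_prop)
  have hset : MeasurableSet {q : ℝ × Space | strip.indicator Φ (q.2 + q.1 • basisVec i)
      ≤ strip.indicator Ψ (q.2 + q.1 • basisVec i)} := measurableSet_le (hm hΦ) (hm hΨ)
  have h1 : ∀ᵐ r ∂(volume.restrict I), ∀ᵐ x, strip.indicator Φ (x + r • basisVec i)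
      ≤ strip.indicator Ψ (x + r • basisVec i) :=
    Filter.Eventually.of_forall fun r => (measurePreserving_add_right (volume : Measure Space)
      (r • basisVec i)).quasiMeasurePreserving.ae hind
  have h2 := (Measure.ae_ae_comm hset).1 h1
  filter_upwards [h2] with x hx
  exact lintegral_mono_ae hx

/-- A function is bounded by integrals along lines of itself and its derivative. -/
theorem enorm_le_lineInt {I : Set ℝ} (hI : I.OrdConnected) (hIm : MeasurableSet I) (h0 : (0 : ℝ) ∈ I)
    {i : Fin 3} {lam : ℝ} (hlam : 0 < lam)
    (hvol : ∀ x ∈ strip, volume (I ∩ {r : ℝ | x + r • basisVec i ∈ strip}) = ENNReal.ofReal lam)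
    {g G : Space → ℝ} (hg : Measurable g) (hG : Measurable G) (hw : HasWeakD (incr 0 i) g G) :
    ∀ᵐ x, x ∈ strip → ‖g x‖ₑ ≤ ENNReal.ofReal (lam⁻¹ + 1) *
      lineInt I i (fun y => ‖g y‖ₑ + ‖G y‖ₑ) x := by
  have hdir := weakDir_of_hasWeakD hw
  set e := basisVec i with he
  have hmg : Measurable fun q : ℝ × Space => g (q.2 + q.1 • e) := hg.comp (by fun_prop)
  have hmg' : Measurable fun q : ℝ × Space => g q.2 := hg.comp measurable_snd
  have hmG : Measurable fun q : (ℝ × Space) × ℝ => strip.indicator (fun y => ‖G y‖ₑ) (q.1.2 + q.2 • e) :=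
    (hG.enorm.indicator measurableSet_strip).comp (by fun_prop)
  have hms : MeasurableSet {q : ℝ × Space | q.2 ∈ strip ∧ q.2 + q.1 • e ∈ strip} :=
    (measurable_snd measurableSet_strip).inter
      ((show Measurable fun q : ℝ × Space => q.2 + q.1 • e by fun_prop) measurableSet_strip)
  have hset : MeasurableSet {q : ℝ × Space | q.2 ∈ strip ∧ q.2 + q.1 • e ∈ strip →
      ‖g (q.2 + q.1 • e) - g q.2‖ₑ ≤ ∫⁻ r in I, strip.indicator (fun y => ‖G y‖ₑ) (q.2 + r • e)} :=
    MeasurableSet.imp hms (measurableSet_le (hmg.sub hmg').enorm hmG.lintegral_prod_right')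
  -- The increment bound holds for each `t` off a null set depending on `t`; measurability of the
  -- joint set lets almost every `x` serve almost every `t`.
  have h1 : ∀ᵐ t ∂(volume.restrict I), ∀ᵐ x, x ∈ strip ∧ x + t • e ∈ strip →
      ‖g (x + t • e) - g x‖ₑ ≤ ∫⁻ r in I, strip.indicator (fun y => ‖G y‖ₑ) (x + r • e) := by
    filter_upwards [ae_restrict_mem hIm] with t ht
    filter_upwards [hdir.enorm_sub_le_uIoc hG t] with x hx hxs
    refine (hx hxs).trans ?_
    have hsub : uIoc 0 t ⊆ I := uIoc_subset_uIcc.trans (hI.uIcc_subset h0 ht)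
    refine le_trans (le_of_eq ?_) (lintegral_mono_set hsub)
    refine setLIntegral_congr_fun measurableSet_uIoc fun r hr => ?_
    have hmem : x + r • e ∈ strip := by
      rcases le_total 0 t with h | h
      · rw [uIoc_of_le h] at hr
        exact add_smul_mem_strip hxs.1 hxs.2 hr.1.le hr.2
      · rw [uIoc_of_ge h] at hr
        have := add_smul_mem_strip (x := x) (u := -e) (r := -r) (t := -t) hxs.1
          (by simpa using hxs.2) (by linarith [hr.2]) (by linarith [hr.1])
        simpa using this
    rw [indicator_of_mem hmem]
  have h2 := (Measure.ae_ae_comm hset).1 h1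
  filter_upwards [h2] with x hx hxs
  set J : Set ℝ := {r : ℝ | x + r • e ∈ strip} with hJ
  have hJm : MeasurableSet J := (show Measurable fun r : ℝ => x + r • e by fun_prop) measurableSet_strip
  set B := ∫⁻ r in I, strip.indicator (fun y => ‖G y‖ₑ) (x + r • e) with hB
  have hmx : Measurable fun r : ℝ => strip.indicator (fun y => ‖g y‖ₑ) (x + r • e) :=
    (hg.enorm.indicator measurableSet_strip).comp (by fun_prop)
  -- Averaging over the admissible end points, a set of measure `lam` independent of `x`.
  have key : ENNReal.ofReal lam * ‖g x‖ₑ ≤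
      (∫⁻ r in I, strip.indicator (fun y => ‖g y‖ₑ) (x + r • e)) + ENNReal.ofReal lam * B := by
    calc ENNReal.ofReal lam * ‖g x‖ₑ = ∫⁻ _ in I ∩ J, ‖g x‖ₑ := by
          rw [setLIntegral_const, hvol x hxs, mul_comm]
      _ ≤ ∫⁻ r in I ∩ J, (strip.indicator (fun y => ‖g y‖ₑ) (x + r • e) + B) := by
          refine lintegral_mono_ae ?_
          filter_upwards [ae_restrict_mem (hIm.inter hJm),
            ae_mono (Measure.restrict_mono (inter_subset_left (s := I) (t := J)) le_rfl) hx]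
            with r hr hxr
          have hrJ : x + r • e ∈ strip := hr.2
          rw [indicator_of_mem hrJ]
          calc ‖g x‖ₑ = ‖g (x + r • e) - (g (x + r • e) - g x)‖ₑ := by rw [sub_sub_cancel]
            _ ≤ ‖g (x + r • e)‖ₑ + ‖g (x + r • e) - g x‖ₑ := enorm_sub_le
            _ ≤ _ := by
              gcongr
              exact hxr ⟨hxs, hrJ⟩
      _ = (∫⁻ r in I ∩ J, strip.indicator (fun y => ‖g y‖ₑ) (x + r • e)) + ENNReal.ofReal lam * B := by
          rw [lintegral_add_left hmx, setLIntegral_const, hvol x hxs, mul_comm B]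
      _ ≤ _ := by
          gcongr
          exact inter_subset_left
  have hlin : lineInt I i (fun y => ‖g y‖ₑ + ‖G y‖ₑ) x
      = (∫⁻ r in I, strip.indicator (fun y => ‖g y‖ₑ) (x + r • e)) + B := by
    rw [lineInt, hB, ← lintegral_add_left hmx]
    refine lintegral_congr fun r => ?_
    by_cases hr : x + r • e ∈ strip
    · rw [← he, indicator_of_mem hr, indicator_of_mem hr, indicator_of_mem hr]
    · rw [← he, indicator_of_notMem hr, indicator_of_notMem hr, indicator_of_notMem hr, add_zero]
  rw [hlin]
  have hinv : ENNReal.ofReal lam⁻¹ * ENNReal.ofReal lam = 1 := by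
    rw [← ENNReal.ofReal_mul (by positivity), inv_mul_cancel₀ hlam.ne', ENNReal.ofReal_one]
  set P := ∫⁻ r in I, strip.indicator (fun y => ‖g y‖ₑ) (x + r • e)
  calc ‖g x‖ₑ = ENNReal.ofReal lam⁻¹ * (ENNReal.ofReal lam * ‖g x‖ₑ) := by
        rw [← mul_assoc, hinv, one_mul]
    _ ≤ ENNReal.ofReal lam⁻¹ * (P + ENNReal.ofReal lam * B) := by gcongr
    _ = ENNReal.ofReal lam⁻¹ * P + B := by rw [mul_add, ← mul_assoc _ _ B, hinv, one_mul]
    _ ≤ (ENNReal.ofReal lam⁻¹ + 1) * P + (ENNReal.ofReal lam⁻¹ + 1) * B := by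
        gcongr
        · exact le_self_add
        · exact le_mul_of_one_le_left' le_add_self
    _ = _ := by
        rw [ENNReal.ofReal_add (by positivity) zero_le_one, ENNReal.ofReal_one]
        ring

theorem lineInt_add (I : Set ℝ) (i : Fin 3) {Φ Ψ : Space → ℝ≥0∞} (hΦ : Measurable Φ) (x : Space) :
    lineInt I i (fun y => Φ y + Ψ y) x = lineInt I i Φ x + lineInt I i Ψ x := by
  have hm : Measurable fun r : ℝ => strip.indicator Φ (x + r • basisVec i) :=
    (hΦ.indicator measurableSet_strip).comp (by fun_prop)
  rw [lineInt, lineInt, lineInt, ← lintegral_add_left hm]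
  refine lintegral_congr fun r => ?_
  by_cases hr : x + r • basisVec i ∈ strip
  · rw [indicator_of_mem hr, indicator_of_mem hr, indicator_of_mem hr]
  · rw [indicator_of_notMem hr, indicator_of_notMem hr, indicator_of_notMem hr, add_zero]

theorem lineInt_const_mul (I : Set ℝ) (i : Fin 3) {c : ℝ≥0∞} (hc : c ≠ ⊤) (Φ : Space → ℝ≥0∞)
    (x : Space) : lineInt I i (fun y => c * Φ y) x = c * lineInt I i Φ x := by
  rw [lineInt, lineInt, ← lintegral_const_mul' _ _ hc]
  refine lintegral_congr fun r => ?_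
  by_cases hr : x + r • basisVec i ∈ strip
  · rw [indicator_of_mem hr, indicator_of_mem hr]
  · rw [indicator_of_notMem hr, indicator_of_notMem hr, mul_zero]

/-- The sum of the absolute values of the members of a family with indices in a list. -/
noncomputable def absSum (u : (Fin 3 → ℕ) → Space → ℝ) (L : List (Fin 3 → ℕ)) (x : Space) : ℝ≥0∞ :=
  (L.map fun m => ‖u m x‖ₑ).sum

theorem measurable_absSum {u : (Fin 3 → ℕ) → Space → ℝ} (hu : ∀ m, Measurable (u m))
    (L : List (Fin 3 → ℕ)) : Measurable (absSum u L) := by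
  induction L with
  | nil => exact measurable_const
  | cons m L ih =>
    have : absSum u (m :: L) = fun x => ‖u m x‖ₑ + absSum u L x := by
      funext x; simp [absSum]
    rw [this]
    exact (hu m).enorm.add ih

theorem absSum_append (u : (Fin 3 → ℕ) → Space → ℝ) (L L' : List (Fin 3 → ℕ)) (x : Space) :
    absSum u (L ++ L') x = absSum u L x + absSum u L' x := by
  simp [absSum]

/-- Adding the derivatives in direction `i` to a list of multi-indices. -/
def addDir (i : Fin 3) (L : List (Fin 3 → ℕ)) : List (Fin 3 → ℕ) := L ++ L.map fun m => incr m i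

/-- Stated for sums over a list so that it can be iterated: each direction enlarges the list by the
derivatives in that direction and adds one line integral. -/
theorem absSum_le_lineInt {ℓ : Fin 2 → ℝ} {α : ℝ} {b : ℕ} {u : (Fin 3 → ℕ) → Space → ℝ} {E : ℝ≥0∞}
    (hu : WeightedFamily ℓ α b u E) {I : Set ℝ} (hI : I.OrdConnected) (hIm : MeasurableSet I)
    (h0 : (0 : ℝ) ∈ I) {i : Fin 3} {lam : ℝ} (hlam : 0 < lam)
    (hvol : ∀ x ∈ strip, volume (I ∩ {r : ℝ | x + r • basisVec i ∈ strip}) = ENNReal.ofReal lam)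
    (L : List (Fin 3 → ℕ)) (hL : ∀ m ∈ L, order m + 1 ≤ b) :
    ∀ᵐ x, x ∈ strip → absSum u L x ≤
      ENNReal.ofReal (lam⁻¹ + 1) * lineInt I i (absSum u (addDir i L)) x := by
  have hadd : absSum u (addDir i L)
      = fun x => absSum u L x + absSum u (L.map fun m => incr m i) x := by
    funext x; exact absSum_append u _ _ x
  rw [hadd]
  clear hadd
  induction L with
  | nil => exact Filter.Eventually.of_forall fun x _ => by simp [absSum]
  | cons m L ih =>
    have h1 := enorm_le_lineInt hI hIm h0 hlam hvol (hu.measurable m) (hu.measurable _)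
      (hu.deriv m i (hL m (by simp)))
    filter_upwards [h1, ih fun m' hm' => hL m' (by simp [hm'])] with x hx1 hx2 hxs
    have e : (fun x => absSum u (m :: L) x + absSum u ((m :: L).map fun m => incr m i) x)
        = fun x => (‖u m x‖ₑ + ‖u (incr m i) x‖ₑ) +
          (absSum u L x + absSum u (L.map fun m => incr m i) x) := by
      funext x
      simp only [absSum, List.map_cons, List.sum_cons]
      ring
    have e' : absSum u (m :: L) x = ‖u m x‖ₑ + absSum u L x := by simp [absSum]
    have hmm : Measurable fun y => ‖u m y‖ₑ + ‖u (incr m i) y‖ₑ :=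
      (hu.measurable m).enorm.add (hu.measurable _).enorm
    rw [e, e', lineInt_add I i hmm, mul_add]
    exact add_le_add (hx1 hxs) (hx2 hxs)

/-- The iterated line integrals of a periodic density are bounded by the integral over the cell. -/
theorem lineInt_iterate_le {ℓ : Fin 2 → ℝ} (hℓ : ∀ j, 0 < ℓ j) {Φ : Space → ℝ≥0∞}
    (hΦ : Measurable Φ) (hp : EPeriodic ℓ Φ) (I : Set ℝ) (x : Space) :
    lineInt (Ico 0 (ℓ 0)) 0 (lineInt (Ico 0 (ℓ 1)) 1 (lineInt I 2 Φ)) x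
      ≤ ∫⁻ y in cell ℓ, Φ y := by
  have hind : ∀ (Ψ : Space → ℝ≥0∞) y, strip.indicator Ψ y ≤ Ψ y := fun Ψ y =>
    indicator_le_self _ _ _
  set H : Space → ℝ≥0∞ := fun y => strip.indicator Φ (y + x) with hH
  have hHm : Measurable H := (hΦ.indicator measurableSet_strip).comp (measurable_add_const x)
  calc lineInt (Ico 0 (ℓ 0)) 0 (lineInt (Ico 0 (ℓ 1)) 1 (lineInt I 2 Φ)) x
      ≤ ∫⁻ a in Ico 0 (ℓ 0), ∫⁻ b in Ico 0 (ℓ 1), ∫⁻ c : ℝ,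
          H (a • basisVec 0 + (b • basisVec 1 + c • basisVec 2)) := by
        unfold lineInt
        -- The outer indicators and the bounds on the normal range are dropped; the innermost
        -- indicator still confines the point to the strip.
        refine lintegral_mono fun a => (hind _ _).trans (lintegral_mono fun b => (hind _ _).trans ?_)
        refine (setLIntegral_le_lintegral _ _).trans (le_of_eq (lintegral_congr fun c => ?_))
        simp only [hH]
        congr 1
        abel
    _ = ∫⁻ a : ℝ, ∫⁻ b : ℝ, ∫⁻ c : ℝ,
          (column ℓ 0).indicator H (a • basisVec 0 + (b • basisVec 1 + c • basisVec 2)) := by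
        rw [← lintegral_indicator measurableSet_Ico]
        refine lintegral_congr fun a => ?_
        have hmem : ∀ b c : ℝ, a • basisVec 0 + (b • basisVec 1 + c • basisVec 2) ∈ column ℓ 0 ↔
            a ∈ Ico 0 (ℓ 0) ∧ b ∈ Ico 0 (ℓ 1) := by
          intro b c
          change _ ∈ Ico _ _ ∧ _ ∈ Ico _ _ ↔ _
          simp [basisVec]
        by_cases ha : a ∈ Ico 0 (ℓ 0)
        · rw [indicator_of_mem ha, ← lintegral_indicator measurableSet_Ico]
          refine lintegral_congr fun b => ?_
          by_cases hb : b ∈ Ico 0 (ℓ 1)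
          · rw [indicator_of_mem hb]
            refine lintegral_congr fun c => ?_
            rw [indicator_of_mem ((hmem b c).2 ⟨ha, hb⟩)]
          · rw [indicator_of_notMem hb]
            refine (lintegral_eq_zero_of_ae_eq_zero ?_).symm
            exact Filter.Eventually.of_forall fun c =>
              indicator_of_notMem (fun h => hb ((hmem b c).1 h).2) _
        · rw [indicator_of_notMem ha]
          refine (lintegral_eq_zero_of_ae_eq_zero ?_).symm
          refine Filter.Eventually.of_forall fun b => lintegral_eq_zero_of_ae_eq_zero ?_
          exact Filter.Eventually.of_forall fun c =>
              indicator_of_notMem (fun h => ha ((hmem b c).1 h).1) _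
    _ = ∫⁻ y in column ℓ 0, H y := by
        rw [← lintegral_space (hHm.indicator (measurableSet_column ℓ 0)),
          lintegral_indicator (measurableSet_column ℓ 0)]
    _ = ∫⁻ y in column ℓ x ∩ strip, Φ y := by
        rw [inter_comm, ← Measure.restrict_restrict measurableSet_strip,
          ← lintegral_indicator measurableSet_strip]
        have e := ((measurePreserving_add_right (volume : Measure Space) x).restrict_preimage
          (measurableSet_column ℓ x)).lintegral_comp (hΦ.indicator measurableSet_strip)
        rw [← e]
        congr 2
        ext y
        change (_ ∈ Ico _ _ ∧ _ ∈ Ico _ _) ↔ (_ ∈ Ico _ _ ∧ _ ∈ Ico _ _)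
        simp only [mem_Ico, PiLp.zero_apply, zero_add, PiLp.add_apply]
        constructor <;> rintro ⟨⟨_, _⟩, _, _⟩ <;> refine ⟨⟨?_, ?_⟩, ?_, ?_⟩ <;> linarith
    _ = _ := by
        rw [lintegral_column_eq hℓ hΦ hp x 0, lintegral_column_zero]

theorem volume_inter_tangential {ℓ : ℝ} {i : Fin 3} (hi : i ≠ 2) (x : Space) (hx : x ∈ strip) :
    volume (Ico 0 ℓ ∩ {r : ℝ | x + r • basisVec i ∈ strip}) = ENNReal.ofReal ℓ := by
  have : Ico 0 ℓ ∩ {r : ℝ | x + r • basisVec i ∈ strip} = Ico 0 ℓ := by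
    refine inter_eq_left.2 fun r _ => ?_
    change x + r • basisVec i ∈ strip
    rw [add_mem_strip_iff]
    · exact hx
    · simp [basisVec, hi.symm]
  rw [this, Real.volume_Ico, sub_zero]

/-- The interval `[-1, 1]` contains `0` and reaches both faces from any height, so the admissible
part of the normal line always has length one. -/
theorem volume_inter_normal (x : Space) (hx : x ∈ strip) :
    volume (Icc (-1) 1 ∩ {r : ℝ | x + r • basisVec 2 ∈ strip}) = ENNReal.ofReal 1 := by
  have : Icc (-1) 1 ∩ {r : ℝ | x + r • basisVec 2 ∈ strip} = Ioo (-(x 2)) (1 - x 2) := by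
    ext r
    change _ ∧ (_ < _ ∧ _ < _) ↔ _
    have e : (x + r • basisVec 2) 2 = x 2 + r := by simp [basisVec]
    rw [e, mem_Icc, mem_Ioo]
    have h1 := hx.1
    have h2 := hx.2
    constructor
    · rintro ⟨_, _, _⟩; constructor <;> linarith
    · rintro ⟨_, _⟩; refine ⟨⟨?_, ?_⟩, ?_, ?_⟩ <;> linarith
  rw [this, Real.volume_Ioo]
  congr 1; ring

/-- The multi-indices with entries `0` and `1`. -/
def mixedIdx : List (Fin 3 → ℕ) := addDir 2 (addDir 1 (addDir 0 [0]))

/-- A function is bounded by the integrals of its mixed derivatives. -/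
theorem WeightedFamily.enorm_le_mixed {ℓ : Fin 2 → ℝ} (hℓ : ∀ j, 0 < ℓ j) :
    ∃ C : ℝ≥0, ∀ (α : ℝ) (b : ℕ) u E, WeightedFamily ℓ α b u E → 3 ≤ b →
      ∀ᵐ x, x ∈ strip → ‖u 0 x‖ₑ ≤ C * ∫⁻ y in cell ℓ, absSum u mixedIdx y := by
  -- One factor `lam⁻¹ + 1` per direction, with `lam` the lengths `ℓ 0`, `ℓ 1` and `1`.
  refine ⟨Real.toNNReal ((ℓ 0)⁻¹ + 1) * (Real.toNNReal ((ℓ 1)⁻¹ + 1) * Real.toNNReal (1⁻¹ + 1)),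
    fun α b u E hu hb => ?_⟩
  set L1 := addDir 0 [0] with hL1
  set L2 := addDir 1 L1 with hL2
  have hm := hu.measurable
  have o1 : ∀ m ∈ L1, order m + 1 ≤ b := by
    intro m hm
    simp only [hL1, addDir, List.map_cons, List.map_nil, List.cons_append, List.nil_append,
      List.mem_cons, List.not_mem_nil, or_false] at hm
    rcases hm with rfl | rfl <;> simp only [order_incr, order_zero] <;> omega
  have o2 : ∀ m ∈ L2, order m + 1 ≤ b := by
    intro m hm
    simp only [hL2, hL1, addDir, List.map_cons, List.map_nil, List.cons_append, List.nil_append,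
      List.mem_cons, List.not_mem_nil, or_false] at hm
    rcases hm with rfl | rfl | rfl | rfl <;> simp only [order_incr, order_zero] <;> omega
  have s1 := absSum_le_lineInt hu ordConnected_Ico measurableSet_Ico ⟨le_rfl, hℓ 0⟩ (hℓ 0)
    (volume_inter_tangential (i := 0) (by decide)) [0] (by
      intro m hm
      simp only [List.mem_cons, List.not_mem_nil, or_false] at hm
      rw [hm, order_zero]; omega)
  have s2 := absSum_le_lineInt hu ordConnected_Ico measurableSet_Ico ⟨le_rfl, hℓ 1⟩ (hℓ 1)
    (volume_inter_tangential (i := 1) (by decide)) L1 o1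
  have s3 := absSum_le_lineInt hu ordConnected_Icc measurableSet_Icc
    (show (0 : ℝ) ∈ Icc (-1) 1 by constructor <;> norm_num) one_pos volume_inter_normal L2 o2
  rw [← hL1] at s1
  rw [← hL2] at s2
  set A2 := lineInt (Icc (-1) 1) 2 (absSum u (addDir 2 L2)) with hA2
  have hA2m : Measurable A2 := measurable_lineInt _ _ (measurable_absSum hm _)
  -- The pointwise bounds are inserted under the line integrals from the inside out: normal into the
  -- second tangential direction here, then into the first.
  have t2 := lineInt_mono_ae (Ico 0 (ℓ 1)) 1 (measurable_absSum hm L2)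
    (hA2m.const_mul (ENNReal.ofReal (1⁻¹ + 1))) s3
  have hb1 : ∀ᵐ x, x ∈ strip → absSum u L1 x ≤ ENNReal.ofReal ((ℓ 1)⁻¹ + 1) *
      (ENNReal.ofReal (1⁻¹ + 1) * lineInt (Ico 0 (ℓ 1)) 1 A2 x) := by
    filter_upwards [s2, t2] with x h1 h2 hxs
    refine (h1 hxs).trans (mul_le_mul' le_rfl (h2.trans (le_of_eq ?_)))
    exact lineInt_const_mul _ _ ENNReal.ofReal_ne_top _ _
  have hA1m : Measurable (lineInt (Ico 0 (ℓ 1)) 1 A2) := measurable_lineInt _ _ hA2m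
  have t1 := lineInt_mono_ae (Ico 0 (ℓ 0)) 0 (measurable_absSum hm L1)
    ((hA1m.const_mul (ENNReal.ofReal (1⁻¹ + 1))).const_mul (ENNReal.ofReal ((ℓ 1)⁻¹ + 1))) hb1
  have hper : EPeriodic ℓ (absSum u mixedIdx) := by
    have h8 : ∀ m ∈ mixedIdx, AEPeriodic ℓ (u m) := by
      intro m hm
      refine hu.periodic m ?_
      simp only [mixedIdx, addDir, List.map_cons, List.map_nil, List.cons_append, List.nil_append,
        List.mem_cons, List.not_mem_nil, or_false] at hm
      rcases hm with rfl | rfl | rfl | rfl | rfl | rfl | rfl | rfl <;>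
        simp only [order_incr, order_zero] <;> omega
    intro j
    have : ∀ᵐ x ∂(volume.restrict strip), ∀ m ∈ mixedIdx,
        u m (x + ℓ j • basisVec j.castSucc) = u m x := by
      have hc : {m | m ∈ mixedIdx}.Countable := (List.finite_toSet mixedIdx).countable
      exact (ae_ball_iff hc).2 fun m hm => h8 m hm j
    filter_upwards [this] with x hx
    unfold absSum
    congr 1
    exact List.map_congr_left fun m hm => by rw [hx m hm]
  filter_upwards [s1, t1] with x h1 h2 hxs
  have e0 : absSum u [0] x = ‖u 0 x‖ₑ := by simp [absSum]
  rw [← e0]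
  refine (h1 hxs).trans ?_
  rw [lineInt_const_mul _ _ ENNReal.ofReal_ne_top, lineInt_const_mul _ _ ENNReal.ofReal_ne_top] at h2
  push_cast
  change _ ≤ ENNReal.ofReal _ * (ENNReal.ofReal _ * ENNReal.ofReal _) * _
  rw [mul_assoc, mul_assoc]
  refine mul_le_mul' le_rfl (h2.trans (mul_le_mul' le_rfl (mul_le_mul' le_rfl ?_)))
  exact lineInt_iterate_le hℓ (measurable_absSum hm _) hper _ x

/-- Only the normal variable matters, and `min(c, 1-c)^{-γ}` is at most the sum of the two one-sided
powers, each integrable on `(0,1)` for `γ < 1`. -/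
theorem lintegral_wt_neg_lt_top (ℓ : Fin 2 → ℝ) {γ : ℝ} (hγ : γ < 1) :
    ∫⁻ x in cell ℓ, wt (-γ) x < ⊤ := by
  set h : ℝ → ℝ≥0∞ := fun c => ENNReal.ofReal (min c (1 - c) ^ (-γ)) with hh
  have hfin : ∫⁻ c in Ioo (0 : ℝ) 1, h c < ⊤ := by
    have e1 : ∫⁻ c in Ioo (0 : ℝ) 1, ENNReal.ofReal ((1 - c) ^ (-γ)) < ⊤ := by
      rw [lintegral_rpow_sub zero_le_one (by linarith)]
      exact ENNReal.ofReal_lt_top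
    have e2 : ∫⁻ c in Ioo (0 : ℝ) 1, ENNReal.ofReal (c ^ (-γ)) < ⊤ := by
      have := lintegral_theta (s := 1 - γ) (by linarith)
      refine lt_of_le_of_lt (lintegral_mono_set Ioo_subset_Ioc_self) ?_
      have e : -γ = 1 - γ - 1 := by ring
      rw [e, this]
      exact ENNReal.ofReal_lt_top
    refine lt_of_le_of_lt ?_ (ENNReal.add_lt_top.2 ⟨e1, e2⟩)
    have hm : Measurable fun c : ℝ => ENNReal.ofReal ((1 - c) ^ (-γ)) :=
      ((measurable_const.sub measurable_id).pow_const _).ennreal_ofReal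
    rw [← lintegral_add_left hm]
    refine lintegral_mono fun c => ?_
    simp only [hh]
    rcases min_choice c (1 - c) with e | e <;> rw [e]
    · exact le_add_self
    · exact le_self_add
  have hb : ∀ a b c : ℝ, (cell ℓ).indicator (wt (-γ))
      (a • basisVec 0 + (b • basisVec 1 + c • basisVec 2)) ≤
      (Ioo 0 (ℓ 0)).indicator 1 a * ((Ioo 0 (ℓ 1)).indicator 1 b * (Ioo 0 1).indicator h c) := by
    intro a b c
    by_cases hm : a • basisVec 0 + (b • basisVec 1 + c • basisVec 2) ∈ cell ℓ
    · rw [indicator_of_mem hm]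
      have e : ∀ i : Fin 3, (a • basisVec 0 + (b • basisVec 1 + c • basisVec 2)) i = ![a, b, c] i := by
        intro i; fin_cases i <;> simp [basisVec]
      obtain ⟨⟨h1, h2⟩, ⟨h3, h4⟩, h5, h6⟩ := hm
      rw [e] at h1 h2 h3 h4 h5 h6
      rw [indicator_of_mem (show a ∈ Ioo 0 (ℓ 0) from ⟨h1, h2⟩),
        indicator_of_mem (show b ∈ Ioo 0 (ℓ 1) from ⟨h3, h4⟩),
        indicator_of_mem (show c ∈ Ioo (0 : ℝ) 1 from ⟨h5, h6⟩), wt, bdryDist, e]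
      simp [hh]
    · rw [indicator_of_notMem hm]; exact zero_le
  have hc : ∫⁻ c : ℝ, (Ioo (0 : ℝ) 1).indicator h c ≠ ⊤ := by
    rw [lintegral_indicator measurableSet_Ioo]; exact hfin.ne
  have h1 : ∀ L : ℝ, ∫⁻ b : ℝ, (Ioo 0 L).indicator (1 : ℝ → ℝ≥0∞) b < ⊤ := by
    intro L
    rw [lintegral_indicator measurableSet_Ioo]
    simp
  have ne1 : ∀ (L b : ℝ), (Ioo 0 L).indicator (1 : ℝ → ℝ≥0∞) b ≠ ⊤ := by
    intro L b
    by_cases hb : b ∈ Ioo 0 L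
    · rw [indicator_of_mem hb]; simp
    · rw [indicator_of_notMem hb]; simp
  rw [← lintegral_indicator (measurableSet_cell ℓ),
    lintegral_space ((measurable_wt _).indicator (measurableSet_cell ℓ))]
  refine lt_of_le_of_lt (lintegral_mono fun a => lintegral_mono fun b => lintegral_mono fun c =>
    hb a b c) ?_
  have hmeas : Measurable fun b : ℝ => (Ioo 0 (ℓ 1)).indicator (1 : ℝ → ℝ≥0∞) b :=
    measurable_one.indicator measurableSet_Ioo
  have e : ∀ a : ℝ, ∫⁻ b : ℝ, ∫⁻ c : ℝ, (Ioo 0 (ℓ 0)).indicator (1 : ℝ → ℝ≥0∞) a *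
      ((Ioo 0 (ℓ 1)).indicator 1 b * (Ioo 0 1).indicator h c)
      = (Ioo 0 (ℓ 0)).indicator 1 a * ((∫⁻ b : ℝ, (Ioo 0 (ℓ 1)).indicator 1 b) *
        ∫⁻ c : ℝ, (Ioo (0 : ℝ) 1).indicator h c) := by
    intro a
    rw [← lintegral_mul_const' _ _ hc, ← lintegral_const_mul' _ _ (ne1 _ _)]
    refine lintegral_congr fun b => ?_
    rw [← lintegral_const_mul' _ _ (ne1 _ _), ← lintegral_const_mul' _ _ (ne1 _ _)]
  simp_rw [e]
  have hprod : (∫⁻ b : ℝ, (Ioo 0 (ℓ 1)).indicator 1 b) *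
        ∫⁻ c : ℝ, (Ioo (0 : ℝ) 1).indicator h c < ⊤ := ENNReal.mul_lt_top (h1 _) hc.lt_top
  rw [lintegral_mul_const' _ _ hprod.ne]
  exact ENNReal.mul_lt_top (h1 _) hprod

theorem sq_lintegral_enorm_le (ℓ : Fin 2 → ℝ) (γ : ℝ) {g : Space → ℝ} (hg : Measurable g) :
    (∫⁻ x in cell ℓ, ‖g x‖ₑ) ^ 2 ≤ (∫⁻ x in cell ℓ, wt (-γ) x) * energy ℓ γ g := by
  refine sq_lintegral_le (measurable_wt _).aemeasurable (measurable_wt _).aemeasurable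
    hg.enorm.aemeasurable ?_
  filter_upwards [ae_restrict_mem (measurableSet_cell ℓ)] with x hx
  have hd := bdryDist_pos (cell_subset_strip ℓ hx)
  rw [wt, wt, ← ENNReal.ofReal_mul (Real.rpow_nonneg hd.le _), ← Real.rpow_add hd]
  simp

theorem le_rpow_half_of_sq_le {a c : ℝ≥0∞} (h : a ^ 2 ≤ c) : a ≤ c ^ (1 / 2 : ℝ) := by
  have h1 := ENNReal.rpow_le_rpow h (show (0 : ℝ) ≤ 1 / 2 by norm_num)
  rwa [← ENNReal.rpow_natCast, ← ENNReal.rpow_mul, Nat.cast_ofNat,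
    show (2 : ℝ) * (1 / 2) = 1 by norm_num, ENNReal.rpow_one] at h1

/-- The bound in `L^∞`, for one component. -/
theorem enorm_le_of_energy {ℓ : Fin 2 → ℝ} (hℓ : ∀ j, 0 < ℓ j) {α : ℝ} (hα : 0 ≤ α) {b : ℕ}
    (hb : ⌊α⌋₊ + 4 ≤ b) : ∃ C : ℝ≥0, ∀ (f : Space → ℝ) (E : ℝ≥0∞), AEPeriodic ℓ f →
      (∀ m, order m ≤ b → ∃ g, HasWeakD m f g) →
      (∀ m, order m ≤ b → energy ℓ (α + m 2) (weakD m f) ≤ E) →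
      ∀ᵐ x ∂(volume.restrict (cell ℓ)), ‖f x‖ₑ ≤ C * E ^ (1 / 2 : ℝ) := by
  -- A mixed derivative has `|m| ≤ 3` and `m₃ ≤ 1`, so it reaches the exponent `α + 4 - b`. Since `b
  -- ≥ ⌊α⌋ + 4 > α + 3`, this is below `1` and `d^{-γ}` is integrable.
  set γ : ℝ := max 0 (α + 4 - b) with hγ
  have hγ0 : 0 ≤ γ := le_max_left _ _
  have hγ1 : γ < 1 := by
    have h1 : α < ⌊α⌋₊ + 1 := Nat.lt_floor_add_one α
    have h2 : ((⌊α⌋₊ + 4 : ℕ) : ℝ) ≤ b := by exact_mod_cast hb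
    push_cast at h2
    exact max_lt one_pos (by linarith)
  obtain ⟨C₁, hC₁⟩ := WeightedFamily.energy_lower hℓ hα b hγ0
  obtain ⟨C₂, hC₂⟩ := WeightedFamily.enorm_le_mixed hℓ
  have hM := lintegral_wt_neg_lt_top ℓ hγ1
  set M := ∫⁻ x in cell ℓ, wt (-γ) x with hMdef
  -- The factor `8` is the number of mixed multi-indices.
  refine ⟨C₂ * (8 * (M.toNNReal * C₁) ^ (1 / 2 : ℝ)), fun f E hf hd hE => ?_⟩
  obtain ⟨u, hu, huf⟩ := exists_weightedFamily hf hd hE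
  have hf0 : f =ᵐ[volume.restrict strip] u 0 := by
    obtain ⟨g, hg⟩ := hd 0 (by rw [order_zero]; omega)
    exact (hasWeakD_zero hg.1).weakD_ae_eq.symm.trans (huf 0 (by rw [order_zero]; omega))
  have hmix : ∀ m ∈ mixedIdx, ∫⁻ x in cell ℓ, ‖u m x‖ₑ
      ≤ ((M.toNNReal * C₁ : ℝ≥0) : ℝ≥0∞) ^ (1 / 2 : ℝ) * E ^ (1 / 2 : ℝ) := by
    intro m hm
    have ho : order m ≤ 3 ∧ m 2 ≤ 1 := by
      simp only [mixedIdx, addDir, List.map_cons, List.map_nil, List.cons_append, List.nil_append,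
        List.mem_cons, List.not_mem_nil, or_false] at hm
      rcases hm with rfl | rfl | rfl | rfl | rfl | rfl | rfl | rfl <;>
        exact ⟨by simp only [order_incr, order_zero]; omega, by simp [incr]⟩
    rw [← ENNReal.mul_rpow_of_nonneg _ _ (by norm_num)]
    refine le_rpow_half_of_sq_le ((sq_lintegral_enorm_le ℓ γ (hu.measurable m)).trans ?_)
    push_cast
    rw [ENNReal.coe_toNNReal hM.ne, mul_assoc]
    refine mul_le_mul' le_rfl (hC₁ u E hu m (by omega) (le_trans ?_ (le_max_right _ _)))
    have h1 : (order m : ℝ) ≤ 3 := by exact_mod_cast ho.1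
    have h2 : (m 2 : ℝ) ≤ 1 := by exact_mod_cast ho.2
    linarith
  have hsum : ∀ L : List (Fin 3 → ℕ), (∀ m ∈ L, m ∈ mixedIdx) → ∫⁻ y in cell ℓ, absSum u L y
      ≤ L.length * (((M.toNNReal * C₁ : ℝ≥0) : ℝ≥0∞) ^ (1 / 2 : ℝ) * E ^ (1 / 2 : ℝ)) := by
    intro L
    induction L with
    | nil => intro _; simp [absSum]
    | cons m L ih =>
      intro h
      have e : absSum u (m :: L) = fun x => ‖u m x‖ₑ + absSum u L x := by
        funext x; simp [absSum]
      rw [e, lintegral_add_left (hu.measurable m).enorm, List.length_cons]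
      push_cast
      rw [add_mul, one_mul, add_comm]
      exact add_le_add (ih fun m' hm' => h m' (by simp [hm'])) (hmix m (h m (by simp)))
  have h8 : mixedIdx.length = 8 := by simp [mixedIdx, addDir]
  have hS := hsum mixedIdx fun _ h => h
  rw [h8] at hS
  filter_upwards [ae_cell_of_ae_strip hf0, ae_restrict_of_ae (hC₂ α b u E hu (by omega)),
    ae_restrict_mem (measurableSet_cell ℓ)] with x h1 h2 h3
  rw [h1]
  refine (h2 (cell_subset_strip ℓ h3)).trans ?_
  push_cast
  rw [ENNReal.coe_rpow_of_nonneg _ (by norm_num), mul_assoc]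
  refine mul_le_mul' le_rfl (hS.trans (le_of_eq ?_))
  push_cast
  ring

/-! ### Fields -/

section Fields

variable {ι : Type*} [Fintype ι]

/-- Here `S` stands for a squared weighted norm and `K` for the constant comparing energies with it.
In this form the statement serves `X` directly, and `Y` and `Z` with `α + 1` in place of `α`. -/
theorem memSobolev_of_energy {ℓ : Fin 2 → ℝ} (hℓ : ∀ j, 0 < ℓ j) {α : ℝ} (hα : 0 < α) {b : ℕ}
    (hb : α ≤ b) (K : ℝ≥0) : ∃ C : ℝ≥0, ∀ (F : ι → Space → ℝ) (S : ℝ≥0∞), S < ⊤ →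
      (∀ i, AEPeriodic ℓ (F i)) → (∀ i, ∀ m, order m ≤ b → ∃ g, HasWeakD m (F i) g) →
      (∀ i, ∀ m, order m ≤ b → energy ℓ (α + m 2) (weakD m (F i)) ≤ K * S) →
      MemSobolevΩ ℓ (((b : ℝ) - α) / 2) F ∧
        sobolevNorm ℓ (((b : ℝ) - α) / 2) F ≤ C * S ^ (1 / 2 : ℝ) := by
  obtain ⟨C, hC⟩ := sobolevSq_le hℓ hα hb
  refine ⟨(Fintype.card ι * (C * K)) ^ (1 / 2 : ℝ), fun F S hS hF hd hE => ?_⟩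
  have hle : sobolevNorm ℓ (((b : ℝ) - α) / 2) F
      ≤ (((Fintype.card ι * (C * K)) ^ (1 / 2 : ℝ) : ℝ≥0) : ℝ≥0∞) * S ^ (1 / 2 : ℝ) := by
    rw [ENNReal.coe_rpow_of_nonneg _ (by norm_num), ← ENNReal.mul_rpow_of_nonneg _ _ (by norm_num)]
    refine ENNReal.rpow_le_rpow ?_ (by norm_num)
    calc _ ≤ ∑ _i : ι, C * (K * S) :=
          Finset.sum_le_sum fun i _ => hC (F i) (K * S) (hF i) (hd i) (hE i)
      _ = _ := by
          rw [Finset.sum_const, Finset.card_univ, nsmul_eq_mul]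
          push_cast
          ring
  refine ⟨⟨hF, fun i m hm => hd i m (hm.trans ?_), lt_of_le_of_lt hle ?_⟩, hle⟩
  · refine Nat.floor_le_of_le ?_
    have : (0 : ℝ) ≤ b := Nat.cast_nonneg b
    linarith
  · exact ENNReal.mul_lt_top ENNReal.coe_lt_top (ENNReal.rpow_lt_top_of_nonneg (by norm_num) hS.ne)

theorem lInftyBound_of_energy {ℓ : Fin 2 → ℝ} (hℓ : ∀ j, 0 < ℓ j) {α : ℝ} (hα : 0 ≤ α) {b : ℕ}
    (hb : ⌊α⌋₊ + 4 ≤ b) (K : ℝ≥0) : ∃ C : ℝ≥0, ∀ (F : ι → Space → ℝ) (S : ℝ≥0∞), S < ⊤ →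
      (∀ i, AEPeriodic ℓ (F i)) → (∀ i, ∀ m, order m ≤ b → ∃ g, HasWeakD m (F i) g) →
      (∀ i, ∀ m, order m ≤ b → energy ℓ (α + m 2) (weakD m (F i)) ≤ K * S) →
      LInftyBound ℓ F (C * S ^ (1 / 2 : ℝ)) := by
  obtain ⟨C, hC⟩ := enorm_le_of_energy hℓ hα hb
  refine ⟨Fintype.card ι * (C * K ^ (1 / 2 : ℝ)), fun F S hS hF hd hE => ?_⟩
  set R := ((C * K ^ (1 / 2 : ℝ) : ℝ≥0) : ℝ≥0∞) * S ^ (1 / 2 : ℝ) with hR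
  have hRlt : R < ⊤ :=
    ENNReal.mul_lt_top ENNReal.coe_lt_top (ENNReal.rpow_lt_top_of_nonneg (by norm_num) hS.ne)
  have hae : ∀ i, ∀ᵐ x ∂(volume.restrict (cell ℓ)), ‖F i x‖ₑ ≤ R := by
    intro i
    filter_upwards [hC (F i) (K * S) (hF i) (hd i) (hE i)] with x hx
    refine hx.trans (le_of_eq ?_)
    rw [hR, ENNReal.mul_rpow_of_nonneg _ _ (by norm_num)]
    push_cast
    rw [ENNReal.coe_rpow_of_nonneg _ (by norm_num), mul_assoc]
  refine ⟨fun i => ?_, ?_⟩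
  · obtain ⟨g, hg⟩ := hd i 0 (by rw [order_zero]; omega)
    have hm : AEStronglyMeasurable (F i) (volume.restrict (cell ℓ)) :=
      hg.1.aestronglyMeasurable.mono_measure (Measure.restrict_mono (cell_subset_strip ℓ) le_rfl)
    refine ⟨hm, lt_of_le_of_lt ?_ hRlt⟩
    rw [eLpNorm_exponent_top]
    exact eLpNormEssSup_le_of_ae_enorm_bound (hae i)
  · rw [eLpNorm_exponent_top]
    refine eLpNormEssSup_le_of_ae_enorm_bound ?_
    filter_upwards [ae_all_iff.2 hae] with x hx
    have h1 : fieldNorm F x ≤ ∑ i, |F i x| := by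
      refine Real.sqrt_le_iff.2 ⟨Finset.sum_nonneg fun i _ => abs_nonneg _, ?_⟩
      have := Finset.sum_sq_le_sq_sum_of_nonneg (s := Finset.univ) (f := fun i => |F i x|)
        (fun i _ => abs_nonneg _)
      simpa only [sq_abs] using this
    calc ‖fieldNorm F x‖ₑ = ENNReal.ofReal (fieldNorm F x) :=
          Real.enorm_of_nonneg (Real.sqrt_nonneg _)
      _ ≤ ENNReal.ofReal (∑ i, |F i x|) := ENNReal.ofReal_le_ofReal h1
      _ = ∑ i, ‖F i x‖ₑ := by
          rw [ENNReal.ofReal_sum_of_nonneg fun i _ => abs_nonneg _]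
          refine Finset.sum_congr rfl fun i _ => ?_
          rw [← Real.norm_eq_abs, ofReal_norm]
      _ ≤ ∑ _i : ι, R := Finset.sum_le_sum fun i _ => hx i
      _ = _ := by
          rw [Finset.sum_const, Finset.card_univ, nsmul_eq_mul, hR]
          push_cast
          ring

/-! ### Comparison of the energies with the norm of `X` -/

theorem le_sum_multiIdx (T : (Fin 3 → ℕ) → ℝ≥0∞) {b : ℕ} {m : Fin 3 → ℕ} (hm : order m ≤ b) :
    T m ≤ ∑ k ∈ Finset.range (b + 1), ∑ m ∈ multiIdx k, T m :=
  calc T m ≤ ∑ m ∈ multiIdx (order m), T m :=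
        Finset.single_le_sum (f := T) (fun _ _ => zero_le) (mem_multiIdx.2 rfl)
    _ ≤ _ := Finset.single_le_sum (f := fun k => ∑ m ∈ multiIdx k, T m) (fun _ _ => zero_le)
        (Finset.mem_range.2 (by omega))

/-- The weight dominates the distance to the boundary. -/
theorem bdryDist_rpow_le {ℓ : Fin 2 → ℝ} {K : ℝ} (hK : 0 < K) {w : Space → ℝ}
    (hw : IsWeight ℓ K w) {x : Space} (hx : x ∈ strip) {s M : ℝ} (hs : 0 ≤ s) (hsM : s ≤ M) :
    bdryDist x ^ s ≤ max K 1 ^ M * w x ^ s := by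
  have hd := bdryDist_pos hx
  have h1 := hw.lower x hx
  have hw0 : 0 ≤ w x := le_trans (mul_nonneg (inv_nonneg.2 hK.le) hd.le) h1
  -- A base of at least `1` makes the power increasing in the exponent, so one constant with
  -- exponent `M` covers all `s ≤ M`, hence all multi-indices.
  have h2 : bdryDist x ≤ max K 1 * w x := by
    have h3 : bdryDist x ≤ K * w x := by
      rw [inv_mul_le_iff₀ hK] at h1; exact h1
    exact h3.trans (mul_le_mul_of_nonneg_right (le_max_left _ _) hw0)
  have h0 : 0 ≤ max K 1 := hK.le.trans (le_max_left _ _)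
  calc bdryDist x ^ s ≤ (max K 1 * w x) ^ s := Real.rpow_le_rpow hd.le h2 hs
    _ = max K 1 ^ s * w x ^ s := Real.mul_rpow h0 hw0
    _ ≤ _ := mul_le_mul_of_nonneg_right
        (Real.rpow_le_rpow_of_exponent_le (le_max_right _ _) hsM) (Real.rpow_nonneg hw0 _)

theorem IsWeight.nonneg {ℓ : Fin 2 → ℝ} {K : ℝ} (hK : 0 < K) {w : Space → ℝ}
    (hw : IsWeight ℓ K w) {x : Space} (hx : x ∈ strip) : 0 ≤ w x :=
  le_trans (mul_nonneg (inv_nonneg.2 hK.le) (bdryDist_pos hx).le) (hw.lower x hx)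

/-- A comparison of the energy with a weighted integral whose integrand dominates it pointwise. -/
theorem energy_le_of_ae_le (ℓ : Fin 2 → ℝ) {γ : ℝ} {g P : Space → ℝ} (c : ℝ≥0)
    (h : ∀ᵐ x ∂(volume.restrict (cell ℓ)), bdryDist x ^ γ * g x ^ 2 ≤ c * P x) :
    energy ℓ γ g ≤ c * ∫⁻ x in cell ℓ, ENNReal.ofReal (P x) := by
  rw [energy, ← lintegral_const_mul' _ _ ENNReal.coe_ne_top]
  refine lintegral_mono_ae ?_
  filter_upwards [h, ae_restrict_mem (measurableSet_cell ℓ)] with x hx hxc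
  have hd := (bdryDist_pos (cell_subset_strip ℓ hxc)).le
  have e : wt γ x * ‖g x‖ₑ ^ 2 = ENNReal.ofReal (bdryDist x ^ γ * g x ^ 2) := by
    rw [wt, ENNReal.ofReal_mul (Real.rpow_nonneg hd _), ← ofReal_norm,
      ← ENNReal.ofReal_pow (norm_nonneg _), Real.norm_eq_abs, sq_abs]
  rw [e, ← ENNReal.ofReal_coe_nnreal, ← ENNReal.ofReal_mul c.coe_nonneg]
  exact ENNReal.ofReal_le_ofReal hx

theorem energy_le_normX {ℓ : Fin 2 → ℝ} {K : ℝ} (hK : 0 < K) {α : ℝ} (hα : 0 ≤ α) (b : ℕ) :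
    ∃ c : ℝ≥0, ∀ w, IsWeight ℓ K w → ∀ (F : ι → Space → ℝ) i m, order m ≤ b →
      energy ℓ (α + m 2) (weakD m (F i)) ≤ c * ∑ k ∈ Finset.range (b + 1), ∑ m ∈ multiIdx k,
        ∫⁻ x in cell ℓ, ENNReal.ofReal (w x ^ (α + (m 2 : ℝ)) * ∑ i, (weakD m (F i) x) ^ 2) := by
  have hK1 : 0 ≤ max K 1 ^ (α + b) := Real.rpow_nonneg (hK.le.trans (le_max_left _ _)) _
  refine ⟨⟨max K 1 ^ (α + b), hK1⟩, fun w hw F i m hm => ?_⟩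
  refine (energy_le_of_ae_le ℓ ⟨max K 1 ^ (α + b), hK1⟩ (P := fun x =>
    w x ^ (α + (m 2 : ℝ)) * ∑ i, (weakD m (F i) x) ^ 2) ?_).trans
    (mul_le_mul' le_rfl (le_sum_multiIdx (fun m => ∫⁻ x in cell ℓ,
      ENNReal.ofReal (w x ^ (α + (m 2 : ℝ)) * ∑ i, (weakD m (F i) x) ^ 2)) hm))
  filter_upwards [ae_restrict_mem (measurableSet_cell ℓ)] with x hx
  have hxs := cell_subset_strip ℓ hx
  have hmb : (m 2 : ℝ) ≤ b := by exact_mod_cast (apply_le_order m 2).trans hm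
  have h1 := bdryDist_rpow_le hK hw hxs (s := α + m 2) (M := α + b) (by positivity) (by linarith)
  have h2 : weakD m (F i) x ^ 2 ≤ ∑ i, (weakD m (F i) x) ^ 2 :=
    Finset.single_le_sum (f := fun i => (weakD m (F i) x) ^ 2) (fun _ _ => sq_nonneg _)
      (Finset.mem_univ i)
  have h3 := mul_le_mul h1 h2 (sq_nonneg _)
    (mul_nonneg hK1 (Real.rpow_nonneg (hw.nonneg hK hxs) _))
  rw [mul_assoc] at h3
  exact h3

end Fields

/-! ### Matrices near the identity -/

/-- The diagonal product is at least `343/512`, three products contain one diagonal entry and are at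
most `9/512` each, two contain none and are at most `1/512`; `314/512` remains. -/
theorem half_le_det {A : Matrix (Fin 3) (Fin 3) ℝ} (h : ∀ s r, |(A - 1) s r| ≤ 1 / 8) :
    1 / 2 ≤ A.det := by
  have hd : ∀ i, 7 / 8 ≤ A i i ∧ |A i i| ≤ 9 / 8 := by
    intro i
    have := abs_le.1 (h i i)
    rw [Matrix.sub_apply, Matrix.one_apply_eq] at this
    exact ⟨by linarith, abs_le.2 ⟨by linarith, by linarith⟩⟩
  have ho : ∀ i j, i ≠ j → |A i j| ≤ 1 / 8 := by
    intro i j hij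
    simpa [Matrix.sub_apply, Matrix.one_apply_ne hij] using h i j
  have hp : ∀ {x y z p q r : ℝ}, |x| ≤ p → |y| ≤ q → |z| ≤ r → |x * y * z| ≤ p * q * r := by
    intro x y z p q r hx hy hz
    have hp := (abs_nonneg x).trans hx
    have hq := (abs_nonneg y).trans hy
    rw [abs_mul, abs_mul]
    exact mul_le_mul (mul_le_mul hx hy (abs_nonneg _) hp) hz (abs_nonneg _) (mul_nonneg hp hq)
  have h1 : (7 / 8 : ℝ) * (7 / 8) * (7 / 8) ≤ A 0 0 * A 1 1 * A 2 2 :=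
    mul_le_mul (mul_le_mul (hd 0).1 (hd 1).1 (by norm_num) (by linarith [(hd 0).1])) (hd 2).1
      (by norm_num) (mul_nonneg (by linarith [(hd 0).1]) (by linarith [(hd 1).1]))
  have h2 := abs_le.1 (hp (hd 0).2 (ho 1 2 (by decide)) (ho 2 1 (by decide)))
  have h3 := abs_le.1 (hp (ho 0 1 (by decide)) (ho 1 0 (by decide)) (hd 2).2)
  have h4 := abs_le.1 (hp (ho 0 1 (by decide)) (ho 1 2 (by decide)) (ho 2 0 (by decide)))
  have h5 := abs_le.1 (hp (ho 0 2 (by decide)) (ho 1 0 (by decide)) (ho 2 1 (by decide)))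
  have h6 := abs_le.1 (hp (ho 0 2 (by decide)) (hd 1).2 (ho 2 0 (by decide)))
  rw [Matrix.det_fin_three]
  linarith

/-- Summing `|v r| ≤ |L r| + (1/8) ∑ |v s|` over `r` lets the last sum, with factor `3/8`, be
absorbed, so `∑ |v s| ≤ (8/5) ∑ |L r|`. Squaring costs a factor `3`, and `3 · 64/25 ≤ 8`. -/
theorem sq_le_sum_sq_vecMul {A : Matrix (Fin 3) (Fin 3) ℝ} (h : ∀ s r, |(A - 1) s r| ≤ 1 / 8)
    (v : Fin 3 → ℝ) (s : Fin 3) : v s ^ 2 ≤ 8 * ∑ r, (∑ s, A s r * v s) ^ 2 := by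
  set L : Fin 3 → ℝ := fun r => ∑ s, A s r * v s with hL
  have h1 : ∀ r, |v r| ≤ |L r| + ∑ s, 1 / 8 * |v s| := by
    intro r
    have e : v r = L r - ∑ s, (A - 1) s r * v s := by
      simp only [hL, Matrix.sub_apply, sub_mul, Finset.sum_sub_distrib, Matrix.one_apply, ite_mul,
        one_mul, zero_mul, Finset.sum_ite_eq', Finset.mem_univ, if_true]
      ring
    calc |v r| ≤ |L r| + |∑ s, (A - 1) s r * v s| := by
          conv_lhs => rw [e]
          exact abs_sub _ _
      _ ≤ _ := by
          refine add_le_add le_rfl ((Finset.abs_sum_le_sum_abs _ _).trans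
            (Finset.sum_le_sum fun s _ => ?_))
          rw [abs_mul]
          exact mul_le_mul_of_nonneg_right (h s r) (abs_nonneg _)
  have h2 : |v s| ≤ ∑ s, |v s| :=
    Finset.single_le_sum (f := fun s => |v s|) (fun _ _ => abs_nonneg _) (Finset.mem_univ s)
  have h3 : |v s| ≤ 8 / 5 * (|L 0| + |L 1| + |L 2|) := by
    have a0 := h1 0
    have a1 := h1 1
    have a2 := h1 2
    simp only [Fin.sum_univ_three] at a0 a1 a2 h2
    linarith
  rw [Fin.sum_univ_three, ← sq_abs (v s), ← sq_abs (L 0), ← sq_abs (L 1), ← sq_abs (L 2)]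
  have h4 := pow_le_pow_left₀ (abs_nonneg _) h3 2
  nlinarith [sq_nonneg (|L 0| - |L 1|), sq_nonneg (|L 0| - |L 2|), sq_nonneg (|L 1| - |L 2|),
    sq_nonneg |L 0|, sq_nonneg |L 1|, sq_nonneg |L 2|]

/-- Since `det A = 1/J` is at least `1/2`, one has `0 < J ≤ 2`, and the negative power of `J` is
bounded below. A singular `Dη` would give `det A = 0`. -/
theorem one_le_jac_rpow {η : Fin 3 → Space → ℝ} {x : Space} {α : ℝ} (hα : 0 < α)
    (h : ∀ s r, |(invDeformation η x - (1 : Matrix (Fin 3) (Fin 3) ℝ)) s r| ≤ 1 / 8) :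
    1 ≤ (2 : ℝ) ^ (1 / α) * jac η x ^ (-1 / α) := by
  have hd := half_le_det h
  rw [invDeformation, Matrix.det_nonsing_inv, Ring.inverse_eq_inv'] at hd
  have hpos : 0 < jac η x := inv_pos.1 (lt_of_lt_of_le (by norm_num) hd)
  have hle : jac η x ≤ 2 := by
    have := inv_anti₀ (by norm_num) hd
    rwa [inv_inv, one_div, inv_inv] at this
  have e : (-1 : ℝ) / α = -(1 / α) := by ring
  have h1 := Real.rpow_le_rpow_of_nonpos hpos hle
    (show (-1 : ℝ) / α ≤ 0 by rw [e]; exact neg_nonpos.2 (by positivity))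
  calc (1 : ℝ) = (2 : ℝ) ^ (1 / α) * 2 ^ (-1 / α) := by
        rw [← Real.rpow_add two_pos, e, add_neg_cancel, Real.rpow_zero]
    _ ≤ _ := mul_le_mul_of_nonneg_left h1 (Real.rpow_nonneg two_pos.le _)

/-! ### The spaces with a flow map -/

/-- Weak derivatives of the components of the gradient. -/
theorem hasWeakD_grad {ι : Type*} {F : ι → Space → ℝ} {b : ℕ}
    (hF : ∀ i, ∀ m, order m ≤ b → ∀ s, ∃ g, HasWeakD (incr m s) (F i) g) (p : ι × Fin 3)
    {m : Fin 3 → ℕ} (hm : order m ≤ b) :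
    HasWeakD m (grad F p) (weakD (incr m p.2) (F p.1)) :=
  (hasWeakD_weakD (hF p.1 0 (by rw [order_zero]; omega) p.2)).of_incr'
    (hasWeakD_weakD (hF p.1 m hm p.2))

section Flow

variable {ι : Type*} [Fintype ι]

/-- The weight `w^{1+α+m₃} J^{-1/α}` dominates the corresponding power of the distance. -/
theorem bdryDist_rpow_le_jac {ℓ : Fin 2 → ℝ} {K : ℝ} (hK : 0 < K) {α : ℝ} (hα : 0 < α) {b : ℕ}
    {w : Space → ℝ} (hw : IsWeight ℓ K w) {η : Fin 3 → Space → ℝ} {x : Space} (hx : x ∈ strip)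
    (h : ∀ s r, |(invDeformation η x - (1 : Matrix (Fin 3) (Fin 3) ℝ)) s r| ≤ 1 / 8)
    {m : Fin 3 → ℕ} (hm : order m ≤ b) :
    bdryDist x ^ (α + 1 + m 2) ≤ max K 1 ^ (1 + α + b) * (2 : ℝ) ^ (1 / α) *
      (w x ^ (1 + α + (m 2 : ℝ)) * jac η x ^ (-1 / α)) := by
  have hmb : (m 2 : ℝ) ≤ b := by exact_mod_cast (apply_le_order m 2).trans hm
  have h1 := bdryDist_rpow_le hK hw hx (s := 1 + α + m 2) (M := 1 + α + b) (by positivity)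
    (by linarith)
  have h0 : 0 ≤ max K 1 ^ (1 + α + b) * w x ^ (1 + α + (m 2 : ℝ)) :=
    mul_nonneg (Real.rpow_nonneg (hK.le.trans (le_max_left _ _)) _)
      (Real.rpow_nonneg (hw.nonneg hK hx) _)
  rw [add_comm α 1]
  calc _ ≤ max K 1 ^ (1 + α + b) * w x ^ (1 + α + (m 2 : ℝ)) := h1
    _ ≤ max K 1 ^ (1 + α + b) * w x ^ (1 + α + (m 2 : ℝ)) *
        ((2 : ℝ) ^ (1 / α) * jac η x ^ (-1 / α)) := le_mul_of_one_le_right h0 (one_le_jac_rpow hα h)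
    _ = _ := by ring

theorem energy_le_normZ {ℓ : Fin 2 → ℝ} {K : ℝ} (hK : 0 < K) {α : ℝ} (hα : 0 < α) (b : ℕ) :
    ∃ c : ℝ≥0, ∀ w, IsWeight ℓ K w → ∀ η, NearIdentity ℓ η → ∀ (F : ι → Space → ℝ) i m,
      order m ≤ b → energy ℓ (α + 1 + m 2) (weakD m (F i)) ≤
        c * ∑ k ∈ Finset.range (b + 1), ∑ m ∈ multiIdx k, ∫⁻ x in cell ℓ, ENNReal.ofReal
          (w x ^ (1 + α + (m 2 : ℝ)) * jac η x ^ (-1 / α) * ∑ i, (weakD m (F i) x) ^ 2) := by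
  have hc : 0 ≤ max K 1 ^ (1 + α + b) * (2 : ℝ) ^ (1 / α) :=
    mul_nonneg (Real.rpow_nonneg (hK.le.trans (le_max_left _ _)) _) (Real.rpow_nonneg two_pos.le _)
  refine ⟨⟨_, hc⟩, fun w hw η hη F i m hm => ?_⟩
  refine (energy_le_of_ae_le ℓ ⟨_, hc⟩ (P := fun x =>
    w x ^ (1 + α + (m 2 : ℝ)) * jac η x ^ (-1 / α) * ∑ i, (weakD m (F i) x) ^ 2) ?_).trans
    (mul_le_mul' le_rfl (le_sum_multiIdx (fun m => ∫⁻ x in cell ℓ, ENNReal.ofReal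
      (w x ^ (1 + α + (m 2 : ℝ)) * jac η x ^ (-1 / α) * ∑ i, (weakD m (F i) x) ^ 2)) hm))
  filter_upwards [ae_restrict_mem (measurableSet_cell ℓ), hη] with x hx hηx
  have hxs := cell_subset_strip ℓ hx
  have h1 := bdryDist_rpow_le_jac hK hα hw hxs hηx hm
  have h2 : weakD m (F i) x ^ 2 ≤ ∑ i, (weakD m (F i) x) ^ 2 :=
    Finset.single_le_sum (f := fun i => (weakD m (F i) x) ^ 2) (fun _ _ => sq_nonneg _)
      (Finset.mem_univ i)
  have h3 := mul_le_mul h1 h2 (sq_nonneg _)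
    ((Real.rpow_nonneg (bdryDist_pos hxs).le _).trans h1)
  rw [mul_assoc] at h3
  exact h3

/-- The derivative `∂^m` of a component of `DF` is `∂^{m + e_s} Fⁱ`, a component of the vector that
`A` maps to `D_η ∂^m Fⁱ`. As `A` is never differentiated, its closeness to the identity is enough to
invert this at each point. -/
theorem energy_le_normY {ℓ : Fin 2 → ℝ} {K : ℝ} (hK : 0 < K) {α : ℝ} (hα : 0 < α) (b : ℕ) :
    ∃ c : ℝ≥0, ∀ w, IsWeight ℓ K w → ∀ η, NearIdentity ℓ η → ∀ (F : ι → Space → ℝ),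
      (∀ i, ∀ m, order m ≤ b → ∀ s, ∃ g, HasWeakD (incr m s) (F i) g) → ∀ p m,
      order m ≤ b → energy ℓ (α + 1 + m 2) (weakD m (grad F p)) ≤
        c * ∑ k ∈ Finset.range (b + 1), ∑ m ∈ multiIdx k, ∫⁻ x in cell ℓ, ENNReal.ofReal
          (w x ^ (1 + α + (m 2 : ℝ)) * jac η x ^ (-1 / α) *
            ∑ i, ∑ r, (lieGrad η m (F i) r x) ^ 2) := by
  have hc : 0 ≤ max K 1 ^ (1 + α + b) * (2 : ℝ) ^ (1 / α) * 8 :=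
    mul_nonneg (mul_nonneg (Real.rpow_nonneg (hK.le.trans (le_max_left _ _)) _)
      (Real.rpow_nonneg two_pos.le _)) (by norm_num)
  refine ⟨⟨_, hc⟩, fun w hw η hη F hF p m hm => ?_⟩
  rw [energy_congr ℓ _ (hasWeakD_grad hF p hm).weakD_ae_eq]
  refine (energy_le_of_ae_le ℓ ⟨_, hc⟩ (P := fun x =>
    w x ^ (1 + α + (m 2 : ℝ)) * jac η x ^ (-1 / α) *
      ∑ i, ∑ r, (lieGrad η m (F i) r x) ^ 2) ?_).trans
    (mul_le_mul' le_rfl (le_sum_multiIdx (fun m => ∫⁻ x in cell ℓ, ENNReal.ofReal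
      (w x ^ (1 + α + (m 2 : ℝ)) * jac η x ^ (-1 / α) *
        ∑ i, ∑ r, (lieGrad η m (F i) r x) ^ 2)) hm))
  filter_upwards [ae_restrict_mem (measurableSet_cell ℓ), hη] with x hx hηx
  have hxs := cell_subset_strip ℓ hx
  have h1 := bdryDist_rpow_le_jac hK hα hw hxs hηx hm
  have h2 : weakD (incr m p.2) (F p.1) x ^ 2 ≤ 8 * ∑ i, ∑ r, (lieGrad η m (F i) r x) ^ 2 :=
    (sq_le_sum_sq_vecMul hηx (fun s => weakD (incr m s) (F p.1) x) p.2).trans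
      (mul_le_mul_of_nonneg_left (Finset.single_le_sum
        (f := fun i => ∑ r, (lieGrad η m (F i) r x) ^ 2)
        (fun _ _ => Finset.sum_nonneg fun _ _ => sq_nonneg _) (Finset.mem_univ p.1)) (by norm_num))
  refine (mul_le_mul h1 h2 (sq_nonneg _)
    ((Real.rpow_nonneg (bdryDist_pos hxs).le _).trans h1)).trans (le_of_eq ?_)
  change _ = max K 1 ^ (1 + α + b) * (2 : ℝ) ^ (1 / α) * 8 * _
  ring

theorem LInftyBound.mono {ℓ : Fin 2 → ℝ} {F : ι → Space → ℝ} {R R' : ℝ≥0∞}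
    (h : LInftyBound ℓ F R) (hR : R ≤ R') : LInftyBound ℓ F R' :=
  ⟨h.1, h.2.trans hR⟩

theorem lt_top_of_rpow_half {S : ℝ≥0∞} (h : S ^ (1 / 2 : ℝ) < ⊤) : S < ⊤ :=
  (ENNReal.rpow_lt_top_iff_of_pos (by norm_num)).1 h

end Flow

end VacuumEmbedding

/-! ### Assembly of the embeddings -/

theorem lemma3p1 {ι : Type*} [Fintype ι] (ℓ : Fin 2 → ℝ) (hℓ : ∀ j, 0 < ℓ j)
    (K : ℝ) (hK : 0 < K) (α : ℝ) (hα : 0 < α) (b : ℕ) :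
    (⌈α⌉₊ ≤ b → ∃ C : ℝ≥0, ∀ w, VacuumEmbedding.IsWeight ℓ K w →
      ∀ F : ι → VacuumEmbedding.Space → ℝ, VacuumEmbedding.MemX ℓ w α b F →
        VacuumEmbedding.MemSobolevΩ ℓ (((b : ℝ) - α) / 2) F ∧
        VacuumEmbedding.sobolevNorm ℓ (((b : ℝ) - α) / 2) F
          ≤ C * VacuumEmbedding.normX ℓ w α b F) ∧
    (⌊α⌋₊ + 4 ≤ b → ∃ C : ℝ≥0, ∀ w, VacuumEmbedding.IsWeight ℓ K w →
      ∀ F : ι → VacuumEmbedding.Space → ℝ, VacuumEmbedding.MemX ℓ w α b F →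
        VacuumEmbedding.LInftyBound ℓ F (C * VacuumEmbedding.normX ℓ w α b F)) ∧
    (⌈α⌉₊ + 1 ≤ b → ∃ C : ℝ≥0, ∀ w, VacuumEmbedding.IsWeight ℓ K w →
      ∀ η, VacuumEmbedding.IsFlowMap ℓ η → VacuumEmbedding.NearIdentity ℓ η →
      (∀ F : ι → VacuumEmbedding.Space → ℝ, VacuumEmbedding.MemY ℓ w η α b F →
        VacuumEmbedding.MemSobolevΩ ℓ (((b : ℝ) - α - 1) / 2) (VacuumEmbedding.grad F) ∧
        VacuumEmbedding.sobolevNorm ℓ (((b : ℝ) - α - 1) / 2) (VacuumEmbedding.grad F)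
          ≤ C * VacuumEmbedding.normY ℓ w η α b F) ∧
      (∀ F : ι → VacuumEmbedding.Space → ℝ, VacuumEmbedding.MemZ ℓ w η α b F →
        VacuumEmbedding.MemSobolevΩ ℓ (((b : ℝ) - α - 1) / 2) F ∧
        VacuumEmbedding.sobolevNorm ℓ (((b : ℝ) - α - 1) / 2) F
          ≤ C * VacuumEmbedding.normZ ℓ w η α b F)) ∧
    (⌊α⌋₊ + 5 ≤ b → ∃ C : ℝ≥0, ∀ w, VacuumEmbedding.IsWeight ℓ K w →
      ∀ η, VacuumEmbedding.IsFlowMap ℓ η → VacuumEmbedding.NearIdentity ℓ η →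
      (∀ F : ι → VacuumEmbedding.Space → ℝ, VacuumEmbedding.MemY ℓ w η α b F →
        VacuumEmbedding.LInftyBound ℓ (VacuumEmbedding.grad F)
          (C * VacuumEmbedding.normY ℓ w η α b F)) ∧
      (∀ F : ι → VacuumEmbedding.Space → ℝ, VacuumEmbedding.MemZ ℓ w η α b F →
        VacuumEmbedding.LInftyBound ℓ F (C * VacuumEmbedding.normZ ℓ w η α b F))) := by
  have hα1 : 0 < α + 1 := by linarith
  -- The weights in `Y` and `Z` have one more power of `w`, so the theory of `X` is applied with `α
  -- + 1`.
  have hsub : ((b : ℝ) - α - 1) / 2 = ((b : ℝ) - (α + 1)) / 2 := by rw [sub_sub]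
  refine ⟨fun hb => ?_, fun hb => ?_, fun hb => ?_, fun hb => ?_⟩
  · obtain ⟨c, hc⟩ := VacuumEmbedding.energy_le_normX (ι := ι) (ℓ := ℓ) hK hα.le b
    obtain ⟨C, hC⟩ := VacuumEmbedding.memSobolev_of_energy (ι := ι) hℓ hα (Nat.ceil_le.1 hb) c
    exact ⟨C, fun w hw F hF => hC F _ (VacuumEmbedding.lt_top_of_rpow_half hF.2.2) hF.1 hF.2.1
      (hc w hw F)⟩
  · obtain ⟨c, hc⟩ := VacuumEmbedding.energy_le_normX (ι := ι) (ℓ := ℓ) hK hα.le b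
    obtain ⟨C, hC⟩ := VacuumEmbedding.lInftyBound_of_energy (ι := ι) hℓ hα.le hb c
    exact ⟨C, fun w hw F hF => hC F _ (VacuumEmbedding.lt_top_of_rpow_half hF.2.2) hF.1 hF.2.1
      (hc w hw F)⟩
  · have hb1 : α + 1 ≤ b := by
      have h1 := Nat.le_ceil α
      have h2 : ((⌈α⌉₊ + 1 : ℕ) : ℝ) ≤ b := by exact_mod_cast hb
      push_cast at h2
      linarith
    obtain ⟨c, hc⟩ := VacuumEmbedding.energy_le_normY (ι := ι) (ℓ := ℓ) hK hα b
    obtain ⟨C, hC⟩ := VacuumEmbedding.memSobolev_of_energy (ι := ι × Fin 3) hℓ hα1 hb1 c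
    obtain ⟨c', hc'⟩ := VacuumEmbedding.energy_le_normZ (ι := ι) (ℓ := ℓ) hK hα b
    obtain ⟨C', hC'⟩ := VacuumEmbedding.memSobolev_of_energy (ι := ι) hℓ hα1 hb1 c'
    rw [hsub]
    -- A single constant has to serve both the `Y` and the `Z` estimate.
    refine ⟨C + C', fun w hw η _ hη => ⟨fun F hF => ?_, fun F hF => ?_⟩⟩
    · obtain ⟨h1, h2⟩ := hC (VacuumEmbedding.grad F) _
        (VacuumEmbedding.lt_top_of_rpow_half hF.2.2) hF.1
        (fun p m hm => ⟨_, VacuumEmbedding.hasWeakD_grad hF.2.1 p hm⟩) (hc w hw η hη F hF.2.1)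
      exact ⟨h1, h2.trans (mul_le_mul' (by push_cast; exact le_self_add) le_rfl)⟩
    · obtain ⟨h1, h2⟩ := hC' F _ (VacuumEmbedding.lt_top_of_rpow_half hF.2.2) hF.1 hF.2.1
        (hc' w hw η hη F)
      exact ⟨h1, h2.trans (mul_le_mul' (by push_cast; exact le_add_self) le_rfl)⟩
  -- Replacing `α` by `α + 1` raises the floor by one, which turns the threshold `⌊α⌋ + 4` into `⌊α⌋
  -- + 5`.
  · have hb1 : ⌊α + 1⌋₊ + 4 ≤ b := by
      rw [Nat.floor_add_one hα.le]
      omega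
    obtain ⟨c, hc⟩ := VacuumEmbedding.energy_le_normY (ι := ι) (ℓ := ℓ) hK hα b
    obtain ⟨C, hC⟩ := VacuumEmbedding.lInftyBound_of_energy (ι := ι × Fin 3) hℓ hα1.le hb1 c
    obtain ⟨c', hc'⟩ := VacuumEmbedding.energy_le_normZ (ι := ι) (ℓ := ℓ) hK hα b
    obtain ⟨C', hC'⟩ := VacuumEmbedding.lInftyBound_of_energy (ι := ι) hℓ hα1.le hb1 c'
    refine ⟨C + C', fun w hw η _ hη => ⟨fun F hF => ?_, fun F hF => ?_⟩⟩
    · exact (hC (VacuumEmbedding.grad F) _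
        (VacuumEmbedding.lt_top_of_rpow_half hF.2.2) hF.1
        (fun p m hm => ⟨_, VacuumEmbedding.hasWeakD_grad hF.2.1 p hm⟩)
        (hc w hw η hη F hF.2.1)).mono (mul_le_mul' (by push_cast; exact le_self_add) le_rfl)
    · exact (hC' F _ (VacuumEmbedding.lt_top_of_rpow_half hF.2.2) hF.1 hF.2.1
        (hc' w hw η hη F)).mono (mul_le_mul' (by push_cast; exact le_add_self) le_rfl)
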